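/- Let $N\ge 2$, let $\Omega$ be a bounded domain (nonempty, open, connected) in $\mathbb R^N$ of class $C^1$, let $\tau>0$, and let $\rho\in L^\infty(\partial\Omega)$ with $\operatorname{ess\,inf}_{\partial\Omega}\rho>0$, where $\partial\Omega$ carries the surface measure $\sigma$. For $u,v\in H^2(\Omega)$ put $$\langle u,v\rangle=\int_\Omega D^2u:D^2v+\tau\,\nabla u\cdot\nabla v\,dx ,$$ and consider the weak biharmonic Steklov problem: find $\lambda\in\mathbb R$ and $u\in H^2(\Omega)$ such that $$\langle u,\varphi\rangle=\lambda\int_{\partial\Omega}\rho\,u\,\varphi\,d\sigma\qquad\text{for all }\varphi\in H^2(\Omega). \tag{1}$$ A number $\lambda$ is an eigenvalue of (1) if (1) has a solution $u\ne0$; its multiplicity is the dimension of the space of solutions $u$. Let $\mathrm{Tr}:H^2(\Omega)\to L^2(\partial\Omega)$ be the trace operator, let $p:H^2(\Omega)\to H^2(\Omega)/\mathbb R$ be the projection modulo constants, and endow $H^2(\Omega)/\mathbb R$ with the form induced by $\langle\cdot,\cdot\rangle$. Let $H^{2,\mathcal S}_\rho(\Omega)=\{u\in H^2(\Omega):\int_{\partial\Omega}\rho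 u\,d\sigma=0\}$ and $F(\Omega)=\{G\in H^2(\Omega)':G[1]=0\}$. Define $\mathcal P^{\mathcal S}_\rho:H^{2,\mathcal S}_\rho(\Omega)\to F(\Omega)$ by $\mathcal P^{\mathcal S}_\rho[u][\varphi]=\langle u,\varphi\rangle$, define $\mathcal J^{\mathcal S}_\rho:L^2(\partial\Omega)\to H^2(\Omega)'$ by $\mathcal J^{\mathcal S}_\rho[u][\varphi]=\int_{\partial\Omega}\rho u\varphi\,d\sigma$, put $\pi^{\mathcal S}_\rho[u]=u-\int_{\partial\Omega}\rho u\,d\sigma\big/\int_{\partial\Omega}\rho\,d\sigma$, and let $\pi^{\sharp,\mathcal S}_\rho:H^2(\Omega)/\mathbb R\to H^{2,\mathcal S}_\rho(\Omega)$ be the map with $\pi^{\mathcal S}_\rho=\pi^{\sharp,\mathcal S}_\rho\circ p$. Let $$T^{\mathcal S}_\rho=(\pi^{\sharp,\mathcal S}_\rho)^{-1}\circ(\mathcal P^{\mathcal S}_\rho)^{-1}\circ\mathcal J^{\mathcal S}_\rho\circ\mathrm{Tr}\circ\pi^{\sharp,\mathcal S}_\rho .$$ Then these objects are well defined: restrictions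 of functions in $C^\infty(\mathbb R^N)$ are dense in $H^1(\Omega)$, and restriction to $\partial\Omega$ extends from them to the continuous trace operator; $H^2(\Omega)/\mathbb R$ is a Hilbert space; $\pi^{\sharp,\mathcal S}_\rho$ is well defined and bijective onto $H^{2,\mathcal S}_\rho(\Omega)$; and $\mathcal P^{\mathcal S}_\rho$ is bijective onto $F(\Omega)$. Moreover: 1. $T^{\mathcal S}_\rho$ is a non-negative, compact, selfadjoint bounded linear operator on $H^2(\Omega)/\mathbb R$, and a real number $\mu\neq0$ is an eigenvalue of $T^{\mathcal S}_\rho$ if and only if $\mu=\lambda^{-1}$ for some positive eigenvalue $\lambda$ of (1). 2. All eigenvalues of (1) lie in $[0,+\infty)$ and have finite multiplicity, and, repeated according to multiplicity, they form a sequence $\lambda_1\le\lambda_2\le\cdots\le\lambda_j\le\cdots$ with $\lambda_j\to+\infty$. 3. $\lambda_1=0$, this eigenvalue has multiplicity one, its eigenspace consists exactly of the constant functions, and $\lambda_2>0$. -/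

import Mathlib

open MeasureTheory Set Filter Topology
open scoped NNReal ContDiff RealInnerProductSpace

noncomputable section

namespace BiharmonicSteklov

/-! ### Domains and surface measure -/

/-- The Euclidean space `ℝ^N`. -/
abbrev Space (N : ℕ) : Type := EuclideanSpace ℝ (Fin N)

/-- The boundary of `Ω` is of class `C¹`: near each of its points, in the direction of a suitable
unit vector `e`, the set `Ω` is the strict subgraph of a `C¹` function of the remaining `N - 1`
coordinates (the component `y - ⟪y, e⟫ e` of `y` orthogonal to `e`). -/
def HasC1Boundary {N : ℕ} (Ω : Set (Space N)) : Prop :=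
  ∀ x ∈ frontier Ω, ∃ r : ℝ, 0 < r ∧ ∃ e : Space N, ‖e‖ = 1 ∧ ∃ γ : Space N → ℝ,
    ContDiff ℝ 1 γ ∧ ∀ y ∈ Metric.ball x r, y ∈ Ω ↔ ⟪y, e⟫ < γ (y - ⟪y, e⟫ • e)

/-- A bounded domain (bounded connected nonempty open set) in `ℝ^N` of class `C¹`. -/
structure BoundedC1Domain (N : ℕ) where
  carrier : Set (Space N)
  isOpen : IsOpen carrier
  isConnected : IsConnected carrier
  isBounded : Bornology.IsBounded carrier
  hasC1Boundary : HasC1Boundary carrier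

variable {N : ℕ}

/-- Lebesgue measure on `Ω`. -/
def BoundedC1Domain.vol (Ω : BoundedC1Domain N) : Measure (Space N) :=
  volume.restrict Ω.carrier

/-- The surface measure `σ` on `∂Ω`: the `(N-1)`-dimensional Hausdorff measure, normalised so as
to agree with Lebesgue measure on `(N-1)`-dimensional Euclidean spaces. -/
def BoundedC1Domain.surf (Ω : BoundedC1Domain N) : Measure (Space N) :=
  (μHE[N - 1] : Measure (Space N)).restrict (frontier Ω.carrier)

lemma BoundedC1Domain.isCompact_closure (Ω : BoundedC1Domain N) :
    IsCompact (closure Ω.carrier) :=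
  Ω.isBounded.isCompact_closure

lemma BoundedC1Domain.isCompact_frontier (Ω : BoundedC1Domain N) :
    IsCompact (frontier Ω.carrier) :=
  Ω.isCompact_closure.of_isClosed_subset isClosed_frontier frontier_subset_closure

instance (Ω : BoundedC1Domain N) : IsFiniteMeasure Ω.vol :=
  ⟨by
    rw [BoundedC1Domain.vol, Measure.restrict_apply_univ]
    exact Ω.isBounded.measure_lt_top⟩

lemma frontier_subset_graph {Ω : Set (Space N)} (hΩ : IsOpen Ω) {x e : Space N} {r : ℝ}
    {γ : Space N → ℝ} (hγ : ContDiff ℝ 1 γ)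
    (h : ∀ y ∈ Metric.ball x r, y ∈ Ω ↔ ⟪y, e⟫ < γ (y - ⟪y, e⟫ • e))
    {y : Space N} (hy : y ∈ frontier Ω) (hyr : y ∈ Metric.ball x r) :
    ⟪y, e⟫ = γ (y - ⟪y, e⟫ • e) := by
  have hyn : y ∉ Ω := by
    rw [hΩ.frontier_eq] at hy
    exact hy.2
  have h1 : γ (y - ⟪y, e⟫ • e) ≤ ⟪y, e⟫ := by
    by_contra! h2
    exact hyn ((h y hyr).2 h2)
  refine le_antisymm ?_ h1
  by_contra! h2
  have hc1 : Continuous fun z : Space N => γ (z - ⟪z, e⟫ • e) := by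
    have := hγ.continuous
    fun_prop
  have hc2 : Continuous fun z : Space N => ⟪z, e⟫ := by fun_prop
  have hopen : IsOpen ({z : Space N | γ (z - ⟪z, e⟫ • e) < ⟪z, e⟫} ∩ Metric.ball x r) :=
    (isOpen_lt hc1 hc2).inter Metric.isOpen_ball
  obtain ⟨z, ⟨hz1, hz2⟩, hz3⟩ :=
    mem_closure_iff.1 (frontier_subset_closure hy) _ hopen ⟨h2, hyr⟩
  exact absurd ((h z hz2).1 hz3) (not_lt.2 (le_of_lt hz1))

lemma surface_finiteAt {Ω : Set (Space N)} (hΩ : IsOpen Ω) (hb : HasC1Boundary Ω)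
    {x : Space N} (hx : x ∈ frontier Ω) :
    (μHE[N - 1] : Measure (Space N)).FiniteAtFilter (𝓝[frontier Ω] x) := by
  obtain ⟨r, hr, e, he, γ, hγ, h⟩ := hb x hx
  set P : Space N → Space N := fun y => y - ⟪y, e⟫ • e with hP
  have hPc : Continuous P := by fun_prop
  obtain ⟨K, t, ht, hK⟩ := (hγ.contDiffAt (x := P x)).exists_lipschitzOnWith
  let W : Submodule ℝ (Space N) := (Submodule.span ℝ {e})ᗮ
  have hfin : Module.finrank ℝ W = N - 1 := by
    have h1 := Submodule.finrank_add_finrank_orthogonal (Submodule.span ℝ {e})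
    have h2 : Module.finrank ℝ (Submodule.span ℝ {e}) = 1 :=
      finrank_span_singleton (by rintro rfl; simp at he)
    rw [h2, finrank_euclideanSpace_fin] at h1
    change Module.finrank ℝ (Submodule.span ℝ {e})ᗮ = N - 1
    omega
  let G : W → Space N := fun w => (w : Space N) + γ w • e
  let t' : Set W := {w | (w : Space N) ∈ t ∩ Metric.closedBall (P x) 1}
  have hG : LipschitzOnWith (1 + K) G t' := by
    apply LipschitzOnWith.of_dist_le_mul
    intro a ha b hb
    have h1 : dist (γ a) (γ b) ≤ K * dist (a : Space N) b := hK.dist_le_mul _ ha.1 _ hb.1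
    calc dist (G a) (G b) ≤ dist (a : Space N) b + dist (γ a • e) (γ b • e) :=
          dist_add_add_le _ _ _ _
      _ = dist (a : Space N) b + dist (γ a) (γ b) := by
          congr 1
          rw [dist_eq_norm, ← sub_smul, norm_smul, he, mul_one, dist_eq_norm]
      _ ≤ _ := by
          push_cast
          rw [Subtype.dist_eq]
          linarith
  have hfinite : (μH[((N - 1 : ℕ) : ℝ)] : Measure W) t' < ⊤ := by
    rw [← hfin]
    have : t' ⊆ (Subtype.val ⁻¹' Metric.closedBall (P x) 1 : Set W) := fun w hw => hw.2
    refine lt_of_le_of_lt (measure_mono this) (Bornology.IsBounded.measure_lt_top ?_)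
    exact AntilipschitzWith.isBounded_preimage
      (K := 1) (f := (Subtype.val : W → Space N)) (AntilipschitzWith.subtype_coe _)
      Metric.isBounded_closedBall
  have himage : (μHE[N - 1] : Measure (Space N)) (G '' t') < ⊤ := by
    rw [Measure.euclideanHausdorffMeasure_def, Measure.smul_apply]
    have h1 := hG.hausdorffMeasure_image_le (d := ((N - 1 : ℕ) : ℝ)) (by positivity)
    have h2 : (μH[((N - 1 : ℕ) : ℝ)] : Measure (Space N)) (G '' t') < ⊤ := by
      refine lt_of_le_of_lt h1 (ENNReal.mul_lt_top ?_ hfinite)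
      exact ENNReal.rpow_lt_top_of_nonneg (by positivity) (by simp)
    rw [ENNReal.smul_def, smul_eq_mul]
    exact ENNReal.mul_lt_top (by simp) h2
  have hU : P ⁻¹' (t ∩ Metric.closedBall (P x) 1) ∩ Metric.ball x r ∈ 𝓝 x :=
    inter_mem (hPc.continuousAt.preimage_mem_nhds
      (inter_mem ht (Metric.closedBall_mem_nhds _ one_pos))) (Metric.ball_mem_nhds _ hr)
  refine ⟨_, inter_mem (mem_nhdsWithin_of_mem_nhds hU) self_mem_nhdsWithin,
    lt_of_le_of_lt (measure_mono ?_) himage⟩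
  rintro y ⟨⟨hy1, hy2⟩, hy3⟩
  have hPy : P y ∈ W := by
    rw [Submodule.mem_orthogonal_singleton_iff_inner_left]
    simp [hP, inner_sub_left, real_inner_smul_left, he]
  refine ⟨⟨P y, hPy⟩, hy1, ?_⟩
  have := frontier_subset_graph hΩ hγ h hy3 hy2
  change P y + γ (P y) • e = y
  rw [← this]
  simp [hP]

instance (Ω : BoundedC1Domain N) : IsFiniteMeasure Ω.surf :=
  ⟨by
    rw [BoundedC1Domain.surf, Measure.restrict_apply_univ]
    exact Ω.isCompact_frontier.measure_lt_top_of_nhdsWithin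
      fun x hx => surface_finiteAt Ω.isOpen Ω.hasC1Boundary hx⟩

/-- The real Hilbert space `L²(Ω)`. -/
abbrev L2 (Ω : BoundedC1Domain N) : Type := Lp ℝ 2 Ω.vol

/-- The real Hilbert space `L²(∂Ω)`. -/
abbrev L2Bdry (Ω : BoundedC1Domain N) : Type := Lp ℝ 2 Ω.surf

/-! ### Weak derivatives and Sobolev spaces -/

/-- The classical partial derivative `∂φ/∂x_i`. -/
def partialDeriv (i : Fin N) (φ : Space N → ℝ) (x : Space N) : ℝ :=
  fderiv ℝ φ x (EuclideanSpace.single i 1)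

/-- Test functions `φ ∈ C_c^∞(Ω)`. -/
structure IsTestFunction (Ω : BoundedC1Domain N) (φ : Space N → ℝ) : Prop where
  smooth : ContDiff ℝ ∞ φ
  hasCompactSupport : HasCompactSupport φ
  tsupport_subset : tsupport φ ⊆ Ω.carrier

/-- `v` is the weak (distributional) partial derivative `∂u/∂x_i` in `Ω`. -/
def IsWeakPartial (Ω : BoundedC1Domain N) (i : Fin N) (u v : L2 Ω) : Prop :=
  ∀ φ : Space N → ℝ, IsTestFunction Ω φ →
    ∫ x, u x * partialDeriv i φ x ∂Ω.vol = - ∫ x, v x * φ x ∂Ω.vol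

lemma continuous_partialDeriv {φ : Space N → ℝ} (hφ : ContDiff ℝ ∞ φ) (i : Fin N) :
    Continuous (partialDeriv i φ) :=
  (hφ.continuous_fderiv (by simp)).clm_apply continuous_const

/-- A continuous function is in every `L^p(Ω)`. -/
lemma memLp_vol (Ω : BoundedC1Domain N) {f : Space N → ℝ} (hf : Continuous f) (p : ENNReal) :
    MemLp f p Ω.vol := by
  obtain ⟨C, hC⟩ := Ω.isCompact_closure.exists_bound_of_continuousOn hf.continuousOn
  refine MemLp.of_bound hf.aestronglyMeasurable C ?_
  exact (ae_restrict_iff' Ω.isOpen.measurableSet).2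
    (Eventually.of_forall fun x hx => hC x (subset_closure hx))

/-- The restriction of a continuous function to `∂Ω` is in every `L^p(∂Ω)`. -/
lemma memLp_surf (Ω : BoundedC1Domain N) {f : Space N → ℝ} (hf : Continuous f) (p : ENNReal) :
    MemLp f p Ω.surf := by
  obtain ⟨C, hC⟩ := Ω.isCompact_frontier.exists_bound_of_continuousOn hf.continuousOn
  refine MemLp.of_bound hf.aestronglyMeasurable C ?_
  exact (ae_restrict_iff' isClosed_frontier.measurableSet).2 (Eventually.of_forall hC)

lemma integrable_L2_mul (Ω : BoundedC1Domain N) (u : L2 Ω) {f : Space N → ℝ}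
    (hf : Continuous f) : Integrable (fun x => u x * f x) Ω.vol :=
  (Lp.memLp u).integrable_mul (memLp_vol Ω hf 2)

lemma IsWeakPartial.zero (Ω : BoundedC1Domain N) (i : Fin N) : IsWeakPartial Ω i 0 0 := by
  intro φ _
  have h : ∀ f : Space N → ℝ, ∫ x, (0 : L2 Ω) x * f x ∂Ω.vol = 0 := fun f => by
    refine integral_eq_zero_of_ae ?_
    filter_upwards [Lp.coeFn_zero ℝ 2 Ω.vol] with x hx
    rw [hx]
    simp
  rw [h, h, neg_zero]

lemma IsWeakPartial.add {Ω : BoundedC1Domain N} {i : Fin N} {u v u' v' : L2 Ω}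
    (h : IsWeakPartial Ω i u v) (h' : IsWeakPartial Ω i u' v') :
    IsWeakPartial Ω i (u + u') (v + v') := by
  intro φ hφ
  have key : ∀ (a b : L2 Ω) {f : Space N → ℝ}, Continuous f →
      ∫ x, (a + b : L2 Ω) x * f x ∂Ω.vol = ∫ x, a x * f x ∂Ω.vol + ∫ x, b x * f x ∂Ω.vol := by
    intro a b f hf
    rw [← integral_add (integrable_L2_mul Ω a hf) (integrable_L2_mul Ω b hf)]
    refine integral_congr_ae ?_
    filter_upwards [Lp.coeFn_add a b] with x hx
    rw [hx, Pi.add_apply, add_mul]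
  rw [key _ _ (continuous_partialDeriv hφ.smooth i), key _ _ hφ.smooth.continuous, h φ hφ, h' φ hφ]
  ring

lemma IsWeakPartial.smul {Ω : BoundedC1Domain N} {i : Fin N} {u v : L2 Ω}
    (c : ℝ) (h : IsWeakPartial Ω i u v) : IsWeakPartial Ω i (c • u) (c • v) := by
  intro φ hφ
  have key : ∀ (a : L2 Ω) (f : Space N → ℝ),
      ∫ x, (c • a : L2 Ω) x * f x ∂Ω.vol = c * ∫ x, a x * f x ∂Ω.vol := by
    intro a f
    rw [← integral_const_mul]
    refine integral_congr_ae ?_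
    filter_upwards [Lp.coeFn_smul c a] with x hx
    rw [hx, Pi.smul_apply, smul_eq_mul, mul_assoc]
  rw [key, key, h φ hφ]
  ring

/-- The space of all `(u, (∂_1 u, …, ∂_N u))` with `u ∈ L²(Ω)` and weak derivatives
`∂_i u ∈ L²(Ω)`. -/
def H1Sub (Ω : BoundedC1Domain N) :
    Submodule ℝ (WithLp 2 (L2 Ω × PiLp 2 fun _ : Fin N => L2 Ω)) where
  carrier := {U | ∀ i, IsWeakPartial Ω i U.fst (U.snd i)}
  zero_mem' := fun i => IsWeakPartial.zero Ω i
  add_mem' := fun h h' i => (h i).add (h' i)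
  smul_mem' := fun c _ h i => (h i).smul c

/-- The Sobolev space `H¹(Ω)`, each `u` being given together with its weak derivatives (which `u`
determines), with the squared norm `‖u‖² + ∑_i ‖∂_i u‖²`. -/
def H1 (Ω : BoundedC1Domain N) : Type := H1Sub Ω

instance (Ω : BoundedC1Domain N) : NormedAddCommGroup (H1 Ω) :=
  inferInstanceAs (NormedAddCommGroup (H1Sub Ω))

instance (Ω : BoundedC1Domain N) : InnerProductSpace ℝ (H1 Ω) :=
  inferInstanceAs (InnerProductSpace ℝ (H1Sub Ω))

/-- The weak derivative `∂_i : H¹(Ω) → L²(Ω)`. -/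
def H1.grad (Ω : BoundedC1Domain N) (i : Fin N) : H1 Ω →L[ℝ] L2 Ω :=
  ((PiLp.proj 2 (fun _ : Fin N => L2 Ω) i).comp
    (WithLp.sndL 2 ℝ (L2 Ω) (PiLp 2 fun _ : Fin N => L2 Ω))).comp (H1Sub Ω).subtypeL

/-- The space of all `(u, (∂_i ∂_j u)_{i,j})` with `u ∈ H¹(Ω)` and weak derivatives
`∂_i ∂_j u ∈ L²(Ω)`. -/
def H2Sub (Ω : BoundedC1Domain N) :
    Submodule ℝ (WithLp 2 (H1 Ω × PiLp 2 fun _ : Fin N × Fin N => L2 Ω)) where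
  carrier := {U | ∀ i j, IsWeakPartial Ω i (H1.grad Ω j U.fst) (U.snd (i, j))}
  zero_mem' := fun i _ => IsWeakPartial.zero Ω i
  add_mem' := fun h h' i j => (h i j).add (h' i j)
  smul_mem' := fun c _ h i j => (h i j).smul c

/-- The Sobolev space `H²(Ω)`, each `u` being given together with its weak derivatives of first
and second order in `L²(Ω)` (which `u` determines), with the squared norm
`‖u‖² + ∑_i ‖∂_i u‖² + ∑_{i,j} ‖∂_i ∂_j u‖²`. -/
def H2 (Ω : BoundedC1Domain N) : Type := H2Sub Ω

instance (Ω : BoundedC1Domain N) : NormedAddCommGroup (H2 Ω) :=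
  inferInstanceAs (NormedAddCommGroup (H2Sub Ω))

instance (Ω : BoundedC1Domain N) : InnerProductSpace ℝ (H2 Ω) :=
  inferInstanceAs (InnerProductSpace ℝ (H2Sub Ω))

/-- The inclusion of `H²(Ω)` in `H¹(Ω)`. -/
def H2.toH1 (Ω : BoundedC1Domain N) : H2 Ω →L[ℝ] H1 Ω :=
  (WithLp.fstL 2 ℝ (H1 Ω) (PiLp 2 fun _ : Fin N × Fin N => L2 Ω)).comp (H2Sub Ω).subtypeL

/-- The weak derivative `∂_i : H²(Ω) → L²(Ω)`. -/
def H2.grad (Ω : BoundedC1Domain N) (i : Fin N) : H2 Ω →L[ℝ] L2 Ω :=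
  (H1.grad Ω i).comp (H2.toH1 Ω)

/-- The weak derivative `∂_i ∂_j : H²(Ω) → L²(Ω)`. -/
def H2.hess (Ω : BoundedC1Domain N) (i j : Fin N) : H2 Ω →L[ℝ] L2 Ω :=
  ((PiLp.proj 2 (fun _ : Fin N × Fin N => L2 Ω) (i, j)).comp
    (WithLp.sndL 2 ℝ (H1 Ω) (PiLp 2 fun _ : Fin N × Fin N => L2 Ω))).comp (H2Sub Ω).subtypeL

lemma isWeakPartial_toLp (Ω : BoundedC1Domain N) (i : Fin N) {f : Space N → ℝ}
    (hf : ContDiff ℝ ∞ f) :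
    IsWeakPartial Ω i ((memLp_vol Ω hf.continuous 2).toLp f)
      ((memLp_vol Ω (continuous_partialDeriv hf i) 2).toLp (partialDeriv i f)) := by
  intro φ hφ
  have hcd := continuous_partialDeriv hφ.smooth i
  have hsupp : Function.support (partialDeriv i φ) ⊆ tsupport φ := by
    intro x hx
    apply support_fderiv_subset ℝ
    intro h0
    exact hx (by simp [partialDeriv, h0])
  have hcs : HasCompactSupport (partialDeriv i φ) :=
    hφ.hasCompactSupport.mono' hsupp
  have h1 : ∀ {g ψ : Space N → ℝ} (hg : MemLp g 2 Ω.vol),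
      Function.support ψ ⊆ tsupport φ →
      ∫ x, (hg.toLp g) x * ψ x ∂Ω.vol = ∫ x, g x * ψ x := by
    intro g ψ hg hψ
    have : ∫ x, (hg.toLp g) x * ψ x ∂Ω.vol = ∫ x, g x * ψ x ∂Ω.vol := by
      refine integral_congr_ae ?_
      filter_upwards [hg.coeFn_toLp] with x hx
      rw [hx]
    rw [this]
    refine setIntegral_eq_integral_of_forall_compl_eq_zero fun x hx => ?_
    have : ψ x = 0 := by
      by_contra h
      exact hx (hφ.tsupport_subset (hψ h))
    simp [this]
  rw [h1 _ hsupp, h1 _ (subset_tsupport φ)]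
  have hfc := hf.continuous
  have hfd := continuous_partialDeriv hf i
  have hφc := hφ.smooth.continuous
  exact integral_mul_fderiv_eq_neg_fderiv_mul_of_integrable
    ((hfd.mul hφc).integrable_of_hasCompactSupport hφ.hasCompactSupport.mul_left)
    ((hfc.mul hcd).integrable_of_hasCompactSupport hcs.mul_left)
    ((hfc.mul hφc).integrable_of_hasCompactSupport hφ.hasCompactSupport.mul_left)
    (fun x _ => (hf.differentiable (by simp)).differentiableAt)
    (fun x _ => (hφ.smooth.differentiable (by simp)).differentiableAt)

/-! ### The trace operator -/

/-- The space `C^∞(ℝ^N)`. -/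
def smoothFunctions (N : ℕ) : Submodule ℝ (Space N → ℝ) where
  carrier := {f | ContDiff ℝ ∞ f}
  zero_mem' := (contDiff_const : ContDiff ℝ ∞ fun _ : Space N => (0 : ℝ))
  add_mem' := fun {a b} (h : ContDiff ℝ ∞ a) (h' : ContDiff ℝ ∞ b) => h.add h'
  smul_mem' := fun c a (h : ContDiff ℝ ∞ a) => (contDiff_const (c := c)).smul h

lemma smoothFunctions.contDiff (f : smoothFunctions N) : ContDiff ℝ ∞ (f : Space N → ℝ) := f.2

lemma partialDeriv_add {f g : Space N → ℝ} (hf : ContDiff ℝ ∞ f) (hg : ContDiff ℝ ∞ g)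
    (i : Fin N) : partialDeriv i (f + g) = partialDeriv i f + partialDeriv i g := by
  funext x
  have h := fderiv_add (𝕜 := ℝ) (hf.differentiable (by simp)).differentiableAt
    (hg.differentiable (by simp)).differentiableAt (x := x)
  simp [partialDeriv, h]

lemma partialDeriv_smul {f : Space N → ℝ} (hf : ContDiff ℝ ∞ f) (c : ℝ)
    (i : Fin N) : partialDeriv i (c • f) = c • partialDeriv i f := by
  funext x
  have h := fderiv_const_smul (𝕜 := ℝ) (hf.differentiable (by simp)).differentiableAt c (x := x)
  simp [partialDeriv, h]

/-- Restriction of a smooth function and its partial derivatives to `Ω`, in `H¹(Ω)`. -/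
def toH1Fun (Ω : BoundedC1Domain N) {f : Space N → ℝ} (hf : ContDiff ℝ ∞ f) : H1 Ω :=
  ⟨WithLp.toLp 2 ((memLp_vol Ω hf.continuous 2).toLp f,
      WithLp.toLp 2 fun i => (memLp_vol Ω (continuous_partialDeriv hf i) 2).toLp (partialDeriv i f)),
    fun i => isWeakPartial_toLp Ω i hf⟩

lemma H1.ext' {Ω : BoundedC1Domain N} {u v : H1 Ω} (h : u.1.fst = v.1.fst)
    (h' : ∀ i, u.1.snd i = v.1.snd i) : u = v :=
  Subtype.ext (WithLp.ofLp_injective 2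
    (Prod.ext h (WithLp.ofLp_injective 2 (funext h'))))

/-- Restriction of smooth functions to `Ω`, as elements of `H¹(Ω)`. -/
def smoothToH1 (Ω : BoundedC1Domain N) : smoothFunctions N →ₗ[ℝ] H1 Ω where
  toFun f := toH1Fun Ω (smoothFunctions.contDiff f)
  map_add' f g := by
    have hf := smoothFunctions.contDiff f
    have hg := smoothFunctions.contDiff g
    refine H1.ext' (MemLp.toLp_add (memLp_vol Ω hf.continuous 2) (memLp_vol Ω hg.continuous 2))
      fun i => ?_
    have hf' := memLp_vol Ω (continuous_partialDeriv hf i) 2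
    have hg' := memLp_vol Ω (continuous_partialDeriv hg i) 2
    have hfg' := memLp_vol Ω (continuous_partialDeriv (smoothFunctions.contDiff (f + g)) i) 2
    refine Eq.trans (MemLp.toLp_congr hfg' (hf'.add hg') ?_) (MemLp.toLp_add hf' hg')
    exact Eventually.of_forall fun x => congrFun (partialDeriv_add hf hg i) x
  map_smul' c f := by
    have hf := smoothFunctions.contDiff f
    refine H1.ext' (MemLp.toLp_const_smul c (memLp_vol Ω hf.continuous 2)) fun i => ?_
    have hf' := memLp_vol Ω (continuous_partialDeriv hf i) 2
    have hcf' := memLp_vol Ω (continuous_partialDeriv (smoothFunctions.contDiff (c • f)) i) 2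
    refine Eq.trans (MemLp.toLp_congr hcf' (hf'.const_smul c) ?_) (MemLp.toLp_const_smul c hf')
    exact Eventually.of_forall fun x => congrFun (partialDeriv_smul hf c i) x

/-- Restriction of smooth functions to `∂Ω`, as elements of `L²(∂Ω)`. -/
def smoothToBdry (Ω : BoundedC1Domain N) : smoothFunctions N →ₗ[ℝ] L2Bdry Ω where
  toFun f := (memLp_surf Ω (smoothFunctions.contDiff f).continuous 2).toLp (f : Space N → ℝ)
  map_add' _ _ := MemLp.toLp_add _ _
  map_smul' c _ := MemLp.toLp_const_smul c _

/-- The trace operator `H¹(Ω) → L²(∂Ω)`: the unique continuous linear operator which on the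
(dense) subspace of functions smooth up to the boundary is the restriction to `∂Ω`. -/
def traceH1 (Ω : BoundedC1Domain N) : H1 Ω →L[ℝ] L2Bdry Ω :=
  (smoothToBdry Ω).extendOfNorm (smoothToH1 Ω)

/-- The trace operator `Tr : H²(Ω) → L²(∂Ω)`. -/
def trace (Ω : BoundedC1Domain N) : H2 Ω →L[ℝ] L2Bdry Ω :=
  (traceH1 Ω).comp (H2.toH1 Ω)

/-! ### The bilinear form and the weak Steklov problem -/

/-- The bilinear form `⟨u, v⟩ = ∫_Ω D²u : D²v + τ ∇u · ∇v dx` on `H²(Ω)`. -/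
def form (Ω : BoundedC1Domain N) (τ : ℝ≥0) (u v : H2 Ω) : ℝ :=
  ∫ x, ((∑ i, ∑ j, H2.hess Ω i j u x * H2.hess Ω i j v x)
    + τ * ∑ i, H2.grad Ω i u x * H2.grad Ω i v x) ∂Ω.vol

/-- The form as a continuous bilinear form on `H²(Ω)`; see `formL_apply`. -/
def formL (Ω : BoundedC1Domain N) (τ : ℝ≥0) : H2 Ω →L[ℝ] H2 Ω →L[ℝ] ℝ :=
  (∑ i, ∑ j, (innerSL ℝ : L2 Ω →L[ℝ] L2 Ω →L[ℝ] ℝ).bilinearComp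
      (H2.hess Ω i j) (H2.hess Ω i j))
    + (τ : ℝ) • ∑ i, (innerSL ℝ : L2 Ω →L[ℝ] L2 Ω →L[ℝ] ℝ).bilinearComp
      (H2.grad Ω i) (H2.grad Ω i)

lemma formL_eq_inner (Ω : BoundedC1Domain N) (τ : ℝ≥0) (u v : H2 Ω) :
    formL Ω τ u v = (∑ i, ∑ j, inner ℝ (H2.hess Ω i j u) (H2.hess Ω i j v))
      + τ * ∑ i, inner ℝ (H2.grad Ω i u) (H2.grad Ω i v) := by
  simp [formL, sum_apply]

lemma formL_apply (Ω : BoundedC1Domain N) (τ : ℝ≥0) (u v : H2 Ω) :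
    formL Ω τ u v = form Ω τ u v := by
  have hint : ∀ a b : L2 Ω, Integrable (fun x => a x * b x) Ω.vol := fun a b =>
    (Lp.memLp a).integrable_mul (Lp.memLp b)
  have hin : ∀ a b : L2 Ω, inner ℝ a b = ∫ x, a x * b x ∂Ω.vol := fun a b => by
    rw [L2.inner_def]
    exact integral_congr_ae (Eventually.of_forall fun x => by simp [mul_comm])
  rw [formL_eq_inner, form, integral_add, integral_const_mul, integral_finsetSum,
    integral_finsetSum]
  · congr 1
    · refine Finset.sum_congr rfl fun i _ => ?_
      rw [integral_finsetSum _ fun j _ => hint _ _]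
      exact Finset.sum_congr rfl fun j _ => hin _ _
    · simp only [hin]
  · exact fun i _ => hint _ _
  · exact fun i _ => integrable_finsetSum _ fun j _ => hint _ _
  · exact integrable_finsetSum _ fun i _ => integrable_finsetSum _ fun j _ => hint _ _
  · exact (integrable_finsetSum _ fun i _ => hint _ _).const_mul _

lemma form_comm (Ω : BoundedC1Domain N) (τ : ℝ≥0) (u v : H2 Ω) :
    form Ω τ u v = form Ω τ v u := by
  have h : ∀ a b : L2 Ω, ∀ x, a x * b x = b x * a x := fun a b x => mul_comm _ _
  unfold form
  refine integral_congr_ae (Eventually.of_forall fun x => ?_)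
  refine congrArg₂ (· + ·) (Finset.sum_congr rfl fun i _ => Finset.sum_congr rfl fun j _ => h _ _ x)
    (congrArg _ (Finset.sum_congr rfl fun i _ => h _ _ x))

lemma form_self_nonneg (Ω : BoundedC1Domain N) (τ : ℝ≥0) (u : H2 Ω) : 0 ≤ form Ω τ u u := by
  refine integral_nonneg fun x => ?_
  exact add_nonneg (Finset.sum_nonneg fun i _ => Finset.sum_nonneg fun j _ => mul_self_nonneg _)
    (mul_nonneg τ.2 (Finset.sum_nonneg fun i _ => mul_self_nonneg _))

/-- Weights `ρ ∈ L^∞(∂Ω)`. -/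
abbrev Weight (Ω : BoundedC1Domain N) : Type := Lp ℝ ⊤ Ω.surf

/-- `(lam, u)` solves the weak Steklov problem
`∫_Ω D²u : D²φ + τ ∇u · ∇φ dx = lam ∫_{∂Ω} ρ u φ dσ` for all `φ ∈ H²(Ω)`. -/
def IsSteklovSolution (Ω : BoundedC1Domain N) (τ : ℝ≥0) (ρ : Weight Ω) (lam : ℝ) (u : H2 Ω) :
    Prop :=
  ∀ φ : H2 Ω, form Ω τ u φ = lam * ∫ x, ρ x * trace Ω u x * trace Ω φ x ∂Ω.surf

/-- `lam` is an eigenvalue of the weak Steklov problem. -/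
def IsSteklovEigenvalue (Ω : BoundedC1Domain N) (τ : ℝ≥0) (ρ : Weight Ω) (lam : ℝ) : Prop :=
  ∃ u : H2 Ω, u ≠ 0 ∧ IsSteklovSolution Ω τ ρ lam u

/-- The operator `𝒥_ρ : L²(∂Ω) → H²(Ω)'`, `𝒥_ρ[u][φ] = ∫_{∂Ω} ρ u φ dσ`; see `steklovJ_apply`. -/
def steklovJ (Ω : BoundedC1Domain N) (ρ : Weight Ω) : L2Bdry Ω →ₗ[ℝ] StrongDual ℝ (H2 Ω) where
  toFun u := (innerSL ℝ (ρ • u : L2Bdry Ω)).comp (trace Ω)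
  map_add' u v := by
    have h : (ρ • (u + v) : L2Bdry Ω) = ρ • u + ρ • v :=
      Lp.add_smul ρ u v
    rw [h, map_add]
    rfl
  map_smul' c u := by
    have h : (ρ • (c • u) : L2Bdry Ω) = c • (ρ • u : L2Bdry Ω) := (Lp.smul_comm c ρ u).symm
    rw [h, map_smul]
    rfl

lemma steklovJ_apply (Ω : BoundedC1Domain N) (ρ : Weight Ω) (u : L2Bdry Ω) (φ : H2 Ω) :
    steklovJ Ω ρ u φ = ∫ x, ρ x * u x * trace Ω φ x ∂Ω.surf := by
  change inner ℝ (ρ • u : L2Bdry Ω) (trace Ω φ) = _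
  rw [L2.inner_def]
  refine integral_congr_ae ?_
  filter_upwards [Lp.coeFn_lpSMul (r := 2) ρ u] with x hx
  rw [hx]
  simp [mul_comm]

/-- The eigenspace (with `0`) of the weak Steklov problem for `lam`. -/
def steklovEigenspace (Ω : BoundedC1Domain N) (τ : ℝ≥0) (ρ : Weight Ω) (lam : ℝ) :
    Submodule ℝ (H2 Ω) where
  carrier := {u | IsSteklovSolution Ω τ ρ lam u}
  zero_mem' := fun φ => by
    rw [← formL_apply, ← steklovJ_apply, map_zero, map_zero]
    simp
  add_mem' := fun {u v} hu hv φ => by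
    have hu' := hu φ
    have hv' := hv φ
    rw [← formL_apply, ← steklovJ_apply] at hu' hv' ⊢
    rw [map_add, map_add, map_add, add_apply, add_apply, hu', hv']
    ring
  smul_mem' := fun c u hu φ => by
    have hu' := hu φ
    rw [← formL_apply, ← steklovJ_apply] at hu' ⊢
    rw [map_smul, map_smul, map_smul, smul_apply, smul_apply, hu', smul_eq_mul, smul_eq_mul]
    ring

/-! ### The quotient `H²(Ω)/ℝ` and the operator `T_ρ` -/

/-- The constant function `1` as a smooth function. -/
def smoothOne (N : ℕ) : smoothFunctions N := ⟨fun _ => 1, (contDiff_const : ContDiff ℝ ∞ fun _ : Space N => (1 : ℝ))⟩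

lemma grad_smoothOne (Ω : BoundedC1Domain N) (i : Fin N) :
    H1.grad Ω i (smoothToH1 Ω (smoothOne N)) = 0 := by
  have h : partialDeriv i (smoothOne N : Space N → ℝ) = fun _ => 0 := by
    funext x
    simp [partialDeriv, smoothOne]
  have h' : MemLp (fun _ : Space N => (0 : ℝ)) 2 Ω.vol := memLp_vol Ω continuous_const 2
  refine Eq.trans (MemLp.toLp_congr (memLp_vol Ω (continuous_partialDeriv
    (smoothFunctions.contDiff (smoothOne N)) i) 2) h' (by rw [h])) ?_
  exact MemLp.toLp_zero h'

/-- The constant function `1` as an element of `H²(Ω)`. -/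
def H2.one (Ω : BoundedC1Domain N) : H2 Ω :=
  ⟨WithLp.toLp 2 (smoothToH1 Ω (smoothOne N), 0), fun i j => by
    change IsWeakPartial Ω i (H1.grad Ω j (smoothToH1 Ω (smoothOne N))) 0
    rw [grad_smoothOne]
    exact IsWeakPartial.zero Ω i⟩

/-- The subspace `ℝ` of constant functions in `H²(Ω)`. -/
def constants (Ω : BoundedC1Domain N) : Submodule ℝ (H2 Ω) := Submodule.span ℝ {H2.one Ω}

/-- The space `H²(Ω)/ℝ`, which carries the inner product induced by `form Ω τ`. -/
def H2modR (Ω : BoundedC1Domain N) (_τ : ℝ≥0) : Type := H2 Ω ⧸ constants Ω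

instance (Ω : BoundedC1Domain N) (τ : ℝ≥0) : AddCommGroup (H2modR Ω τ) :=
  inferInstanceAs (AddCommGroup (H2 Ω ⧸ constants Ω))

instance (Ω : BoundedC1Domain N) (τ : ℝ≥0) : Module ℝ (H2modR Ω τ) :=
  inferInstanceAs (Module ℝ (H2 Ω ⧸ constants Ω))

/-- The canonical projection `p : H²(Ω) → H²(Ω)/ℝ`. -/
def proj (Ω : BoundedC1Domain N) (τ : ℝ≥0) : H2 Ω →ₗ[ℝ] H2modR Ω τ := (constants Ω).mkQ

lemma proj_surjective (Ω : BoundedC1Domain N) (τ : ℝ≥0) : Function.Surjective (proj Ω τ) :=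
  (constants Ω).mkQ_surjective

lemma formL_one (Ω : BoundedC1Domain N) (τ : ℝ≥0) : formL Ω τ (H2.one Ω) = 0 := by
  ext v
  have h1 : ∀ i, H2.grad Ω i (H2.one Ω) = 0 := grad_smoothOne Ω
  have h2 : ∀ i j, H2.hess Ω i j (H2.one Ω) = 0 := fun i j => rfl
  rw [formL_eq_inner]
  simp [h1, h2]

lemma constants_le_ker (Ω : BoundedC1Domain N) (τ : ℝ≥0) :
    constants Ω ≤ LinearMap.ker (formL Ω τ : H2 Ω →ₗ[ℝ] H2 Ω →L[ℝ] ℝ) := by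
  rw [constants, Submodule.span_singleton_le_iff_mem]
  exact formL_one Ω τ

lemma form_constant_right {Ω : BoundedC1Domain N} (τ : ℝ≥0) (u : H2 Ω) {c : H2 Ω}
    (hc : c ∈ constants Ω) : formL Ω τ u c = 0 := by
  have h : formL Ω τ c = 0 := constants_le_ker Ω τ hc
  rw [formL_apply, form_comm, ← formL_apply, h]
  rfl

/-- The bilinear form induced by `form Ω τ` on `H²(Ω)/ℝ`; see `quotForm_proj`. -/
def quotForm (Ω : BoundedC1Domain N) (τ : ℝ≥0) : H2modR Ω τ →ₗ[ℝ] H2modR Ω τ →ₗ[ℝ] ℝ :=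
  (constants Ω).liftQ
    { toFun := fun u => (constants Ω).liftQ (formL Ω τ u : H2 Ω →ₗ[ℝ] ℝ)
        fun _ hc => form_constant_right τ u hc
      map_add' := fun u v => by
        apply Submodule.linearMap_qext
        ext φ
        change formL Ω τ (u + v) φ = formL Ω τ u φ + formL Ω τ v φ
        simp
      map_smul' := fun c u => by
        apply Submodule.linearMap_qext
        ext φ
        change formL Ω τ (c • u) φ = c • formL Ω τ u φ
        simp }
    fun c hc => by
      have h : formL Ω τ c = 0 := constants_le_ker Ω τ hc
      apply Submodule.linearMap_qext
      ext φ
      change formL Ω τ c φ = 0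
      rw [h]
      rfl

lemma quotForm_proj (Ω : BoundedC1Domain N) (τ : ℝ≥0) (u v : H2 Ω) :
    quotForm Ω τ (proj Ω τ u) (proj Ω τ v) = form Ω τ u v :=
  formL_apply Ω τ u v

/-- The (semi-)inner product on `H²(Ω)/ℝ` induced by `form Ω τ`. -/
@[reducible]
def H2modR.core (Ω : BoundedC1Domain N) (τ : ℝ≥0) : PreInnerProductSpace.Core ℝ (H2modR Ω τ) where
  inner x y := quotForm Ω τ x y
  conj_inner_symm x y := by
    obtain ⟨u, rfl⟩ := proj_surjective Ω τ x
    obtain ⟨v, rfl⟩ := proj_surjective Ω τ y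
    simp [quotForm_proj, form_comm Ω τ u v]
  re_inner_nonneg x := by
    obtain ⟨u, rfl⟩ := proj_surjective Ω τ x
    simpa [quotForm_proj] using form_self_nonneg Ω τ u
  add_left x y z := by simp
  smul_left x y r := by simp

instance (Ω : BoundedC1Domain N) (τ : ℝ≥0) : SeminormedAddCommGroup (H2modR Ω τ) :=
  @InnerProductSpace.Core.toSeminormedAddCommGroup ℝ (H2modR Ω τ) _ _ _ (H2modR.core Ω τ)

instance (Ω : BoundedC1Domain N) (τ : ℝ≥0) : InnerProductSpace ℝ (H2modR Ω τ) :=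
  InnerProductSpace.ofCore (H2modR.core Ω τ)

lemma inner_proj (Ω : BoundedC1Domain N) (τ : ℝ≥0) (u v : H2 Ω) :
    inner ℝ (proj Ω τ u) (proj Ω τ v) = form Ω τ u v :=
  quotForm_proj Ω τ u v

/-- The linear functional `u ↦ ∫_{∂Ω} ρ u dσ` on `H²(Ω)`. -/
def bdryIntegral (Ω : BoundedC1Domain N) (ρ : Weight Ω) : H2 Ω →ₗ[ℝ] ℝ where
  toFun u := ∫ x, ρ x * trace Ω u x ∂Ω.surf
  map_add' u v := by
    have hint : ∀ g : L2Bdry Ω, Integrable (fun x => ρ x * g x) Ω.surf := fun g => by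
      refine ((Lp.memLp (ρ • g : L2Bdry Ω)).integrable one_le_two).congr ?_
      filter_upwards [Lp.coeFn_lpSMul (r := 2) ρ g] with x hx
      rw [hx]
      simp
    rw [← integral_add (hint _) (hint _), map_add]
    refine integral_congr_ae ?_
    filter_upwards [Lp.coeFn_add (trace Ω u) (trace Ω v)] with x hx
    rw [hx, Pi.add_apply, mul_add]
  map_smul' c u := by
    rw [map_smul, RingHom.id_apply, smul_eq_mul, ← integral_const_mul]
    refine integral_congr_ae ?_
    filter_upwards [Lp.coeFn_smul c (trace Ω u)] with x hx
    rw [hx, Pi.smul_apply, smul_eq_mul]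
    ring

/-- The space `H²_ρ(Ω)` of all `u ∈ H²(Ω)` with `∫_{∂Ω} ρ u dσ = 0`. -/
def H2rho (Ω : BoundedC1Domain N) (ρ : Weight Ω) : Submodule ℝ (H2 Ω) :=
  LinearMap.ker (bdryIntegral Ω ρ)

/-- The space `F(Ω)` of all `G ∈ H²(Ω)'` with `G[1] = 0`. -/
def dualF (Ω : BoundedC1Domain N) : Submodule ℝ (StrongDual ℝ (H2 Ω)) where
  carrier := {G | G (H2.one Ω) = 0}
  zero_mem' := rfl
  add_mem' := fun {a b} (ha : a _ = 0) (hb : b _ = 0) => by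
    change a _ + b _ = 0
    rw [ha, hb, add_zero]
  smul_mem' := fun c a (ha : a _ = 0) => by
    change c * a _ = 0
    rw [ha, mul_zero]

/-- The operator `𝒫_ρ : H²_ρ(Ω) → F(Ω)`, `𝒫_ρ[u][φ] = ∫_Ω D²u : D²φ + τ ∇u · ∇φ dx`. -/
def steklovP (Ω : BoundedC1Domain N) (τ : ℝ≥0) (ρ : Weight Ω) : H2rho Ω ρ →ₗ[ℝ] dualF Ω where
  toFun u := ⟨formL Ω τ u,
    form_constant_right τ _ (Submodule.mem_span_singleton_self (H2.one Ω))⟩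
  map_add' u v := Subtype.ext (map_add (formL Ω τ) (u : H2 Ω) v)
  map_smul' c u := Subtype.ext (map_smul (formL Ω τ) c (u : H2 Ω))

lemma steklovP_apply (Ω : BoundedC1Domain N) (τ : ℝ≥0) (ρ : Weight Ω) (u : H2rho Ω ρ) (φ : H2 Ω) :
    (steklovP Ω τ ρ u : StrongDual ℝ (H2 Ω)) φ = form Ω τ u φ :=
  formL_apply Ω τ u φ

/-- The map `π_ρ[u] = u - (∫_{∂Ω} ρ u dσ) / (∫_{∂Ω} ρ dσ)`. -/
def piMap (Ω : BoundedC1Domain N) (ρ : Weight Ω) (u : H2 Ω) : H2 Ω :=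
  u - (bdryIntegral Ω ρ u / ∫ x, ρ x ∂Ω.surf) • H2.one Ω

/-- The map `π♯_ρ` on `H²(Ω)/ℝ` with `π_ρ = π♯_ρ ∘ p`. -/
def piSharp (Ω : BoundedC1Domain N) (τ : ℝ≥0) (ρ : Weight Ω) (x : H2modR Ω τ) : H2 Ω :=
  piMap Ω ρ (Function.surjInv (proj_surjective Ω τ) x)

/-- The operator `T_ρ = (π♯_ρ)⁻¹ ∘ 𝒫_ρ⁻¹ ∘ 𝒥_ρ ∘ Tr ∘ π♯_ρ` on `H²(Ω)/ℝ`. -/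
def steklovOp (Ω : BoundedC1Domain N) (τ : ℝ≥0) (ρ : Weight Ω) (x : H2modR Ω τ) : H2modR Ω τ :=
  Function.invFun (piSharp Ω τ ρ)
    (Function.invFun (fun u : H2rho Ω ρ => (steklovP Ω τ ρ u : StrongDual ℝ (H2 Ω)))
      (steklovJ Ω ρ (trace Ω (piSharp Ω τ ρ x))) : H2rho Ω ρ)

end BiharmonicSteklov

end

open BiharmonicSteklov

/-!
Write `J u φ = ∫_{∂Ω} ρ u φ dσ`. On `H²_ρ(Ω)` the form `⟨·,·⟩` is an inner product equivalent to
that of `H²(Ω)`, and `T_ρ` is the operator representing the form `J` with respect to it: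
`⟨T_ρ u, v⟩ = J u v`. Testing the Steklov problem with the constant `1` shows that eigenfunctions
for `λ ≠ 0` belong to `H²_ρ(Ω)`, where the problem reads `T_ρ u = λ⁻¹ u`. For `λ = 0`, taking
`φ = u` gives `⟨u, u⟩ = 0`, so that `u` is constant. Since `J` is symmetric and non-negative, everything follows
from the spectral theory of compact symmetric operators, once two facts are known: the trace
is compact, and `T_ρ` has infinite rank.

The analytic input is developed for domains of class `C¹` from two facts on boundary charts.

* Near each boundary point, `Ω` satisfies a uniform cone condition. Hence there are mollifiers which
  only look at points inside `Ω`, and a subordinate partition of unity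
  (`exists_inward_partition`). Mollifying each piece gives the density of smooth functions
  (`denseRange_smoothToH1`). The difference between a function and its mollification is bounded by a
  small multiple of the gradient, and the mollifications of bounded families are equicontinuous,
  whence Rellich's theorem (`isCompactOperator_toL2`).
* A chart exhibits a piece of `∂Ω` as a Lipschitz graph. Integrating a one-dimensional inequality
  along the segments from the graph into `Ω` gives
  `‖u‖²_{L²(∂Ω)} ≤ C ((1 + 1/ε) ‖u‖² + ε ‖∇u‖²)` for every `ε > 0` (`exists_trace_le`). So the trace
  is well defined (`traceH1_smoothToH1`), and by Rellich's theorem it is compact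
  (`isCompactOperator_traceH1`).

A function whose weak gradient vanishes is constant because `Ω` is connected
(`exists_ae_eq_const`), and with Rellich's theorem and Peetre's lemma this gives the coercivity of
the form on `H²_ρ(Ω)` (`exists_norm_le_norm_proj`), from which the Hilbert space structure of
`H²(Ω)/ℝ` and the bijectivity of `𝒫_ρ` follow (`completeSpace_H2modR`, `bijective_steklovP`).

If `T_ρ` had only finitely many nonzero eigenvalues, it would have finite rank, and so would the
trace, since `J u u = 0` implies that the trace of `u` vanishes. But the surface measure has no
atoms when `N ≥ 2`, and bump functions around different points of its support have linearly
independent traces (`not_finiteDimensional_range_steklovOpL`).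
-/

noncomputable section

namespace BiharmonicSteklov

variable {N : ℕ}

/-! ### Mollification -/

/-- `k` is a smooth probability density on `ℝ^N` with compact support contained in `S`. -/
structure IsMollifier (k : Space N → ℝ) (S : Set (Space N)) : Prop where
  smooth : ContDiff ℝ ∞ k
  nonneg : ∀ x, 0 ≤ k x
  hasCompactSupport : HasCompactSupport k
  integral_eq_one : ∫ x, k x = 1
  tsupport_subset : tsupport k ⊆ S

lemma IsMollifier.mono {k : Space N → ℝ} {S T : Set (Space N)} (hk : IsMollifier k S)
    (h : S ⊆ T) : IsMollifier k T :=
  ⟨hk.smooth, hk.nonneg, hk.hasCompactSupport, hk.integral_eq_one, hk.tsupport_subset.trans h⟩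

lemma exists_isMollifier (a : Space N) {r : ℝ} (hr : 0 < r) :
    ∃ k : Space N → ℝ, IsMollifier k (Metric.closedBall a r) := by
  let f : ContDiffBump a := ⟨r / 2, r, by positivity, by linarith⟩
  exact ⟨f.normed volume, f.contDiff_normed, f.nonneg_normed, f.hasCompactSupport_normed,
    f.integral_normed, f.tsupport_normed_eq.subset⟩

/-- The extension of `g ∈ L²(Ω)` by zero. -/
def zeroExt {Ω : BoundedC1Domain N} (g : L2 Ω) : Space N → ℝ := Ω.carrier.indicator g

lemma measurable_zeroExt {Ω : BoundedC1Domain N} (g : L2 Ω) : Measurable (zeroExt g) :=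
  (Lp.stronglyMeasurable g).measurable.indicator Ω.isOpen.measurableSet

lemma memLp_zeroExt {Ω : BoundedC1Domain N} (g : L2 Ω) : MemLp (zeroExt g) 2 volume :=
  (memLp_indicator_iff_restrict Ω.isOpen.measurableSet).2 (Lp.memLp g)

lemma integrable_zeroExt {Ω : BoundedC1Domain N} (g : L2 Ω) : Integrable (zeroExt g) volume :=
  (integrable_indicator_iff Ω.isOpen.measurableSet).2 ((Lp.memLp g).integrable one_le_two)

/-- The convolution of `k` with the extension of `g ∈ L²(Ω)` by zero. -/
def mollify (Ω : BoundedC1Domain N) (k : Space N → ℝ) (g : L2 Ω) (x : Space N) : ℝ :=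
  ∫ y, g y * k (x - y) ∂Ω.vol

lemma mollify_eq_convolution (Ω : BoundedC1Domain N) (k : Space N → ℝ) (g : L2 Ω) :
    mollify Ω k g = convolution (zeroExt g) k (ContinuousLinearMap.mul ℝ ℝ) volume := by
  ext x
  change ∫ y in Ω.carrier, g y * k (x - y) = ∫ y, zeroExt g y * k (x - y)
  rw [← integral_indicator Ω.isOpen.measurableSet]
  congr 1
  ext y
  by_cases hy : y ∈ Ω.carrier <;> simp [zeroExt, hy]

lemma contDiff_mollify (Ω : BoundedC1Domain N) {k : Space N → ℝ} {S : Set (Space N)}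
    (hk : IsMollifier k S) (g : L2 Ω) : ContDiff ℝ ∞ (mollify Ω k g) := by
  rw [mollify_eq_convolution]
  exact hk.hasCompactSupport.contDiff_convolution_right _
    (integrable_zeroExt g).locallyIntegrable hk.smooth

lemma partialDeriv_mollify (Ω : BoundedC1Domain N) {k : Space N → ℝ} {S : Set (Space N)}
    (hk : IsMollifier k S) (g : L2 Ω) (i : Fin N) (x : Space N) :
    partialDeriv i (mollify Ω k g) x = ∫ y, g y * partialDeriv i k (x - y) ∂Ω.vol := by
  change _ = mollify Ω (partialDeriv i k) g x
  have hk1 : ContDiff ℝ 1 k := hk.smooth.of_le (by exact_mod_cast le_top)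
  have h := (hk.hasCompactSupport.hasFDerivAt_convolution_right (ContinuousLinearMap.mul ℝ ℝ)
    (integrable_zeroExt g).locallyIntegrable hk1 x).fderiv
  rw [partialDeriv, mollify_eq_convolution, h]
  rw [convolution_precompR_apply _ (integrable_zeroExt g).locallyIntegrable
    (hk.hasCompactSupport.fderiv ℝ) (hk1.continuous_fderiv one_ne_zero), mollify_eq_convolution]
  rfl

/-- At points `x` such that `x - supp k` is inside `Ω`, mollification commutes with weak
derivatives, since `y ↦ k (x - y)` is then a test function. -/
lemma partialDeriv_mollify_of_isWeakPartial {Ω : BoundedC1Domain N} {k : Space N → ℝ}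
    {S : Set (Space N)} (hk : IsMollifier k S) {i : Fin N} {u v : L2 Ω}
    (huv : IsWeakPartial Ω i u v) {x : Space N} (hx : ∀ z ∈ S, x - z ∈ Ω.carrier) :
    partialDeriv i (mollify Ω k u) x = mollify Ω k v x := by
  have hφ : IsTestFunction Ω fun y => k (x - y) := by
    have hts : tsupport (fun y => k (x - y)) = (fun y => x - y) ⁻¹' tsupport k :=
      (tsupport_comp_eq_preimage k (Homeomorph.subLeft x))
    refine ⟨hk.smooth.comp (contDiff_const.sub contDiff_id),
      hk.hasCompactSupport.comp_homeomorph (Homeomorph.subLeft x), ?_⟩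
    rw [hts]
    intro y hy
    simpa using hx _ (hk.tsupport_subset hy)
  have hd : ∀ y, partialDeriv i (fun y => k (x - y)) y = - partialDeriv i k (x - y) := by
    intro y
    have h1 : HasFDerivAt k (fderiv ℝ k (x - y)) (x - y) :=
      ((hk.smooth.differentiable (by simp)) _).hasFDerivAt
    have h2 : HasFDerivAt (fun y : Space N => x - y) (-ContinuousLinearMap.id ℝ (Space N)) y :=
      (hasFDerivAt_id y).const_sub x
    have h3 := (h1.comp y h2).fderiv
    have h4 : (k ∘ fun y => x - y) = fun y => k (x - y) := rfl
    rw [h4] at h3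
    simp [partialDeriv, h3]
  have h := huv _ hφ
  simp only [hd, mul_neg, integral_neg, neg_inj] at h
  rw [partialDeriv_mollify Ω hk, h]
  rfl

/-- The probability measure with density `k`. -/
def mollifierMeasure (k : Space N → ℝ) : Measure (Space N) :=
  volume.withDensity fun z => ENNReal.ofReal (k z)

lemma IsMollifier.isProbabilityMeasure {k : Space N → ℝ} {S : Set (Space N)}
    (hk : IsMollifier k S) : IsProbabilityMeasure (mollifierMeasure k) := by
  constructor
  have hi : Integrable k := hk.smooth.continuous.integrable_of_hasCompactSupport
    hk.hasCompactSupport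
  rw [mollifierMeasure, withDensity_apply _ MeasurableSet.univ, Measure.restrict_univ,
    ← ofReal_integral_eq_lintegral_ofReal hi (ae_of_all _ hk.nonneg), hk.integral_eq_one]
  simp

lemma IsMollifier.ae_mem {k : Space N → ℝ} {S : Set (Space N)}
    (hk : IsMollifier k S) : ∀ᵐ z ∂mollifierMeasure k, z ∈ S := by
  rw [mollifierMeasure, ae_withDensity_iff (by have := hk.smooth.continuous; fun_prop)]
  refine ae_of_all _ fun z hz => hk.tsupport_subset (subset_tsupport k ?_)
  intro h
  simp [h] at hz

lemma integrable_zeroExt_sub {Ω : BoundedC1Domain N} {k : Space N → ℝ} {S : Set (Space N)}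
    (hk : IsMollifier k S) (g : L2 Ω) (x : Space N) :
    Integrable (fun z => k z * zeroExt g (x - z)) volume := by
  obtain ⟨C, hC⟩ := hk.hasCompactSupport.exists_bound_of_continuous hk.smooth.continuous
  exact (((integrable_zeroExt g).comp_sub_left x)).bdd_mul
    hk.smooth.continuous.aestronglyMeasurable (ae_of_all _ hC)

lemma mollify_sub_eq_integral {Ω : BoundedC1Domain N} {k : Space N → ℝ} {S : Set (Space N)}
    (hk : IsMollifier k S) (g : L2 Ω) (x : Space N) :
    mollify Ω k g x - zeroExt g x
      = ∫ z, (zeroExt g (x - z) - zeroExt g x) ∂mollifierMeasure k := by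
  have h1 : mollify Ω k g x = ∫ z, k z * zeroExt g (x - z) := by
    have h2 : mollify Ω k g x = ∫ y, zeroExt g y * k (x - y) :=
      congrFun (mollify_eq_convolution Ω k g) x
    rw [h2, ← integral_sub_left_eq_self _ volume x]
    simp [mul_comm]
  have hi : Integrable k := hk.smooth.continuous.integrable_of_hasCompactSupport
    hk.hasCompactSupport
  rw [mollifierMeasure, integral_withDensity_eq_integral_toReal_smul
    (by have := hk.smooth.continuous; fun_prop) (by simp)]
  simp only [ENNReal.toReal_ofReal (hk.nonneg _), smul_eq_mul, mul_sub]
  rw [integral_sub (integrable_zeroExt_sub hk g x) (hi.mul_const _), integral_mul_const,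
    hk.integral_eq_one, one_mul, h1]

/-- Jensen's inequality for mollification. -/
lemma lintegral_mollify_sub_le {Ω : BoundedC1Domain N} {k : Space N → ℝ} {S : Set (Space N)}
    (hk : IsMollifier k S) (g : L2 Ω) (A : Set (Space N)) {C : ENNReal}
    (hC : ∀ z ∈ S, ∫⁻ x in A, ‖zeroExt g (x - z) - zeroExt g x‖ₑ ^ 2 ≤ C) :
    ∫⁻ x in A, ‖mollify Ω k g x - zeroExt g x‖ₑ ^ 2 ≤ C := by
  have := hk.isProbabilityMeasure
  have hm : Measurable fun p : Space N × Space N =>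
      ‖zeroExt g (p.1 - p.2) - zeroExt g p.1‖ₑ ^ 2 := by
    have := measurable_zeroExt g
    fun_prop
  have key : ∀ x, ‖mollify Ω k g x - zeroExt g x‖ₑ ^ 2
      ≤ ∫⁻ z, ‖zeroExt g (x - z) - zeroExt g x‖ₑ ^ 2 ∂mollifierMeasure k := by
    intro x
    have hmx : AEStronglyMeasurable (fun z => zeroExt g (x - z) - zeroExt g x)
        (mollifierMeasure k) := by
      have := measurable_zeroExt g
      exact Measurable.aestronglyMeasurable (by fun_prop)
    rw [mollify_sub_eq_integral hk]
    have h1 := enorm_integral_le_lintegral_enorm (μ := mollifierMeasure k)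
      (fun z => zeroExt g (x - z) - zeroExt g x)
    rw [← eLpNorm_one_eq_lintegral_enorm] at h1
    have h2 := eLpNorm_le_eLpNorm_of_exponent_le (p := 1) (q := 2) one_le_two hmx
    have h3 : eLpNorm (fun z => zeroExt g (x - z) - zeroExt g x) 2 (mollifierMeasure k) ^ 2
        = ∫⁻ z, ‖zeroExt g (x - z) - zeroExt g x‖ₑ ^ 2 ∂mollifierMeasure k := by
      simpa using eLpNorm_nnreal_pow_eq_lintegral (p := 2) two_ne_zero
        (f := fun z => zeroExt g (x - z) - zeroExt g x) (μ := mollifierMeasure k)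
    rw [← h3]
    gcongr
    exact h1.trans h2
  calc _ ≤ ∫⁻ x in A, ∫⁻ z, ‖zeroExt g (x - z) - zeroExt g x‖ₑ ^ 2 ∂mollifierMeasure k :=
        lintegral_mono key
    _ = ∫⁻ z, (∫⁻ x in A, ‖zeroExt g (x - z) - zeroExt g x‖ₑ ^ 2) ∂mollifierMeasure k :=
        lintegral_lintegral_swap hm.aemeasurable
    _ ≤ ∫⁻ _, C ∂mollifierMeasure k := by
        refine lintegral_mono_ae ?_
        filter_upwards [hk.ae_mem] with z hz using hC z hz
    _ = C := by simp

lemma enorm_L2_sq {Ω : BoundedC1Domain N} (g : L2 Ω) :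
    ‖g‖ₑ ^ 2 = ∫⁻ x, ‖g x‖ₑ ^ 2 ∂Ω.vol := by
  rw [Lp.enorm_def]
  simpa using eLpNorm_nnreal_pow_eq_lintegral (p := 2) two_ne_zero (f := g) (μ := Ω.vol)

/-- Translations are continuous in `L²`. -/
lemma exists_lintegral_translation_le {Ω : BoundedC1Domain N} (g : L2 Ω) {ε : ℝ} (hε : 0 < ε) :
    ∃ δ > 0, ∀ z : Space N, ‖z‖ < δ →
      ∫⁻ x, ‖zeroExt g (x - z) - zeroExt g x‖ₑ ^ 2 ≤ ENNReal.ofReal (ε ^ 2) := by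
  -- precomposition with a continuous family of measure preserving maps is continuous in `L²`
  let G : Lp ℝ 2 (volume : Measure (Space N)) := (memLp_zeroExt g).toLp _
  let c : Space N → C(Space N, Space N) := fun z => ⟨fun x => x - z, by fun_prop⟩
  have hcm : ∀ z, MeasurePreserving (c z) volume volume :=
    fun z => measurePreserving_sub_right volume z
  have hcc : Continuous c := by
    refine ContinuousMap.continuous_of_continuous_uncurry _ ?_
    change Continuous fun p : Space N × Space N => p.2 - p.1
    fun_prop
  have hcont : Continuous fun z => Lp.compMeasurePreserving (c z) (hcm z) G :=
    continuous_const.compMeasurePreservingLp hcc hcm (by simp)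
  obtain ⟨δ, hδ, h⟩ := Metric.continuous_iff.1 hcont 0 ε hε
  refine ⟨δ, hδ, fun z hz => ?_⟩
  have h1 := (h z (by simpa using hz)).le
  have hz1 : Lp.compMeasurePreserving (c z) (hcm z) G =ᵐ[volume] fun x => zeroExt g (x - z) :=
    (Lp.coeFn_compMeasurePreserving G (hcm z)).trans
      ((hcm z).quasiMeasurePreserving.ae_eq_comp (memLp_zeroExt g).coeFn_toLp)
  have hz0 : Lp.compMeasurePreserving (c 0) (hcm 0) G =ᵐ[volume] fun x => zeroExt g x := by
    refine (Lp.coeFn_compMeasurePreserving G (hcm 0)).trans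
      (((hcm 0).quasiMeasurePreserving.ae_eq_comp (memLp_zeroExt g).coeFn_toLp).trans ?_)
    exact ae_of_all _ fun x => by simp [c]
  have h2 : ∫⁻ x, ‖zeroExt g (x - z) - zeroExt g x‖ₑ ^ 2
      = ‖Lp.compMeasurePreserving (c z) (hcm z) G - Lp.compMeasurePreserving (c 0) (hcm 0) G‖ₑ ^ 2
      := by
    rw [Lp.enorm_def]
    have h3 := eLpNorm_nnreal_pow_eq_lintegral (p := 2) two_ne_zero (μ := volume)
      (f := (Lp.compMeasurePreserving (c z) (hcm z) G - Lp.compMeasurePreserving (c 0) (hcm 0) G :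
        Lp ℝ 2 (volume : Measure (Space N))))
    simp only [ENNReal.coe_ofNat, NNReal.coe_ofNat, ENNReal.rpow_ofNat] at h3
    rw [h3]
    refine lintegral_congr_ae ?_
    filter_upwards [hz1, hz0, Lp.coeFn_sub (Lp.compMeasurePreserving (c z) (hcm z) G)
      (Lp.compMeasurePreserving (c 0) (hcm 0) G)] with x h4 h5 h6
    rw [h6, Pi.sub_apply, h4, h5]
  rw [h2, ENNReal.ofReal_pow hε.le]
  gcongr
  rw [dist_eq_norm] at h1
  rw [← ofReal_norm]
  exact ENNReal.ofReal_le_ofReal h1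

/-- Mollifications of `g` are in `L²(Ω)`. -/
def mollifyL2 (Ω : BoundedC1Domain N) {k : Space N → ℝ} {S : Set (Space N)}
    (hk : IsMollifier k S) (g : L2 Ω) : L2 Ω :=
  (memLp_vol Ω (contDiff_mollify Ω hk g).continuous 2).toLp _

lemma coeFn_mollifyL2 {Ω : BoundedC1Domain N} {k : Space N → ℝ} {S : Set (Space N)}
    (hk : IsMollifier k S) (g : L2 Ω) : mollifyL2 Ω hk g =ᵐ[Ω.vol] mollify Ω k g :=
  MemLp.coeFn_toLp _

lemma norm_L2_le {Ω : BoundedC1Domain N} {g : L2 Ω} {C : ℝ} (hC : 0 ≤ C)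
    (h : ∫⁻ x, ‖g x‖ₑ ^ 2 ∂Ω.vol ≤ ENNReal.ofReal (C ^ 2)) : ‖g‖ ≤ C := by
  rw [← enorm_L2_sq, ENNReal.ofReal_pow hC, ENNReal.pow_le_pow_left_iff two_ne_zero,
    ← ofReal_norm] at h
  exact (ENNReal.ofReal_le_ofReal_iff hC).1 h

/-- Mollifications with kernels supported near `0` converge in `L²(Ω)`. -/
lemma exists_norm_mollifyL2_sub_le {Ω : BoundedC1Domain N} (g : L2 Ω) {ε : ℝ} (hε : 0 < ε) :
    ∃ δ > 0, ∀ (k : Space N → ℝ) (S : Set (Space N)) (hk : IsMollifier k S),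
      S ⊆ Metric.ball 0 δ → ‖mollifyL2 Ω hk g - g‖ ≤ ε := by
  obtain ⟨δ, hδ, h⟩ := exists_lintegral_translation_le g hε
  refine ⟨δ, hδ, fun k S hk hS => norm_L2_le hε.le ?_⟩
  have h1 := lintegral_mollify_sub_le hk g Ω.carrier (C := ENNReal.ofReal (ε ^ 2))
    fun z hz => (setLIntegral_le_lintegral _ _).trans (h z (by simpa using hS hz))
  refine le_trans (le_of_eq (lintegral_congr_ae ?_)) h1
  filter_upwards [Lp.coeFn_sub (mollifyL2 Ω hk g) g, coeFn_mollifyL2 hk g,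
    ae_restrict_mem Ω.isOpen.measurableSet] with x hx1 hx2 hx3
  rw [hx1, Pi.sub_apply, hx2, zeroExt, indicator_of_mem hx3]

/-! ### The inward cone property and a subordinate partition of unity -/

/-- Near every point of `closure Ω`, there are mollifiers with arbitrarily small support `S` such
that translating a point of `Ω` by `-z`, `z ∈ S`, does not leave `Ω`. At a boundary point `S` is a
small ball around a small multiple of the direction in which `Ω` is a subgraph. -/
lemma exists_inward_isMollifier (Ω : BoundedC1Domain N) {x₀ : Space N}
    (hx₀ : x₀ ∈ closure Ω.carrier) :
    ∃ r > 0, ∀ δ > 0, ∃ (k : Space N → ℝ) (S : Set (Space N)), IsMollifier k S ∧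
      S ⊆ Metric.ball 0 δ ∧ ∀ x ∈ Ω.carrier ∩ Metric.ball x₀ r, ∀ z ∈ S, ∀ t ∈ Icc (0 : ℝ) 1,
        x - t • z ∈ Ω.carrier := by
  -- The balls around `h e` of radius `c h` sweep out a truncated cone, which contains the
  -- multiples `t z` of its elements.
  suffices H : ∃ r > 0, ∃ c > 0, c ≤ 1 ∧ ∃ h₀ > 0, ∃ e : Space N, ‖e‖ ≤ 1 ∧
      ∀ x ∈ Ω.carrier ∩ Metric.ball x₀ r, ∀ h : ℝ, 0 < h → h ≤ h₀ →
        ∀ z ∈ Metric.closedBall (h • e) (c * h), x - z ∈ Ω.carrier by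
    obtain ⟨r, hr, c, hc, hc1, h₀, hh₀, e, he, H⟩ := H
    refine ⟨r, hr, fun δ hδ => ?_⟩
    set h := min h₀ (δ / 4) with hh
    have hpos : 0 < h := lt_min hh₀ (by positivity)
    obtain ⟨k, hk⟩ := exists_isMollifier (h • e) (mul_pos hc hpos)
    refine ⟨k, _, hk, ?_, ?_⟩
    · intro z hz
      rw [mem_closedBall_iff_norm] at hz
      rw [mem_ball_zero_iff]
      have h1 : ‖h • e‖ ≤ h := by
        rw [norm_smul, Real.norm_of_nonneg hpos.le]
        nlinarith
      have h2 : ‖z‖ ≤ ‖z - h • e‖ + ‖h • e‖ := by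
        simpa using norm_add_le (z - h • e) (h • e)
      have h3 : h ≤ δ / 4 := min_le_right _ _
      nlinarith
    · intro x hx z hz t ht
      rcases ht.1.eq_or_lt with rfl | ht0
      · simpa using hx.1
      · refine H x hx (t * h) (by positivity) ?_ _ ?_
        · have : h ≤ h₀ := min_le_left _ _
          nlinarith [ht.2]
        · rw [mem_closedBall_iff_norm] at hz ⊢
          rw [mul_smul, ← smul_sub, norm_smul, Real.norm_of_nonneg ht0.le]
          nlinarith
  by_cases hx : x₀ ∈ Ω.carrier
  · obtain ⟨r, hr, h⟩ := Metric.isOpen_iff.1 Ω.isOpen x₀ hx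
    refine ⟨r / 2, by positivity, 1, one_pos, le_rfl, r / 2, by positivity, 0, by simp, ?_⟩
    intro x hx h' hpos hh' z hz
    apply h
    have h1 := mem_ball_iff_norm.1 hx.2
    rw [smul_zero, mem_closedBall_zero_iff] at hz
    rw [mem_ball_iff_norm]
    have h2 : ‖x - z - x₀‖ ≤ ‖x - x₀‖ + ‖z‖ := by
      have := norm_sub_le (x - x₀) z
      rwa [sub_right_comm] at this
    linarith
  · have hfr : x₀ ∈ frontier Ω.carrier := by
      rw [Ω.isOpen.frontier_eq]
      exact ⟨hx₀, hx⟩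
    obtain ⟨r₁, hr₁, e, he, γ, hγ, hch⟩ := Ω.hasC1Boundary x₀ hfr
    set P : Space N → Space N := fun y => y - ⟪y, e⟫ • e with hP
    obtain ⟨K, t, ht, hK⟩ := (hγ.contDiffAt (x := P x₀)).exists_lipschitzOnWith
    obtain ⟨s, hs, hst⟩ := Metric.mem_nhds_iff.1 ht
    have hPsub : ∀ y z, P y - P z = P (y - z) := by
      intro y z
      simp only [hP, inner_sub_left, sub_smul]
      abel
    have hPn : ∀ y, ‖P y‖ ≤ 2 * ‖y‖ := by
      intro y
      have h1 := norm_sub_le y (⟪y, e⟫ • e)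
      have h2 : ‖⟪y, e⟫ • e‖ ≤ ‖y‖ := by
        rw [norm_smul, he, mul_one]
        simpa [he] using norm_inner_le_norm y e (𝕜 := ℝ)
      linarith
    set R := min r₁ (s / 2) with hR
    have hRpos : 0 < R := lt_min hr₁ (by positivity)
    have hK0 : (0 : ℝ) ≤ K := K.2
    -- Passing from `x` to `x - z` lowers the height by at least `(1 - c) h` and changes `γ` by at
    -- most `2 K c h`; the two are equal for `c = 1 / (2 K + 1)`.
    have hc1 : 1 / (2 * (K : ℝ) + 1) ≤ 1 := by
      rw [div_le_one (by positivity)]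
      linarith
    have hcK : 1 / (2 * (K : ℝ) + 1) * (2 * K + 1) = 1 := by field_simp
    set c := 1 / (2 * (K : ℝ) + 1) with hc
    have hcpos : 0 < c := by positivity
    refine ⟨R / 2, by positivity, c, hcpos, hc1, R / 4, by positivity, e, he.le, ?_⟩
    intro x hx h hpos hhR z hz
    rw [mem_closedBall_iff_norm] at hz
    have hee : ⟪e, e⟫ = 1 := by simp [he]
    have hx1 := mem_ball_iff_norm.1 hx.2
    have hz2 : ‖z‖ ≤ 2 * h := by
      have h2 : ‖z‖ ≤ ‖z - h • e‖ + ‖h • e‖ := by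
        simpa using norm_add_le (z - h • e) (h • e)
      rw [norm_smul, he, Real.norm_of_nonneg hpos.le] at h2
      nlinarith
    have hxz : ‖x - z - x₀‖ < R := by
      have := norm_sub_le (x - x₀) z
      rw [sub_right_comm] at this
      linarith
    have hin : ∀ y, ‖y - x₀‖ < R → y ∈ Metric.ball x₀ r₁ ∧ P y ∈ t := by
      intro y hy
      refine ⟨mem_ball_iff_norm.2 (hy.trans_le (min_le_left _ _)), hst ?_⟩
      rw [mem_ball_iff_norm, hPsub]
      have : R ≤ s / 2 := min_le_right _ _
      linarith [hPn (y - x₀)]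
    obtain ⟨hxr, hxt⟩ := hin x (by linarith)
    obtain ⟨hyr, hyt⟩ := hin _ hxz
    have hPe : P z = P (z - h • e) := by
      simp only [hP, inner_sub_left, real_inner_smul_left, hee, sub_smul, mul_one]
      abel
    have hγd : |γ (P x) - γ (P (x - z))| ≤ K * (2 * (c * h)) := by
      rw [← Real.dist_eq]
      refine (hK.dist_le_mul _ hxt _ hyt).trans ?_
      rw [dist_eq_norm, hPsub, sub_sub_cancel, hPe]
      gcongr
      linarith [hPn (z - h • e)]
    have hze : h - c * h ≤ ⟪z, e⟫ := by
      have h1 := (abs_le.1 (abs_real_inner_le_norm (z - h • e) e)).1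
      rw [inner_sub_left, real_inner_smul_left, hee, he] at h1
      linarith
    have hxΩ := (hch x hxr).1 hx.1
    refine (hch _ hyr).2 ?_
    change ⟪x - z, e⟫ < γ (P (x - z))
    change ⟪x, e⟫ < γ (P x) at hxΩ
    rw [inner_sub_left]
    have h3 := (abs_le.1 hγd).2
    nlinarith

/-- A finite smooth partition of unity on `Ω`, each member of which has its own inward mollifiers
on its support. -/
lemma exists_inward_partition (Ω : BoundedC1Domain N) :
    ∃ (ι : Type) (_ : Fintype ι) (χ : ι → Space N → ℝ), (∀ j, ContDiff ℝ ∞ (χ j)) ∧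
      (∀ j x, 0 ≤ χ j x) ∧ (∀ j x, χ j x ≤ 1) ∧ (∀ x ∈ Ω.carrier, ∑ j, χ j x = 1) ∧
      ∀ j, ∀ δ > 0, ∃ (k : Space N → ℝ) (S : Set (Space N)), IsMollifier k S ∧
        S ⊆ Metric.ball 0 δ ∧ ∀ x ∈ Ω.carrier ∩ tsupport (χ j), ∀ z ∈ S, ∀ t ∈ Icc (0 : ℝ) 1,
          x - t • z ∈ Ω.carrier := by
  choose! r hr h using fun x₀ (hx₀ : x₀ ∈ closure Ω.carrier) => exists_inward_isMollifier Ω hx₀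
  obtain ⟨t, ht, hcov⟩ := Ω.isCompact_closure.elim_nhds_subcover (fun x => Metric.ball x (r x))
    fun x hx => Metric.ball_mem_nhds _ (hr x hx)
  obtain ⟨f, hf⟩ := SmoothPartitionOfUnity.exists_isSubordinate (modelWithCornersSelf ℝ (Space N))
    (s := closure Ω.carrier) isClosed_closure
    (fun x : ((t : Set (Space N)) : Type _) => Metric.ball (x : Space N) (r x))
    (fun _ => Metric.isOpen_ball) (by
      intro x hx
      simpa using hcov hx)
  have hfin : Finite ((t : Set (Space N)) : Type _) := t.finite_toSet
  let n := Nat.card ((t : Set (Space N)) : Type _)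
  let eq : ((t : Set (Space N)) : Type _) ≃ Fin n := Finite.equivFin _
  refine ⟨Fin n, inferInstance, fun j => f (eq.symm j), fun j => (f (eq.symm j)).contMDiff.contDiff,
    fun j x => f.nonneg _ x, fun j x => f.le_one _ x, fun x hx => ?_, fun j δ hδ => ?_⟩
  · have h1 := f.sum_eq_one (subset_closure hx)
    rw [← finsum_comp_equiv eq.symm, finsum_eq_sum_of_fintype] at h1
    exact h1
  · obtain ⟨k, S, hk, hS, hin⟩ := h (eq.symm j) (ht _ (eq.symm j).2) δ hδ
    exact ⟨k, S, hk, hS, fun x hx => hin x ⟨hx.1, hf _ hx.2⟩⟩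

/-! ### Density of smooth functions -/

/-- The inclusion of `H¹(Ω)` in `L²(Ω)`. -/
def H1.toL2 (Ω : BoundedC1Domain N) : H1 Ω →L[ℝ] L2 Ω :=
  (WithLp.fstL 2 ℝ (L2 Ω) (PiLp 2 fun _ : Fin N => L2 Ω)).comp (H1Sub Ω).subtypeL

lemma H1.isWeakPartial {Ω : BoundedC1Domain N} (u : H1 Ω) (i : Fin N) :
    IsWeakPartial Ω i (H1.toL2 Ω u) (H1.grad Ω i u) := u.2 i

lemma H1.norm_sq {Ω : BoundedC1Domain N} (u : H1 Ω) :
    ‖u‖ ^ 2 = ‖H1.toL2 Ω u‖ ^ 2 + ∑ i, ‖H1.grad Ω i u‖ ^ 2 := by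
  have h : ‖u‖ ^ 2 = ‖u.1.fst‖ ^ 2 + ‖u.1.snd‖ ^ 2 := WithLp.prod_norm_sq_eq_of_L2 u.1
  rw [h, PiLp.norm_sq_eq_of_L2]
  rfl

lemma H1.norm_le {Ω : BoundedC1Domain N} (u : H1 Ω) :
    ‖u‖ ≤ ‖H1.toL2 Ω u‖ + ∑ i, ‖H1.grad Ω i u‖ := by
  refine le_of_sq_le_sq ?_ (by positivity)
  have h0 : 0 ≤ ∑ i, ‖H1.grad Ω i u‖ := Finset.sum_nonneg fun i _ => norm_nonneg _
  have h := Finset.sum_sq_le_sq_sum_of_nonneg (s := Finset.univ) (f := fun i => ‖H1.grad Ω i u‖)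
    fun i _ => norm_nonneg _
  rw [H1.norm_sq]
  nlinarith [norm_nonneg (H1.toL2 Ω u)]

lemma H1.norm_toL2_le_norm {Ω : BoundedC1Domain N} (u : H1 Ω) : ‖H1.toL2 Ω u‖ ≤ ‖u‖ := by
  refine le_of_sq_le_sq ?_ (norm_nonneg _)
  rw [H1.norm_sq]
  exact le_add_of_nonneg_right (Finset.sum_nonneg fun i _ => sq_nonneg _)

lemma norm_L2_le_of_ae_le_sum {Ω : BoundedC1Domain N} {ι : Type*} [Fintype ι] {F : L2 Ω}
    {G : ι → L2 Ω} {M : ℝ} (hM : 0 ≤ M) (h : ∀ᵐ x ∂Ω.vol, |F x| ≤ M * ∑ j, |G j x|) :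
    ‖F‖ ≤ M * ∑ j, ‖G j‖ := by
  have h1 : ‖F‖ ≤ M * ‖∑ j, |G j|‖ := by
    refine Lp.norm_le_mul_norm_of_ae_le_mul ?_
    filter_upwards [h, Lp.coeFn_finsetSum Finset.univ fun j => |G j|,
      ae_all_iff.2 fun j => Lp.coeFn_abs (G j)] with x hx h2 h3
    rw [h2]
    simp only [Finset.sum_apply, h3, Real.norm_eq_abs]
    exact hx.trans (mul_le_mul_of_nonneg_left (le_abs_self _) hM)
  refine h1.trans (mul_le_mul_of_nonneg_left ((norm_sum_le _ _).trans ?_) hM)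
  simp [norm_abs_eq_norm]

lemma H1.toL2_smoothToH1 {Ω : BoundedC1Domain N} (f : smoothFunctions N) :
    H1.toL2 Ω (smoothToH1 Ω f) =ᵐ[Ω.vol] f :=
  MemLp.coeFn_toLp (memLp_vol Ω (smoothFunctions.contDiff f).continuous 2)

lemma H1.grad_smoothToH1 {Ω : BoundedC1Domain N} (f : smoothFunctions N) (i : Fin N) :
    H1.grad Ω i (smoothToH1 Ω f) =ᵐ[Ω.vol] partialDeriv i f :=
  MemLp.coeFn_toLp (memLp_vol Ω (continuous_partialDeriv (smoothFunctions.contDiff f) i) 2)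

lemma partialDeriv_sum_mul {ι : Type*} [Fintype ι] {χ w : ι → Space N → ℝ}
    (hχ : ∀ j, ContDiff ℝ ∞ (χ j)) (hw : ∀ j, ContDiff ℝ ∞ (w j)) (i : Fin N) (x : Space N) :
    partialDeriv i (fun x => ∑ j, χ j x * w j x) x
      = ∑ j, (partialDeriv i (χ j) x * w j x + χ j x * partialDeriv i (w j) x) := by
  have h : HasFDerivAt (fun x => ∑ j, χ j x * w j x)
      (∑ j, (χ j x • fderiv ℝ (w j) x + w j x • fderiv ℝ (χ j) x)) x :=
    HasFDerivAt.fun_sum fun j _ => HasFDerivAt.mul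
      ((hχ j).differentiable (by simp) x).hasFDerivAt
      ((hw j).differentiable (by simp) x).hasFDerivAt
  rw [partialDeriv, h.fderiv]
  simp only [sum_apply, add_apply, smul_apply, smul_eq_mul, partialDeriv]
  exact Finset.sum_congr rfl fun j _ => by ring

lemma exists_partialDeriv_bound (Ω : BoundedC1Domain N) {ι : Type*} [Fintype ι]
    {χ : ι → Space N → ℝ} (hχ : ∀ j, ContDiff ℝ ∞ (χ j)) :
    ∃ M : ℝ, 1 ≤ M ∧ ∀ i j, ∀ x ∈ Ω.carrier, |partialDeriv i (χ j) x| ≤ M := by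
  choose C hC using fun p : Fin N × ι => Ω.isCompact_closure.exists_bound_of_continuousOn
    (continuous_partialDeriv (hχ p.2) p.1).continuousOn
  refine ⟨1 + ∑ p, |C p|, le_add_of_nonneg_right (Finset.sum_nonneg fun _ _ => abs_nonneg _), ?_⟩
  intro i j x hx
  have h1 := hC (i, j) x (subset_closure hx)
  have h2 : |C (i, j)| ≤ ∑ p, |C p| :=
    Finset.single_le_sum (f := fun p => |C p|) (fun _ _ => abs_nonneg _) (Finset.mem_univ _)
  rw [Real.norm_eq_abs] at h1
  linarith [le_abs_self (C (i, j))]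

/-- Functions in `H¹(Ω)` are approximated by `∑ χ_j (k_j ⋆ u)` with a partition of unity `χ_j` on
`Ω` and inward mollifiers `k_j`. -/
theorem denseRange_smoothToH1 (Ω : BoundedC1Domain N) : DenseRange (smoothToH1 Ω) := by
  obtain ⟨ι, _, χ, hχ, hχ0, hχ1, hsum, hmol⟩ := exists_inward_partition Ω
  obtain ⟨M, hM1, hM⟩ := exists_partialDeriv_bound Ω hχ
  have hM0 : 0 ≤ M := zero_le_one.trans hM1
  refine Metric.denseRange_iff.2 fun u ε hε => ?_
  set C : ℝ := M * Fintype.card ι * (1 + 2 * N) with hC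
  have hC0 : 0 ≤ C := by positivity
  set η : ℝ := ε / (C + 1) with hη
  have hηpos : 0 < η := by positivity
  obtain ⟨δ₀, hδ₀, h₀⟩ := exists_norm_mollifyL2_sub_le (H1.toL2 Ω u) hηpos
  choose δ hδ hd using fun i => exists_norm_mollifyL2_sub_le (H1.grad Ω i u) hηpos
  obtain ⟨δ', hδ', hle⟩ : ∃ δ' > 0, δ' ≤ δ₀ ∧ ∀ i, δ' ≤ δ i := by
    have h1 : ∀ᶠ d in 𝓝[>] (0 : ℝ), d ≤ δ₀ := nhdsWithin_le_nhds (Iic_mem_nhds hδ₀)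
    have h2 : ∀ᶠ d in 𝓝[>] (0 : ℝ), ∀ i, d ≤ δ i :=
      eventually_all.2 fun i => nhdsWithin_le_nhds (Iic_mem_nhds (hδ i))
    have h : ∀ᶠ d in 𝓝[>] (0 : ℝ), 0 < d ∧ d ≤ δ₀ ∧ ∀ i, d ≤ δ i :=
      eventually_mem_nhdsWithin.and (h1.and h2)
    obtain ⟨d, h1, h2⟩ := h.exists
    exact ⟨d, h1, h2⟩
  choose k S hk hS hin using fun j => hmol j δ' hδ'
  let w : ι → Space N → ℝ := fun j => mollify Ω (k j) (H1.toL2 Ω u)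
  have hw : ∀ j, ContDiff ℝ ∞ (w j) := fun j => contDiff_mollify Ω (hk j) _
  let W : smoothFunctions N := ⟨fun x => ∑ j, χ j x * w j x,
    ContDiff.sum fun j _ => (hχ j).mul (hw j)⟩
  refine ⟨W, ?_⟩
  rw [dist_comm, dist_eq_norm]
  have hv : ∀ᵐ x ∂Ω.vol, x ∈ Ω.carrier := ae_restrict_mem Ω.isOpen.measurableSet
  have hsub : ∀ (g g' : L2 Ω), (g - g' : L2 Ω) =ᵐ[Ω.vol] fun x => g x - g' x :=
    fun g g' => Lp.coeFn_sub g g'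
  have e0 : ‖H1.toL2 Ω (smoothToH1 Ω W - u)‖
      ≤ M * ∑ j, ‖mollifyL2 Ω (hk j) (H1.toL2 Ω u) - H1.toL2 Ω u‖ := by
    refine norm_L2_le_of_ae_le_sum hM0 ?_
    rw [map_sub]
    filter_upwards [hv, hsub (H1.toL2 Ω (smoothToH1 Ω W)) (H1.toL2 Ω u), H1.toL2_smoothToH1 W,
      ae_all_iff.2 fun j => hsub (mollifyL2 Ω (hk j) (H1.toL2 Ω u)) (H1.toL2 Ω u),
      ae_all_iff.2 fun j => coeFn_mollifyL2 (hk j) (H1.toL2 Ω u)] with x hx h1 h2 h3 h4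
    have h5 : (W : Space N → ℝ) x - H1.toL2 Ω u x = ∑ j, χ j x * (w j x - H1.toL2 Ω u x) := by
      simp only [mul_sub, Finset.sum_sub_distrib, ← Finset.sum_mul, hsum x hx, one_mul]
      rfl
    rw [h1, h2, h5, Finset.mul_sum]
    refine (Finset.abs_sum_le_sum_abs _ _).trans (Finset.sum_le_sum fun j _ => ?_)
    rw [h3 j, h4 j, abs_mul, abs_of_nonneg (hχ0 j x)]
    exact mul_le_mul_of_nonneg_right ((hχ1 j x).trans hM1) (abs_nonneg _)
  have e1 : ∀ i, ‖H1.grad Ω i (smoothToH1 Ω W - u)‖ ≤ M * ∑ j : ι ⊕ ι,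
      ‖Sum.elim (fun j => mollifyL2 Ω (hk j) (H1.toL2 Ω u) - H1.toL2 Ω u)
        (fun j => mollifyL2 Ω (hk j) (H1.grad Ω i u) - H1.grad Ω i u) j‖ := by
    intro i
    refine norm_L2_le_of_ae_le_sum hM0 ?_
    rw [map_sub]
    filter_upwards [hv, hsub (H1.grad Ω i (smoothToH1 Ω W)) (H1.grad Ω i u),
      H1.grad_smoothToH1 W i,
      ae_all_iff.2 fun j => hsub (mollifyL2 Ω (hk j) (H1.toL2 Ω u)) (H1.toL2 Ω u),
      ae_all_iff.2 fun j => coeFn_mollifyL2 (hk j) (H1.toL2 Ω u),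
      ae_all_iff.2 fun j => hsub (mollifyL2 Ω (hk j) (H1.grad Ω i u)) (H1.grad Ω i u),
      ae_all_iff.2 fun j => coeFn_mollifyL2 (hk j) (H1.grad Ω i u)] with x hx h1 h2 h3 h4 h5 h6
    -- the partition sums to `1` on the open set `Ω`
    have hd0 : ∑ j, partialDeriv i (χ j) x = 0 := by
      have h7 := partialDeriv_sum_mul hχ (w := fun _ _ => 1) (fun _ => contDiff_const) i x
      have h8 : (fun x => ∑ j, χ j x * 1) =ᶠ[𝓝 x] fun _ => 1 := by
        filter_upwards [Ω.isOpen.mem_nhds hx] with y hy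
        simpa using hsum y hy
      rw [partialDeriv, h8.fderiv_eq] at h7
      simpa [partialDeriv] using h7.symm
    -- off the support of `χ_j` both sides vanish, and on it the mollifier `k_j` is inward
    have h9 : ∀ j, χ j x * partialDeriv i (w j) x = χ j x * mollify Ω (k j) (H1.grad Ω i u) x := by
      intro j
      by_cases hxs : x ∈ tsupport (χ j)
      · rw [partialDeriv_mollify_of_isWeakPartial (hk j) (H1.isWeakPartial u i)]
        intro z hz
        simpa using hin j x ⟨hx, hxs⟩ z hz 1 (by simp)
      · simp [image_eq_zero_of_notMem_tsupport hxs]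
    have h10 : partialDeriv i (W : Space N → ℝ) x - H1.grad Ω i u x
        = ∑ j, (partialDeriv i (χ j) x * (w j x - H1.toL2 Ω u x)
          + χ j x * (mollify Ω (k j) (H1.grad Ω i u) x - H1.grad Ω i u x)) := by
      have h11 := partialDeriv_sum_mul hχ hw i x
      simp only [h9] at h11
      simp only [mul_sub, Finset.sum_sub_distrib, Finset.sum_add_distrib, ← Finset.sum_mul,
        hsum x hx, one_mul, hd0, zero_mul, sub_zero]
      rw [← add_sub_assoc, ← Finset.sum_add_distrib, ← h11]
    rw [h1, h2, h10, Fintype.sum_sum_type, ← Finset.sum_add_distrib, Finset.mul_sum]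
    refine (Finset.abs_sum_le_sum_abs _ _).trans (Finset.sum_le_sum fun j _ => ?_)
    simp only [Sum.elim_inl, Sum.elim_inr]
    rw [h3 j, h4 j, h5 j, h6 j, mul_add]
    refine (abs_add_le _ _).trans (add_le_add ?_ ?_)
    · rw [abs_mul]
      exact mul_le_mul_of_nonneg_right (hM i j x hx) (abs_nonneg _)
    · rw [abs_mul, abs_of_nonneg (hχ0 j x)]
      exact mul_le_mul_of_nonneg_right ((hχ1 j x).trans hM1) (abs_nonneg _)
  have hSδ : ∀ j, ∀ r ≥ δ', S j ⊆ Metric.ball 0 r := fun j r h =>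
    (hS j).trans (Metric.ball_subset_ball h)
  have s0 : ∑ j, ‖mollifyL2 Ω (hk j) (H1.toL2 Ω u) - H1.toL2 Ω u‖ ≤ Fintype.card ι * η := by
    refine (Finset.sum_le_card_nsmul _ _ η fun j _ =>
      h₀ _ _ (hk j) (hSδ j _ hle.1)).trans_eq ?_
    simp
  have s1 : ∀ i, ∑ j, ‖mollifyL2 Ω (hk j) (H1.grad Ω i u) - H1.grad Ω i u‖
      ≤ Fintype.card ι * η := by
    intro i
    refine (Finset.sum_le_card_nsmul _ _ η fun j _ =>
      hd i _ _ (hk j) (hSδ j _ (hle.2 i))).trans_eq ?_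
    simp
  have e2 : ∀ i, ‖H1.grad Ω i (smoothToH1 Ω W - u)‖ ≤ M * (2 * (Fintype.card ι * η)) := by
    intro i
    refine (e1 i).trans (mul_le_mul_of_nonneg_left ?_ hM0)
    rw [Fintype.sum_sum_type]
    simp only [Sum.elim_inl, Sum.elim_inr]
    linarith [s1 i]
  calc ‖smoothToH1 Ω W - u‖ ≤ M * (Fintype.card ι * η) + ∑ _i : Fin N,
        M * (2 * (Fintype.card ι * η)) :=
        (H1.norm_le _).trans (add_le_add (e0.trans (mul_le_mul_of_nonneg_left s0 hM0))
          (Finset.sum_le_sum fun i _ => e2 i))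
    _ = C * η := by
        simp [hC]
        ring
    _ < ε := by
        rw [hη, mul_div_assoc', div_lt_iff₀ (by positivity)]
        nlinarith

/-! ### Rellich's theorem -/

/-- An operator is compact if its norm is controlled, up to arbitrarily small multiples of the norm,
by compact operators. -/
lemma isCompactOperator_of_forall_exists_le {X Y : Type*} [NormedAddCommGroup X] [NormedSpace ℝ X]
    [NormedAddCommGroup Y] [NormedSpace ℝ Y] [CompleteSpace Y] (A : X →L[ℝ] Y)
    (h : ∀ ε > 0, ∃ (Z : Type) (_ : NormedAddCommGroup Z) (_ : NormedSpace ℝ Z) (K : X →L[ℝ] Z),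
      IsCompactOperator K ∧ ∀ u, ‖A u‖ ≤ ε * ‖u‖ + ‖K u‖) : IsCompactOperator A := by
  have htb : TotallyBounded (A '' Metric.closedBall 0 1) := by
    refine Metric.totallyBounded_iff.2 fun ε hε => ?_
    obtain ⟨Z, _, _, K, hK, hA⟩ := h (ε / 4) (by positivity)
    have hKt : TotallyBounded (K '' Metric.closedBall 0 1) :=
      (hK.isCompact_closure_image_closedBall (f := (K : X →ₗ[ℝ] Z)) 1).totallyBounded.subset
        subset_closure
    obtain ⟨t, hts, htf, hcov⟩ := Metric.finite_approx_of_totallyBounded hKt (ε / 4) (by positivity)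
    choose! v hv hKv using fun z (hz : z ∈ t) => (mem_image _ _ _).1 (hts hz)
    refine ⟨(fun z => A (v z)) '' t, htf.image _, ?_⟩
    rintro _ ⟨u, hu, rfl⟩
    obtain ⟨z, hz, huz⟩ := mem_iUnion₂.1 (hcov ⟨u, hu, rfl⟩)
    refine mem_iUnion₂.2 ⟨_, ⟨z, hz, rfl⟩, ?_⟩
    rw [mem_ball_iff_norm, ← map_sub]
    rw [mem_ball_iff_norm, ← hKv z hz, ← map_sub] at huz
    have h1 := hv z hz
    rw [mem_closedBall_zero_iff] at hu h1
    have h2 := norm_sub_le u (v z)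
    have h3 := hA (u - v z)
    nlinarith
  exact (isCompactOperator_iff_isCompact_closure_image_closedBall (A : X →ₗ[ℝ] Y) one_pos).2
    (htb.closure.isCompact_of_isClosed isClosed_closure)

/-- The functional `g ↦ (k ⋆ g) (x)` on `L²(Ω)`. -/
def mollifyAt (Ω : BoundedC1Domain N) {k : Space N → ℝ} {S : Set (Space N)}
    (hk : IsMollifier k S) (x : Space N) : L2 Ω →L[ℝ] ℝ :=
  innerSL ℝ ((memLp_vol Ω (f := fun y => k (x - y))
    (hk.smooth.continuous.comp (continuous_const.sub continuous_id)) 2).toLp _)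

lemma mollifyAt_apply {Ω : BoundedC1Domain N} {k : Space N → ℝ} {S : Set (Space N)}
    (hk : IsMollifier k S) (x : Space N) (g : L2 Ω) : mollifyAt Ω hk x g = mollify Ω k g x := by
  have hm : MemLp (fun y => k (x - y)) 2 Ω.vol := memLp_vol Ω
    (hk.smooth.continuous.comp (continuous_const.sub continuous_id)) 2
  change inner ℝ (hm.toLp _) g = _
  rw [L2.inner_def, mollify]
  refine integral_congr_ae ?_
  filter_upwards [hm.coeFn_toLp] with y hy
  rw [hy]
  simp

/-- The mollifications of the functions in a ball of `L²(Ω)` are equicontinuous, so that they are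
controlled by their values at finitely many points. -/
lemma exists_finset_mollify (Ω : BoundedC1Domain N) {k : Space N → ℝ} {S : Set (Space N)}
    (hk : IsMollifier k S) {ε : ℝ} (hε : 0 < ε) :
    ∃ t : Finset (Space N), ∀ (g : L2 Ω), ∀ x ∈ Ω.carrier, ∃ y ∈ t,
      |mollify Ω k g x| ≤ ε * ‖g‖ + |mollify Ω k g y| := by
  set m : ℝ := (measureUnivNNReal Ω.vol : ℝ) ^ (2 : ENNReal).toReal⁻¹ with hm
  have hm0 : 0 ≤ m := by positivity
  have huc := hk.hasCompactSupport.uniformContinuous_of_continuous hk.smooth.continuous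
  obtain ⟨δ, hδ, h⟩ := Metric.uniformContinuous_iff.1 huc (ε / (m + 1)) (by positivity)
  obtain ⟨t, -, ht, hcov⟩ := Metric.finite_approx_of_totallyBounded
    Ω.isCompact_closure.totallyBounded δ hδ
  refine ⟨ht.toFinset, fun g x hx => ?_⟩
  obtain ⟨y, hy, hxy⟩ := mem_iUnion₂.1 (hcov (subset_closure hx))
  refine ⟨y, ht.mem_toFinset.2 hy, ?_⟩
  have hd : ‖(memLp_vol Ω (f := fun z => k (x - z))
      (hk.smooth.continuous.comp (continuous_const.sub continuous_id)) 2).toLp _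
      - (memLp_vol Ω (f := fun z => k (y - z))
      (hk.smooth.continuous.comp (continuous_const.sub continuous_id)) 2).toLp _‖ ≤ ε := by
    rw [← MemLp.toLp_sub]
    refine (Lp.norm_le_of_ae_bound (C := ε / (m + 1)) (by positivity) ?_).trans ?_
    · filter_upwards [MemLp.coeFn_toLp ((memLp_vol Ω (f := fun z => k (x - z))
        (hk.smooth.continuous.comp (continuous_const.sub continuous_id)) 2).sub
        (memLp_vol Ω (f := fun z => k (y - z))
        (hk.smooth.continuous.comp (continuous_const.sub continuous_id)) 2))] with z hz
      rw [hz]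
      exact (h (a := x - z) (b := y - z) (by simpa using hxy)).le
    · change m * (ε / (m + 1)) ≤ ε
      rw [mul_div_assoc', div_le_iff₀ (by positivity)]
      nlinarith
  have h1 : |mollify Ω k g x - mollify Ω k g y| ≤ ε * ‖g‖ := by
    have hin : mollify Ω k g x - mollify Ω k g y = inner ℝ ((memLp_vol Ω (f := fun z => k (x - z))
        (hk.smooth.continuous.comp (continuous_const.sub continuous_id)) 2).toLp _
        - (memLp_vol Ω (f := fun z => k (y - z))
        (hk.smooth.continuous.comp (continuous_const.sub continuous_id)) 2).toLp _) g := by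
      rw [inner_sub_left, ← mollifyAt_apply hk, ← mollifyAt_apply hk]
      rfl
    rw [hin]
    exact (abs_real_inner_le_norm _ _).trans (by gcongr)
  have := abs_sub_abs_le_abs_sub (mollify Ω k g x) (mollify Ω k g y)
  linarith

/-- `|∇f(x)|²` as an extended non-negative real. -/
def gradSq (f : Space N → ℝ) (x : Space N) : ENNReal := ∑ i, ‖partialDeriv i f x‖ₑ ^ 2

lemma enorm_fderiv_apply_sq_le (f : Space N → ℝ) (x z : Space N) :
    ‖fderiv ℝ f x z‖ₑ ^ 2 ≤ ‖z‖ₑ ^ 2 * gradSq f x := by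
  have h1 : fderiv ℝ f x z = ∑ i, z i * partialDeriv i f x := by
    conv_lhs => rw [← (EuclideanSpace.basisFun (Fin N) ℝ).sum_repr z]
    simp [partialDeriv, map_sum]
  have h2 : (fderiv ℝ f x z) ^ 2 ≤ ‖z‖ ^ 2 * ∑ i, (partialDeriv i f x) ^ 2 := by
    rw [h1, EuclideanSpace.real_norm_sq_eq]
    exact Finset.sum_mul_sq_le_sq_mul_sq _ _ _
  have h3 : ∀ a : ℝ, ‖a‖ₑ ^ 2 = ENNReal.ofReal (a ^ 2) := fun a => by
    rw [← ofReal_norm, ← ENNReal.ofReal_pow (norm_nonneg _)]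
    simp
  have h4 : ‖z‖ₑ ^ 2 = ENNReal.ofReal (‖z‖ ^ 2) := by
    rw [← ofReal_norm, ← ENNReal.ofReal_pow (norm_nonneg _)]
  simp only [gradSq, h3, h4]
  rw [← ENNReal.ofReal_sum_of_nonneg fun i _ => sq_nonneg _, ← ENNReal.ofReal_mul (by positivity)]
  exact ENNReal.ofReal_le_ofReal h2

lemma measurable_gradSq {f : Space N → ℝ} (hf : ContDiff ℝ ∞ f) : Measurable (gradSq f) :=
  Finset.measurable_fun_sum _ fun i _ => by
    have := (continuous_partialDeriv hf i).measurable
    fun_prop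

/-- The translation estimate `‖f(· - z) - f‖ ≤ |z| ‖∇f‖`. -/
lemma lintegral_translation_le {Ω A : Set (Space N)} (hΩ : MeasurableSet Ω) (hA : MeasurableSet A)
    {f : Space N → ℝ} (hf : ContDiff ℝ ∞ f) {z : Space N}
    (hz : ∀ x ∈ A, ∀ t ∈ Icc (0 : ℝ) 1, x - t • z ∈ Ω) :
    ∫⁻ x in A, ‖f (x - z) - f x‖ₑ ^ 2 ≤ ‖z‖ₑ ^ 2 * ∫⁻ x in Ω, gradSq f x := by
  have hgm := measurable_gradSq hf
  have hdc : Continuous (fderiv ℝ f) := hf.continuous_fderiv (by simp)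
  have hpt : ∀ x, ‖f (x - z) - f x‖ₑ ^ 2
      ≤ ∫⁻ t in Ioc (0 : ℝ) 1, ‖z‖ₑ ^ 2 * gradSq f (x - t • z) := by
    intro x
    have hd : ∀ t ∈ uIcc (0 : ℝ) 1, HasDerivAt (fun t : ℝ => f (x - t • z))
        (fderiv ℝ f (x - t • z) (-z)) t := by
      intro t _
      have h1 : HasDerivAt (fun t : ℝ => x - t • z) (-z) t := by
        simpa using ((hasDerivAt_id t).smul_const z).const_sub x
      exact ((hf.differentiable (by simp)) _).hasFDerivAt.comp_hasDerivAt t h1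
    have hc : Continuous fun t : ℝ => fderiv ℝ f (x - t • z) (-z) := by fun_prop
    have h1 := intervalIntegral.integral_eq_sub_of_hasDerivAt hd (hc.intervalIntegrable _ _)
    simp only [one_smul, zero_smul, sub_zero] at h1
    rw [← h1, intervalIntegral.integral_of_le zero_le_one]
    have : IsProbabilityMeasure ((volume : Measure ℝ).restrict (Ioc 0 1)) := ⟨by simp⟩
    have h2 := enorm_integral_le_lintegral_enorm (μ := (volume : Measure ℝ).restrict (Ioc 0 1))
      (fun t => fderiv ℝ f (x - t • z) (-z))
    rw [← eLpNorm_one_eq_lintegral_enorm] at h2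
    have h3 := eLpNorm_le_eLpNorm_of_exponent_le (p := 1) (q := 2) one_le_two
      (μ := (volume : Measure ℝ).restrict (Ioc 0 1)) hc.aestronglyMeasurable
    have h4 := eLpNorm_nnreal_pow_eq_lintegral (p := 2) two_ne_zero
      (f := fun t => fderiv ℝ f (x - t • z) (-z)) (μ := (volume : Measure ℝ).restrict (Ioc 0 1))
    simp only [ENNReal.coe_ofNat, NNReal.coe_ofNat, ENNReal.rpow_ofNat] at h4
    calc _ ≤ eLpNorm (fun t => fderiv ℝ f (x - t • z) (-z)) 2
          ((volume : Measure ℝ).restrict (Ioc 0 1)) ^ 2 := by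
          gcongr
          exact h2.trans h3
      _ ≤ _ := by
          rw [h4]
          refine lintegral_mono fun t => ?_
          simpa using enorm_fderiv_apply_sq_le f (x - t • z) (-z)
  calc ∫⁻ x in A, ‖f (x - z) - f x‖ₑ ^ 2
      ≤ ∫⁻ x in A, ∫⁻ t in Ioc (0 : ℝ) 1, ‖z‖ₑ ^ 2 * gradSq f (x - t • z) := lintegral_mono hpt
    _ = ∫⁻ t in Ioc (0 : ℝ) 1, ∫⁻ x in A, ‖z‖ₑ ^ 2 * gradSq f (x - t • z) :=
        lintegral_lintegral_swap (by fun_prop)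
    _ ≤ ∫⁻ t in Ioc (0 : ℝ) 1, ‖z‖ₑ ^ 2 * ∫⁻ x in Ω, gradSq f x := by
        refine setLIntegral_mono' measurableSet_Ioc fun t ht => ?_
        rw [lintegral_const_mul _ (by fun_prop)]
        refine mul_le_mul' le_rfl ?_
        rw [← lintegral_indicator hA, ← lintegral_indicator hΩ,
          ← lintegral_sub_right_eq_self (Ω.indicator (gradSq f)) (t • z)]
        refine lintegral_mono fun x => ?_
        by_cases hx : x ∈ A
        · rw [indicator_of_mem hx, indicator_of_mem (hz x hx t ⟨ht.1.le, ht.2⟩)]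
        · simp [hx]
    _ = _ := by simp

lemma lintegral_gradSq {Ω : BoundedC1Domain N} (f : smoothFunctions N) :
    ∫⁻ x in Ω.carrier, gradSq f x = ∑ i, ‖H1.grad Ω i (smoothToH1 Ω f)‖ₑ ^ 2 := by
  simp only [gradSq]
  rw [lintegral_finsetSum _ fun i _ => by
    have := (continuous_partialDeriv (smoothFunctions.contDiff f) i).measurable
    fun_prop]
  refine Finset.sum_congr rfl fun i _ => ?_
  rw [enorm_L2_sq]
  refine lintegral_congr_ae ?_
  filter_upwards [H1.grad_smoothToH1 (Ω := Ω) f i] with x hx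
  rw [hx]

lemma lintegral_gradSq_le {Ω : BoundedC1Domain N} (f : smoothFunctions N) :
    ∫⁻ x in Ω.carrier, gradSq f x ≤ ‖smoothToH1 Ω f‖ₑ ^ 2 := by
  have h : ∀ {E : Type} [NormedAddCommGroup E] (a : E), ‖a‖ₑ ^ 2 = ENNReal.ofReal (‖a‖ ^ 2) :=
    fun a => by rw [← ofReal_norm, ← ENNReal.ofReal_pow (norm_nonneg _)]
  rw [lintegral_gradSq]
  simp only [h]
  rw [← ENNReal.ofReal_sum_of_nonneg fun i _ => sq_nonneg _, H1.norm_sq]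
  exact ENNReal.ofReal_le_ofReal (le_add_of_nonneg_left (sq_nonneg _))

/-- A smooth `u` is `∑ χ_j (u - k_j ⋆ u) + ∑ χ_j (k_j ⋆ u)` on `Ω`. Here the first sum is at most a
small multiple of the gradient by the translation estimate, and the second one is controlled by the
values of `k_j ⋆ u` at finitely many points. -/
lemma exists_norm_toL2_smoothToH1_le (Ω : BoundedC1Domain N) {ε : ℝ} (hε : 0 < ε) :
    ∃ (κ : Type) (_ : Fintype κ) (K : L2 Ω →L[ℝ] (κ → ℝ)), ∀ f : smoothFunctions N,
      ‖H1.toL2 Ω (smoothToH1 Ω f)‖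
        ≤ ε * ‖smoothToH1 Ω f‖ + ‖K (H1.toL2 Ω (smoothToH1 Ω f))‖ := by
  obtain ⟨ι, _, χ, hχ, hχ0, hχ1, hsum, hmol⟩ := exists_inward_partition Ω
  set m : ℝ := (measureUnivNNReal Ω.vol : ℝ) ^ (2 : ENNReal).toReal⁻¹ with hm
  have hm0 : 0 ≤ m := by positivity
  set n : ℝ := (Fintype.card ι : ℝ) with hn
  have hn0 : 0 ≤ n := by positivity
  set η : ℝ := ε / (n * (1 + m) + 1) with hη
  have hηpos : 0 < η := by positivity
  choose k S hk hS hin using fun j => hmol j η hηpos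
  choose t ht using fun j => exists_finset_mollify Ω (hk j) hηpos
  let K : L2 Ω →L[ℝ] ((Σ j, t j) → ℝ) :=
    ContinuousLinearMap.pi fun p => mollifyAt Ω (hk p.1) p.2
  refine ⟨_, inferInstance, (n * m) • K, fun f => ?_⟩
  set u := smoothToH1 Ω f with hu
  set g := H1.toL2 Ω u with hg
  have hfc := (smoothFunctions.contDiff f).continuous
  have hv : ∀ᵐ x ∂Ω.vol, x ∈ Ω.carrier := ae_restrict_mem Ω.isOpen.measurableSet
  have hgf : g =ᵐ[Ω.vol] f := H1.toL2_smoothToH1 f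
  have hGm : ∀ j, MemLp (fun x => χ j x * (mollify Ω (k j) g x - f.1 x)) 2 Ω.vol := fun j =>
    memLp_vol Ω ((hχ j).continuous.mul ((contDiff_mollify Ω (hk j) g).continuous.sub hfc)) 2
  have hgn : ‖g‖ ≤ ‖u‖ := H1.norm_toL2_le_norm u
  have hG : ∀ j, ‖(hGm j).toLp _‖ ≤ η * ‖u‖ := by
    intro j
    refine norm_L2_le (by positivity) ?_
    have hA : MeasurableSet (Ω.carrier ∩ tsupport (χ j)) :=
      Ω.isOpen.measurableSet.inter (isClosed_tsupport _).measurableSet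
    have h1 := lintegral_mollify_sub_le (hk j) g (Ω.carrier ∩ tsupport (χ j))
      (C := ENNReal.ofReal ((η * ‖u‖) ^ 2)) (by
        intro z hz
        have hze : zeroExt g =ᵐ[volume] Ω.carrier.indicator f := by
          filter_upwards [(ae_restrict_iff' Ω.isOpen.measurableSet).1 hgf] with x hx
          by_cases hxΩ : x ∈ Ω.carrier
          · rw [zeroExt, indicator_of_mem hxΩ, indicator_of_mem hxΩ, hx hxΩ]
          · rw [zeroExt, indicator_of_notMem hxΩ, indicator_of_notMem hxΩ]
        have hze' := (measurePreserving_sub_right volume z).quasiMeasurePreserving.ae_eq_comp hze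
        have h2 : ∫⁻ x in Ω.carrier ∩ tsupport (χ j), ‖zeroExt g (x - z) - zeroExt g x‖ₑ ^ 2
            = ∫⁻ x in Ω.carrier ∩ tsupport (χ j), ‖f.1 (x - z) - f.1 x‖ₑ ^ 2 := by
          refine lintegral_congr_ae ?_
          filter_upwards [ae_restrict_mem hA, ae_restrict_of_ae hze, ae_restrict_of_ae hze']
            with x hx h3 h4
          simp only [Function.comp_apply] at h4
          have h5 : x - z ∈ Ω.carrier := by simpa using hin j x hx z hz 1 (by simp)
          rw [h3, h4, indicator_of_mem hx.1, indicator_of_mem h5]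
        rw [h2, mul_pow, ENNReal.ofReal_mul (by positivity), ENNReal.ofReal_pow (norm_nonneg _),
          ofReal_norm]
        refine (lintegral_translation_le Ω.isOpen.measurableSet hA (smoothFunctions.contDiff f)
          fun x hx => hin j x hx z hz).trans (mul_le_mul' ?_ (lintegral_gradSq_le f))
        rw [← ofReal_norm, ← ENNReal.ofReal_pow (norm_nonneg _)]
        have h6 := mem_ball_zero_iff.1 (hS j hz)
        exact ENNReal.ofReal_le_ofReal (by gcongr))
    refine le_trans ?_ h1
    rw [← lintegral_indicator hA]
    refine le_trans ?_ (setLIntegral_le_lintegral Ω.carrier _)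
    refine lintegral_mono_ae ?_
    filter_upwards [hv, hgf, (hGm j).coeFn_toLp] with x hx h3 h4
    rw [h4]
    by_cases hxs : x ∈ tsupport (χ j)
    · have hxA : x ∈ Ω.carrier ∩ tsupport (χ j) := ⟨hx, hxs⟩
      rw [indicator_of_mem hxA, zeroExt, indicator_of_mem hx, h3, enorm_mul]
      refine pow_le_pow_left' (mul_le_of_le_one_left' ?_) 2
      rw [Real.enorm_eq_ofReal (hχ0 j x)]
      exact ENNReal.ofReal_le_one.2 (hχ1 j x)
    · simp [image_eq_zero_of_notMem_tsupport hxs]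
  have hG' : ∀ j, ‖mollifyL2 Ω (hk j) g‖ ≤ m * (η * ‖u‖ + ‖K g‖) := by
    intro j
    refine Lp.norm_le_of_ae_bound (by positivity) ?_
    filter_upwards [hv, coeFn_mollifyL2 (hk j) g] with x hx h3
    obtain ⟨y, hy, hxy⟩ := ht j g x hx
    have h4 := norm_le_pi_norm (K g) ⟨j, y, hy⟩
    have h5 : K g ⟨j, y, hy⟩ = mollify Ω (k j) g y := mollifyAt_apply (hk j) y g
    rw [h5, Real.norm_eq_abs] at h4
    rw [h3, Real.norm_eq_abs]
    nlinarith
  have hfin : ‖g‖ ≤ 1 * ∑ j : ι ⊕ ι,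
      ‖Sum.elim (fun j => (hGm j).toLp _) (fun j => mollifyL2 Ω (hk j) g) j‖ := by
    refine norm_L2_le_of_ae_le_sum zero_le_one ?_
    filter_upwards [hv, hgf, ae_all_iff.2 fun j => (hGm j).coeFn_toLp,
      ae_all_iff.2 fun j => coeFn_mollifyL2 (hk j) g] with x hx h1 h2 h3
    have h4 : f.1 x = ∑ j, (χ j x * mollify Ω (k j) g x
        - χ j x * (mollify Ω (k j) g x - f.1 x)) := by
      simp [mul_sub, ← Finset.sum_mul, hsum x hx]
    rw [h1, one_mul, Fintype.sum_sum_type, ← Finset.sum_add_distrib]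
    change |f.1 x| ≤ _
    rw [h4]
    refine (Finset.abs_sum_le_sum_abs _ _).trans (Finset.sum_le_sum fun j _ => ?_)
    simp only [Sum.elim_inl, Sum.elim_inr]
    rw [h2 j, h3 j, add_comm]
    refine (abs_sub _ _).trans (add_le_add ?_ le_rfl)
    rw [abs_mul, abs_of_nonneg (hχ0 j x)]
    exact mul_le_of_le_one_left (abs_nonneg _) (hχ1 j x)
  rw [one_mul, Fintype.sum_sum_type] at hfin
  simp only [Sum.elim_inl, Sum.elim_inr] at hfin
  have s1 : ∑ j, ‖(hGm j).toLp _‖ ≤ n * (η * ‖u‖) := by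
    refine (Finset.sum_le_card_nsmul _ _ _ fun j _ => hG j).trans_eq ?_
    simp [hn]
  have s2 : ∑ j, ‖mollifyL2 Ω (hk j) g‖ ≤ n * (m * (η * ‖u‖ + ‖K g‖)) := by
    refine (Finset.sum_le_card_nsmul _ _ _ fun j _ => hG' j).trans_eq ?_
    simp [hn]
  have h7 : n * (1 + m) * η ≤ ε := by
    rw [hη, mul_div_assoc', div_le_iff₀ (by positivity)]
    nlinarith [mul_nonneg hn0 (add_nonneg zero_le_one hm0)]
  have h8 : ‖((n * m) • K) g‖ = n * m * ‖K g‖ := by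
    rw [smul_apply, norm_smul, Real.norm_of_nonneg (by positivity)]
  rw [h8]
  nlinarith [norm_nonneg u]

lemma exists_norm_toL2_le (Ω : BoundedC1Domain N) {ε : ℝ} (hε : 0 < ε) :
    ∃ (κ : Type) (_ : Fintype κ) (K : L2 Ω →L[ℝ] (κ → ℝ)), ∀ u : H1 Ω,
      ‖H1.toL2 Ω u‖ ≤ ε * ‖u‖ + ‖K (H1.toL2 Ω u)‖ := by
  obtain ⟨κ, _, K, hK⟩ := exists_norm_toL2_smoothToH1_le Ω hε
  refine ⟨κ, inferInstance, K, fun u => ?_⟩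
  exact (denseRange_smoothToH1 Ω).induction_on u
    (isClosed_le (by fun_prop) (by fun_prop)) hK

/-- Rellich's theorem: the inclusion of `H¹(Ω)` in `L²(Ω)` is compact. -/
theorem isCompactOperator_toL2 (Ω : BoundedC1Domain N) : IsCompactOperator (H1.toL2 Ω) := by
  refine isCompactOperator_of_forall_exists_le _ fun ε hε => ?_
  obtain ⟨κ, _, K, hK⟩ := exists_norm_toL2_le Ω hε
  exact ⟨κ → ℝ, inferInstance, inferInstance, K.comp (H1.toL2 Ω),
    isCompactOperator_of_locallyCompactSpace_dom (K.comp (H1.toL2 Ω)), hK⟩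

/-! ### The trace inequality -/

/-- A one-dimensional trace inequality, obtained by integrating the derivative of
`(1 - s / δ) h(s)²`. -/
lemma sq_le_integral_of_hasDerivAt {h h' : ℝ → ℝ} (hd : ∀ s, HasDerivAt h (h' s) s)
    (hc : Continuous h') {δ ε : ℝ} (hδ : 0 < δ) (hε : 0 < ε) :
    h 0 ^ 2 ≤ ∫ s in (0 : ℝ)..δ, ((1 / δ + 1 / ε) * h s ^ 2 + ε * h' s ^ 2) := by
  have hcont : Continuous h := continuous_iff_continuousAt.2 fun s => (hd s).continuousAt
  have hφ : ∀ s ∈ uIcc 0 δ, HasDerivAt (fun s => (1 - s / δ) * h s ^ 2)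
      ((-(1 / δ)) * h s ^ 2 + (1 - s / δ) * (2 * h s * h' s)) s := by
    intro s _
    have h1 : HasDerivAt (fun s => 1 - s / δ) (-(1 / δ)) s :=
      ((hasDerivAt_id s).div_const δ).const_sub 1
    have h2 : HasDerivAt (fun s => h s ^ 2) (2 * h s * h' s) s := by
      simpa using (hd s).fun_pow 2
    exact h1.mul h2
  have hci : Continuous fun s => (-(1 / δ)) * h s ^ 2 + (1 - s / δ) * (2 * h s * h' s) := by
    fun_prop
  have h1 := intervalIntegral.integral_eq_sub_of_hasDerivAt hφ (hci.intervalIntegrable _ _)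
  rw [div_self hδ.ne', zero_div] at h1
  have h2 : h 0 ^ 2 = ∫ s in (0 : ℝ)..δ,
      -((-(1 / δ)) * h s ^ 2 + (1 - s / δ) * (2 * h s * h' s)) := by
    rw [intervalIntegral.integral_neg, h1]
    ring
  rw [h2]
  refine intervalIntegral.integral_mono_on hδ.le (hci.neg.intervalIntegrable _ _)
    (Continuous.intervalIntegrable (by fun_prop) _ _) fun s hs => ?_
  have h3 : 0 ≤ 1 - s / δ := by
    rw [sub_nonneg, div_le_one hδ]
    exact hs.2
  have h4 : 1 - s / δ ≤ 1 := by
    have := div_nonneg hs.1 hδ.le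
    linarith
  have h5 : 2 * |h s * h' s| ≤ 1 / ε * h s ^ 2 + ε * h' s ^ 2 := by
    have h6 : 0 ≤ 1 / ε * (|h s| - ε * |h' s|) ^ 2 := by positivity
    have h7 : 1 / ε * (|h s| - ε * |h' s|) ^ 2
        = 1 / ε * |h s| ^ 2 + ε * |h' s| ^ 2 - 2 * (|h s| * |h' s|) := by
      field_simp
      ring
    rw [h7, sq_abs, sq_abs] at h6
    rw [abs_mul]
    linarith
  have h8 : -((1 - s / δ) * (2 * h s * h' s)) ≤ 2 * |h s * h' s| := by
    have h9 := neg_abs_le (h s * h' s)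
    have h10 := mul_le_of_le_one_left (abs_nonneg (h s * h' s)) h4
    nlinarith
  linarith

lemma enorm_sq_le_lintegral_of_hasDerivAt {h h' : ℝ → ℝ} (hd : ∀ s, HasDerivAt h (h' s) s)
    (hc : Continuous h') {δ ε : ℝ} (hδ : 0 < δ) (hε : 0 < ε) :
    ‖h 0‖ₑ ^ 2 ≤ ∫⁻ s in Ioc 0 δ, (ENNReal.ofReal (1 / δ + 1 / ε) * ‖h s‖ₑ ^ 2
      + ENNReal.ofReal ε * ‖h' s‖ₑ ^ 2) := by
  have hcont : Continuous h := continuous_iff_continuousAt.2 fun s => (hd s).continuousAt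
  have hsq : ∀ a : ℝ, ‖a‖ₑ ^ 2 = ENNReal.ofReal (a ^ 2) := fun a => by
    rw [← ofReal_norm, ← ENNReal.ofReal_pow (norm_nonneg _)]
    simp
  have h1 := sq_le_integral_of_hasDerivAt hd hc hδ hε
  rw [intervalIntegral.integral_of_le hδ.le] at h1
  have h2 : ∀ s, ENNReal.ofReal (1 / δ + 1 / ε) * ‖h s‖ₑ ^ 2 + ENNReal.ofReal ε * ‖h' s‖ₑ ^ 2
      = ENNReal.ofReal ((1 / δ + 1 / ε) * h s ^ 2 + ε * h' s ^ 2) := fun s => by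
    rw [hsq, hsq, ← ENNReal.ofReal_mul (by positivity), ← ENNReal.ofReal_mul hε.le,
      ← ENNReal.ofReal_add (by positivity) (by positivity)]
  simp only [h2]
  rw [hsq]
  rw [← ofReal_integral_eq_lintegral_ofReal]
  · exact ENNReal.ofReal_le_ofReal h1
  · exact (Continuous.integrableOn_Icc (by fun_prop)).mono_set Ioc_subset_Icc_self
  · exact ae_of_all _ fun s => by positivity

/-- The subgraph coordinates `(w, s) ↦ w + (γ(w) - s) e` preserve volume. -/
lemma measurePreserving_graph_sub {e : Space N} (he : ‖e‖ = 1) {γ : Space N → ℝ}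
    (hγ : Continuous γ) :
    MeasurePreserving (fun p : (Submodule.span ℝ {e})ᗮ × ℝ =>
      (p.1 : Space N) + (γ p.1 - p.2) • e) (volume.prod volume) volume := by
  have h1 : MeasurePreserving (fun p : (Submodule.span ℝ {e})ᗮ × ℝ => (p.1, γ p.1 - p.2))
      (volume.prod volume) (volume.prod volume) := by
    refine (MeasurePreserving.id volume).skew_product
      (g := fun (w : (Submodule.span ℝ {e})ᗮ) (s : ℝ) => γ w - s) ?_ ?_
    · exact Continuous.measurable (by fun_prop)
    · exact ae_of_all _ fun w => (volume.measurePreserving_sub_left (γ w)).map_eq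
  have h2 : MeasurePreserving (Prod.swap : (Submodule.span ℝ {e})ᗮ × ℝ → _)
      (volume.prod volume) (volume.prod volume) := Measure.measurePreserving_swap
  have h3 : MeasurePreserving (Prod.map (LinearIsometryEquiv.toSpanUnitSingleton e he) id :
      ℝ × (Submodule.span ℝ {e})ᗮ → _) (volume.prod volume) (volume.prod volume) :=
    (LinearIsometryEquiv.toSpanUnitSingleton (𝕜 := ℝ) e he).measurePreserving.prod
      (MeasurePreserving.id _)
  have h4 := ((Submodule.span ℝ {e}).measurePreserving_measurableEquivProd (0 : Space N)).symm
  rw [InnerProductSpace.euclideanHausdorffMeasure_eq_volume] at h4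
  have h5 := h4.comp (h3.comp (h2.comp h1))
  convert! h5 using 1
  ext1 p
  simp [add_comm]

lemma finrank_orthogonal_unit {e : Space N} (he : ‖e‖ = 1) :
    Module.finrank ℝ (Submodule.span ℝ {e})ᗮ = N - 1 := by
  have h1 := Submodule.finrank_add_finrank_orthogonal (Submodule.span ℝ {e})
  have h2 : Module.finrank ℝ (Submodule.span ℝ {e}) = 1 :=
    finrank_span_singleton (by rintro rfl; simp at he)
  rw [h2, finrank_euclideanSpace_fin] at h1
  omega

/-- A Lipschitz parametrisation `G` of a set `A` bounds the Hausdorff measure on `A`. -/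
lemma restrict_le_map_of_lipschitzOnWith {W : Type*} [NormedAddCommGroup W] [InnerProductSpace ℝ W]
    [FiniteDimensional ℝ W] [MeasurableSpace W] [BorelSpace W] {G : W → Space N}
    (hG : Measurable G) {K : ℝ≥0} {A : Set (Space N)}
    (hK : LipschitzOnWith K G (G ⁻¹' A)) (hAG : A ⊆ range G) :
    (μHE[Module.finrank ℝ W] : Measure (Space N)).restrict A
      ≤ ((K : ENNReal) ^ Module.finrank ℝ W) • (volume.restrict (G ⁻¹' A)).map G := by
  refine Measure.le_iff.2 fun E hE => ?_
  rw [Measure.restrict_apply hE, Measure.smul_apply, Measure.map_apply hG hE,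
    Measure.restrict_apply (hG hE), ← preimage_inter]
  have h1 : E ∩ A = G '' (G ⁻¹' (E ∩ A)) :=
    (image_preimage_eq_of_subset (inter_subset_right.trans hAG)).symm
  have h2 := (hK.mono (preimage_mono inter_subset_right) :
    LipschitzOnWith K G (G ⁻¹' (E ∩ A))).hausdorffMeasure_image_le
      (d := (Module.finrank ℝ W : ℝ)) (by positivity)
  rw [h1, preimage_image_preimage, ← InnerProductSpace.euclideanHausdorffMeasure_eq_volume,
    Measure.euclideanHausdorffMeasure_def, Measure.euclideanHausdorffMeasure_def,
    Measure.smul_apply, Measure.smul_apply, smul_eq_mul, ENNReal.smul_def, ENNReal.smul_def,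
    smul_eq_mul, smul_eq_mul, mul_left_comm]
  gcongr
  simpa using h2

/-- The trace inequality in a boundary chart. -/
lemma exists_local_trace_le (Ω : BoundedC1Domain N) {x₀ : Space N}
    (hx₀ : x₀ ∈ frontier Ω.carrier) :
    ∃ r > 0, ∃ C : ℝ≥0, ∀ f : Space N → ℝ, ContDiff ℝ ∞ f → ∀ ε : ℝ, 0 < ε →
      ∫⁻ x in frontier Ω.carrier ∩ Metric.ball x₀ r, ‖f x‖ₑ ^ 2 ∂(μHE[N - 1])
        ≤ C * (ENNReal.ofReal (1 + 1 / ε) * (∫⁻ x in Ω.carrier, ‖f x‖ₑ ^ 2)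
          + ENNReal.ofReal ε * ∫⁻ x in Ω.carrier, gradSq f x) := by
  obtain ⟨r₁, hr₁, e, he, γ, hγ, hch⟩ := Ω.hasC1Boundary x₀ hx₀
  have hγc := hγ.continuous
  have hee : ⟪e, e⟫ = 1 := by simp [he]
  set P : Space N → Space N := fun y => y - ⟪y, e⟫ • e with hP
  have hPc : Continuous P := by fun_prop
  obtain ⟨K, t, ht, hK⟩ := (hγ.contDiffAt (x := P x₀)).exists_lipschitzOnWith
  obtain ⟨r₂, hr₂, hball⟩ := Metric.mem_nhds_iff.1 (hPc.continuousAt.preimage_mem_nhds ht)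
  set r := min (r₁ / 2) r₂ with hr
  have hrpos : 0 < r := lt_min (by positivity) hr₂
  let W := (Submodule.span ℝ {e})ᗮ
  have hWe : ∀ w : W, ⟪(w : Space N), e⟫ = 0 := fun w =>
    (Submodule.mem_orthogonal_singleton_iff_inner_left.1 w.2)
  let G : W → Space N := fun w => (w : Space N) + γ w • e
  have hGc : Continuous G := by fun_prop
  have hPw : ∀ (w : W) (a : ℝ), P (w + a • e) = w := by
    intro w a
    simp only [hP, inner_add_left, real_inner_smul_left, hWe, hee]
    simp
  set A := frontier Ω.carrier ∩ Metric.ball x₀ r with hA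
  have hPt : ∀ w ∈ G ⁻¹' A, (w : Space N) ∈ t := by
    intro w hw
    have h1 := hball (Metric.ball_subset_ball (min_le_right _ _) hw.2)
    rwa [mem_preimage, hPw] at h1
  have hG : LipschitzOnWith (1 + K) G (G ⁻¹' A) := by
    apply LipschitzOnWith.of_dist_le_mul
    intro a ha b hb
    have h1 : dist (γ a) (γ b) ≤ K * dist (a : Space N) b :=
      hK.dist_le_mul _ (hPt a ha) _ (hPt b hb)
    calc dist (G a) (G b) ≤ dist (a : Space N) b + dist (γ a • e) (γ b • e) :=
          dist_add_add_le _ _ _ _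
      _ = dist (a : Space N) b + dist (γ a) (γ b) := by
          congr 1
          rw [dist_eq_norm, ← sub_smul, norm_smul, he, mul_one, dist_eq_norm]
      _ ≤ _ := by
          push_cast
          rw [Subtype.dist_eq]
          linarith
  have hAG : A ⊆ range G := by
    intro y hy
    have hyr : y ∈ Metric.ball x₀ r₁ := Metric.ball_subset_ball
      ((min_le_left _ _).trans (by linarith)) hy.2
    have hPy : P y ∈ W := by
      rw [Submodule.mem_orthogonal_singleton_iff_inner_left]
      simp [hP, inner_sub_left, real_inner_smul_left, he]
    refine ⟨⟨P y, hPy⟩, ?_⟩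
    have := frontier_subset_graph Ω.isOpen hγ hch hy.1 hyr
    change P y + γ (P y) • e = y
    rw [← this]
    simp [hP]
  have hle := restrict_le_map_of_lipschitzOnWith hGc.measurable hG hAG
  rw [finrank_orthogonal_unit he] at hle
  set δ := r₁ / 2 with hδ
  have hδpos : 0 < δ := by positivity
  set L : ℝ≥0 := (1 + K) ^ (N - 1) with hL
  refine ⟨r, hrpos, L * (1 + (1 / δ).toNNReal), fun f hf ε hε => ?_⟩
  have hfc := hf.continuous
  have hgm := measurable_gradSq hf
  let H : Space N → ENNReal := fun x =>
    ENNReal.ofReal (1 / δ + 1 / ε) * ‖f x‖ₑ ^ 2 + ENNReal.ofReal ε * gradSq f x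
  have hHm : Measurable H := by
    have := hfc.measurable
    fun_prop
  -- the one-dimensional inequality on the segment of length `δ` from `G w` in direction `-e`
  have h1d : ∀ w : W, ‖f (G w)‖ₑ ^ 2
      ≤ ∫⁻ s in Ioc 0 δ, H ((w : Space N) + (γ w - s) • e) := by
    intro w
    have hd : ∀ s : ℝ, HasDerivAt (fun s : ℝ => f ((w : Space N) + (γ w - s) • e))
        (fderiv ℝ f ((w : Space N) + (γ w - s) • e) (-e)) s := by
      intro s
      have h1 : HasDerivAt (fun s : ℝ => (w : Space N) + (γ w - s) • e) (-e) s := by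
        simpa using (((hasDerivAt_id s).const_sub (γ w)).smul_const e).const_add (w : Space N)
      exact ((hf.differentiable (by simp)) _).hasFDerivAt.comp_hasDerivAt s h1
    have hdc : Continuous (fderiv ℝ f) := hf.continuous_fderiv (by simp)
    have h2 := enorm_sq_le_lintegral_of_hasDerivAt hd (by fun_prop) hδpos hε
    simp only [sub_zero] at h2
    refine h2.trans (lintegral_mono fun s => add_le_add le_rfl (mul_le_mul' le_rfl ?_))
    have h3 := enorm_fderiv_apply_sq_le f ((w : Space N) + (γ w - s) • e) (-e)
    have h4 : ‖-e‖ₑ = 1 := by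
      rw [enorm_neg, ← ofReal_norm, he, ENNReal.ofReal_one]
    rwa [h4, one_pow, one_mul] at h3
  -- these segments stay in `Ω`, as they stay below the graph and within the chart
  have hin : ∀ w ∈ G ⁻¹' A, ∀ s ∈ Ioc 0 δ, (w : Space N) + (γ w - s) • e ∈ Ω.carrier := by
    intro w hw s hs
    have h1 : (w : Space N) + (γ w - s) • e = G w - s • e := by
      simp only [G, sub_smul]
      abel
    refine (hch _ ?_).2 ?_
    · have h2 := mem_ball_iff_norm.1 hw.2
      rw [h1, mem_ball_iff_norm, sub_right_comm]
      have h3 := norm_sub_le (G w - x₀) (s • e)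
      rw [norm_smul, he, mul_one, Real.norm_of_nonneg hs.1.le] at h3
      have h4 : r ≤ r₁ / 2 := min_le_left _ _
      have h5 := hs.2
      linarith
    · change _ < γ (P _)
      rw [hPw, inner_add_left, hWe, real_inner_smul_left, hee]
      have := hs.1
      linarith
  have hΨ := measurePreserving_graph_sub he hγc
  calc ∫⁻ x in A, ‖f x‖ₑ ^ 2 ∂(μHE[N - 1])
      ≤ ∫⁻ x, ‖f x‖ₑ ^ 2 ∂(((1 + K : ℝ≥0) : ENNReal) ^ (N - 1) •
        (volume.restrict (G ⁻¹' A)).map G) := lintegral_mono' hle le_rfl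
    _ = L * ∫⁻ w in G ⁻¹' A, ‖f (G w)‖ₑ ^ 2 := by
        rw [lintegral_smul_measure, lintegral_map (by fun_prop) hGc.measurable, smul_eq_mul, hL]
        push_cast
        rfl
    _ ≤ L * ∫⁻ w in G ⁻¹' A, ∫⁻ s in Ioc 0 δ, H ((w : Space N) + (γ w - s) • e) := by
        gcongr with w
        exact h1d w
    _ = L * ∫⁻ p in (G ⁻¹' A) ×ˢ Ioc 0 δ, H ((p.1 : Space N) + (γ p.1 - p.2) • e)
          ∂(volume.prod volume) := by
        rw [← Measure.prod_restrict, lintegral_prod]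
        exact (hHm.comp hΨ.measurable).aemeasurable
    _ ≤ L * ∫⁻ p in (fun p : W × ℝ => (p.1 : Space N) + (γ p.1 - p.2) • e) ⁻¹' Ω.carrier,
          H ((p.1 : Space N) + (γ p.1 - p.2) • e) ∂(volume.prod volume) := by
        refine mul_le_mul' le_rfl (lintegral_mono_set ?_)
        rintro ⟨w, s⟩ ⟨hw, hs⟩
        exact hin w hw s hs
    _ = L * ∫⁻ x in Ω.carrier, H x := by
        rw [hΨ.setLIntegral_comp_preimage Ω.isOpen.measurableSet hHm]
    _ = L * (ENNReal.ofReal (1 / δ + 1 / ε) * (∫⁻ x in Ω.carrier, ‖f x‖ₑ ^ 2)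
          + ENNReal.ofReal ε * ∫⁻ x in Ω.carrier, gradSq f x) := by
        rw [lintegral_add_left (by fun_prop), lintegral_const_mul _ (by fun_prop),
          lintegral_const_mul _ (by fun_prop)]
    _ ≤ _ := by
        push_cast
        rw [mul_assoc, mul_add (1 + _)]
        have h1 : ENNReal.ofReal (1 / δ + 1 / ε)
            ≤ (1 + ENNReal.ofReal (1 / δ)) * ENNReal.ofReal (1 + 1 / ε) := by
          rw [← ENNReal.ofReal_one, ← ENNReal.ofReal_add zero_le_one (by positivity),
            ← ENNReal.ofReal_mul (by positivity)]
          refine ENNReal.ofReal_le_ofReal ?_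
          have h2 : 0 ≤ 1 / δ := by positivity
          have h3 : 0 ≤ 1 / ε := by positivity
          nlinarith
        refine mul_le_mul' le_rfl (add_le_add ?_ ?_)
        · rw [← mul_assoc]
          exact mul_le_mul' h1 le_rfl
        · rw [← one_mul (ENNReal.ofReal ε * _)]
          exact mul_le_mul' (by simp) (by simp)

/-- The trace inequality for smooth functions, by compactness of the boundary. -/
lemma exists_trace_le (Ω : BoundedC1Domain N) :
    ∃ C : ℝ≥0, ∀ f : Space N → ℝ, ContDiff ℝ ∞ f → ∀ ε : ℝ, 0 < ε →
      ∫⁻ x, ‖f x‖ₑ ^ 2 ∂Ω.surf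
        ≤ C * (ENNReal.ofReal (1 + 1 / ε) * (∫⁻ x in Ω.carrier, ‖f x‖ₑ ^ 2)
          + ENNReal.ofReal ε * ∫⁻ x in Ω.carrier, gradSq f x) := by
  refine Ω.isCompact_frontier.induction_on (p := fun s => ∃ C : ℝ≥0, ∀ f : Space N → ℝ,
    ContDiff ℝ ∞ f → ∀ ε : ℝ, 0 < ε → ∫⁻ x in s, ‖f x‖ₑ ^ 2 ∂(μHE[N - 1])
      ≤ C * (ENNReal.ofReal (1 + 1 / ε) * (∫⁻ x in Ω.carrier, ‖f x‖ₑ ^ 2)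
        + ENNReal.ofReal ε * ∫⁻ x in Ω.carrier, gradSq f x)) ?_ ?_ ?_ ?_
  · exact ⟨0, fun f _ ε _ => by simp⟩
  · rintro s t hst ⟨C, hC⟩
    exact ⟨C, fun f hf ε hε => (lintegral_mono_set hst).trans (hC f hf ε hε)⟩
  · rintro s t ⟨C, hC⟩ ⟨C', hC'⟩
    refine ⟨C + C', fun f hf ε hε => (lintegral_union_le _ _ _).trans ?_⟩
    push_cast
    rw [add_mul]
    exact add_le_add (hC f hf ε hε) (hC' f hf ε hε)
  · intro x hx
    obtain ⟨r, hr, C, hC⟩ := exists_local_trace_le Ω hx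
    exact ⟨_, inter_mem self_mem_nhdsWithin
      (mem_nhdsWithin_of_mem_nhds (Metric.ball_mem_nhds x hr)), C, hC⟩

lemma enorm_L2Bdry_sq {Ω : BoundedC1Domain N} (g : L2Bdry Ω) :
    ‖g‖ₑ ^ 2 = ∫⁻ x, ‖g x‖ₑ ^ 2 ∂Ω.surf := by
  rw [Lp.enorm_def]
  simpa using eLpNorm_nnreal_pow_eq_lintegral (p := 2) two_ne_zero (f := g) (μ := Ω.surf)

lemma exists_norm_smoothToBdry_sq_le (Ω : BoundedC1Domain N) :
    ∃ C : ℝ, 0 ≤ C ∧ ∀ f : smoothFunctions N, ∀ ε : ℝ, 0 < ε → ‖smoothToBdry Ω f‖ ^ 2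
      ≤ C * ((1 + 1 / ε) * ‖H1.toL2 Ω (smoothToH1 Ω f)‖ ^ 2 + ε * ‖smoothToH1 Ω f‖ ^ 2) := by
  obtain ⟨C, hC⟩ := exists_trace_le Ω
  refine ⟨C, C.2, fun f ε hε => ?_⟩
  have hsq : ∀ {E : Type} [NormedAddCommGroup E] (a : E), ‖a‖ₑ ^ 2 = ENNReal.ofReal (‖a‖ ^ 2) :=
    fun a => by rw [← ofReal_norm, ← ENNReal.ofReal_pow (norm_nonneg _)]
  have h1 := hC f (smoothFunctions.contDiff f) ε hε
  have h2 : ∫⁻ x, ‖f.1 x‖ₑ ^ 2 ∂Ω.surf = ‖smoothToBdry Ω f‖ₑ ^ 2 := by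
    rw [enorm_L2Bdry_sq]
    refine lintegral_congr_ae ?_
    filter_upwards [MemLp.coeFn_toLp (memLp_surf Ω (smoothFunctions.contDiff f).continuous 2)]
      with x hx
    exact congrArg (fun a : ℝ => ‖a‖ₑ ^ 2) hx.symm
  have h3 : ∫⁻ x in Ω.carrier, ‖f.1 x‖ₑ ^ 2 = ‖H1.toL2 Ω (smoothToH1 Ω f)‖ₑ ^ 2 := by
    rw [enorm_L2_sq]
    refine lintegral_congr_ae ?_
    filter_upwards [H1.toL2_smoothToH1 (Ω := Ω) f] with x hx
    rw [hx]
  rw [h2, h3, hsq, hsq] at h1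
  have h4 := h1.trans (mul_le_mul' le_rfl (add_le_add le_rfl
    (mul_le_mul' le_rfl (lintegral_gradSq_le f))))
  rw [hsq, ← ENNReal.ofReal_mul (by positivity), ← ENNReal.ofReal_mul hε.le,
    ← ENNReal.ofReal_add (by positivity) (by positivity), ← ENNReal.ofReal_coe_nnreal,
    ← ENNReal.ofReal_mul C.coe_nonneg] at h4
  exact (ENNReal.ofReal_le_ofReal_iff (mul_nonneg C.coe_nonneg (by positivity))).1 h4

/-- The trace operator extends restriction to the boundary. -/
theorem traceH1_smoothToH1 (Ω : BoundedC1Domain N) (f : smoothFunctions N) :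
    traceH1 Ω (smoothToH1 Ω f) = smoothToBdry Ω f := by
  obtain ⟨C, hC0, hC⟩ := exists_norm_smoothToBdry_sq_le Ω
  refine LinearMap.extendOfNorm_eq (denseRange_smoothToH1 Ω) ⟨Real.sqrt (3 * C), fun f => ?_⟩ f
  refine le_of_sq_le_sq ?_ (by positivity)
  rw [mul_pow, Real.sq_sqrt (by positivity)]
  have h1 := hC f 1 one_pos
  have h2 := pow_le_pow_left₀ (norm_nonneg _) (H1.norm_toL2_le_norm (smoothToH1 Ω f)) 2
  nlinarith

lemma exists_norm_traceH1_sq_le (Ω : BoundedC1Domain N) :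
    ∃ C : ℝ, 0 ≤ C ∧ ∀ u : H1 Ω, ∀ ε : ℝ, 0 < ε → ‖traceH1 Ω u‖ ^ 2
      ≤ C * ((1 + 1 / ε) * ‖H1.toL2 Ω u‖ ^ 2 + ε * ‖u‖ ^ 2) := by
  obtain ⟨C, hC0, hC⟩ := exists_norm_smoothToBdry_sq_le Ω
  refine ⟨C, hC0, fun u ε hε => ?_⟩
  refine (denseRange_smoothToH1 Ω).induction_on u
    (isClosed_le (by fun_prop) (by fun_prop)) fun f => ?_
  rw [traceH1_smoothToH1]
  exact hC f ε hε

/-- The trace `H¹(Ω) → L²(∂Ω)` is compact: it is controlled by a small multiple of the norm of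
`H¹(Ω)` and by the compact inclusion in `L²(Ω)`. -/
theorem isCompactOperator_traceH1 (Ω : BoundedC1Domain N) : IsCompactOperator (traceH1 Ω) := by
  obtain ⟨C, hC0, hC⟩ := exists_norm_traceH1_sq_le Ω
  refine isCompactOperator_of_forall_exists_le _ fun ε hε => ?_
  set η : ℝ := ε ^ 2 / (C + 1) with hη
  have hηpos : 0 < η := by positivity
  refine ⟨L2 Ω, inferInstance, inferInstance, Real.sqrt (C * (1 + 1 / η)) • H1.toL2 Ω, ?_, ?_⟩
  · exact (isCompactOperator_toL2 Ω).smul (Real.sqrt (C * (1 + 1 / η)))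
  · intro u
    have h1 := hC u η hηpos
    rw [smul_apply, norm_smul, Real.norm_of_nonneg (Real.sqrt_nonneg _)]
    refine le_of_sq_le_sq ?_ (by positivity)
    have h2 : C * η ≤ ε ^ 2 := by
      rw [hη, mul_div_assoc', div_le_iff₀ (by positivity)]
      nlinarith [sq_nonneg ε]
    have h3 : (Real.sqrt (C * (1 + 1 / η)) * ‖H1.toL2 Ω u‖) ^ 2
        = C * (1 + 1 / η) * ‖H1.toL2 Ω u‖ ^ 2 := by
      rw [mul_pow, Real.sq_sqrt (by positivity)]
    have h4 : 0 ≤ ε * ‖u‖ * (Real.sqrt (C * (1 + 1 / η)) * ‖H1.toL2 Ω u‖) := by positivity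
    rw [add_sq, h3]
    nlinarith [mul_le_mul_of_nonneg_right h2 (sq_nonneg ‖u‖)]

/-! ### Functions with vanishing gradient -/

/-- On a ball well inside `Ω`, a function with zero weak gradient is constant: its mollifications
are, and the constants are closed in `L²`. -/
lemma exists_ae_eq_const_on_ball {Ω : BoundedC1Domain N} {u : H1 Ω}
    (hu : ∀ i, H1.grad Ω i u = 0) {x₀ : Space N} {r : ℝ}
    (hball : Metric.ball x₀ (2 * r) ⊆ Ω.carrier) :
    ∃ c : ℝ, ∀ᵐ x ∂volume.restrict (Metric.ball x₀ r), H1.toL2 Ω u x = c := by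
  rcases le_or_gt r 0 with hr | hr
  · exact ⟨0, by simp [Metric.ball_eq_empty.2 hr]⟩
  set μ : Measure (Space N) := volume.restrict (Metric.ball x₀ r) with hμ
  have hsub : Metric.ball x₀ r ⊆ Ω.carrier :=
    (Metric.ball_subset_ball (by linarith)).trans hball
  have hμle : μ ≤ Ω.vol := Measure.restrict_mono hsub le_rfl
  have : IsFiniteMeasure μ := isFiniteMeasure_of_le _ hμle
  have hmem : ∀ g : L2 Ω, MemLp g 2 μ := fun g => (Lp.memLp g).mono_measure hμle
  have hnorm : ∀ g : L2 Ω, ‖(hmem g).toLp g‖ ≤ ‖g‖ := by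
    intro g
    rw [Lp.norm_toLp, Lp.norm_def]
    exact ENNReal.toReal_mono (Lp.eLpNorm_ne_top g) (eLpNorm_mono_measure _ hμle)
  let R : Submodule ℝ (Lp ℝ 2 μ) := LinearMap.range (Lp.constₗ 2 μ ℝ : ℝ →ₗ[ℝ] Lp ℝ 2 μ)
  have hRc : IsClosed (R : Set (Lp ℝ 2 μ)) := Submodule.closed_of_finiteDimensional R
  set g := H1.toL2 Ω u with hg
  have hmemR : (hmem g).toLp g ∈ R := by
    change (hmem g).toLp g ∈ (R : Set (Lp ℝ 2 μ))
    rw [← hRc.closure_eq]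
    refine Metric.mem_closure_iff.2 fun ε hε => ?_
    obtain ⟨δ, hδ, h⟩ := exists_norm_mollifyL2_sub_le g (half_pos hε)
    obtain ⟨k, hk⟩ := exists_isMollifier (0 : Space N) (r := min (δ / 2) (r / 2))
      (lt_min (by positivity) (by positivity))
    have h1 := h k _ hk (Metric.closedBall_subset_ball ((min_le_left _ _).trans_lt (by linarith)))
    have hfd : ∀ x ∈ Metric.ball x₀ r, fderiv ℝ (mollify Ω k g) x = 0 := by
      intro x hx
      have hp : ∀ i, partialDeriv i (mollify Ω k g) x = 0 := by
        intro i
        rw [partialDeriv_mollify_of_isWeakPartial hk (H1.isWeakPartial u i), hu i,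
          ← mollifyAt_apply hk, map_zero]
        intro z hz
        apply hball
        rw [mem_closedBall_zero_iff] at hz
        rw [mem_ball_iff_norm] at hx ⊢
        have h2 := norm_sub_le (x - x₀) z
        rw [sub_right_comm] at h2
        have h3 : min (δ / 2) (r / 2) ≤ r / 2 := min_le_right _ _
        linarith
      ext z
      rw [← (EuclideanSpace.basisFun (Fin N) ℝ).sum_repr z]
      simp only [partialDeriv] at hp
      simp [map_sum, hp]
    have hconst : ∀ x ∈ Metric.ball x₀ r, mollify Ω k g x = mollify Ω k g x₀ := fun x hx =>
      Metric.isOpen_ball.is_const_of_fderiv_eq_zero (convex_ball x₀ r).isPreconnected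
        ((contDiff_mollify Ω hk g).differentiable (by simp)).differentiableOn
        (fun y hy => hfd y hy) hx (Metric.mem_ball_self hr)
    refine ⟨_, ⟨mollify Ω k g x₀, rfl⟩, ?_⟩
    have h2 : (Lp.constₗ 2 μ ℝ : ℝ →ₗ[ℝ] Lp ℝ 2 μ) (mollify Ω k g x₀)
        = (hmem (mollifyL2 Ω hk g)).toLp _ := by
      apply Lp.ext
      have h3 : mollifyL2 Ω hk g =ᵐ[μ] mollify Ω k g :=
        (ae_mono hμle) (coeFn_mollifyL2 hk g)
      filter_upwards [Lp.coeFn_const 2 μ (mollify Ω k g x₀), (hmem (mollifyL2 Ω hk g)).coeFn_toLp,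
        h3, ae_restrict_mem measurableSet_ball] with x h4 h5 h6 h7
      rw [h5, h6, hconst x h7]
      exact h4
    have h8 : (hmem (mollifyL2 Ω hk g)).toLp _ - (hmem g).toLp _
        = (hmem (mollifyL2 Ω hk g - g)).toLp _ := by
      rw [← MemLp.toLp_sub]
      refine MemLp.toLp_congr _ _ ?_
      exact EventuallyEq.symm ((ae_mono hμle) (Lp.coeFn_sub (mollifyL2 Ω hk g) g))
    rw [dist_comm, dist_eq_norm, h2, h8]
    exact ((hnorm _).trans h1).trans_lt (by linarith)
  obtain ⟨c, hc⟩ := hmemR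
  refine ⟨c, ?_⟩
  filter_upwards [Lp.coeFn_const 2 μ c, (hmem g).coeFn_toLp] with x h1 h2
  rw [← h2, ← hc]
  exact h1

/-- A function with zero weak gradient on the connected set `Ω` is constant. -/
lemma exists_ae_eq_const {Ω : BoundedC1Domain N} {u : H1 Ω} (hu : ∀ i, H1.grad Ω i u = 0) :
    ∃ c : ℝ, ∀ᵐ x ∂Ω.vol, H1.toL2 Ω u x = c := by
  have h : ∀ x : Ω.carrier, ∃ r > 0, Metric.ball (x : Space N) r ⊆ Ω.carrier ∧ ∃ c : ℝ,
      ∀ᵐ y ∂volume.restrict (Metric.ball (x : Space N) r), H1.toL2 Ω u y = c := by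
    intro x
    obtain ⟨r, hr, hx⟩ := Metric.isOpen_iff.1 Ω.isOpen x x.2
    exact ⟨r / 2, by positivity, (Metric.ball_subset_ball (by linarith)).trans hx,
      exists_ae_eq_const_on_ball hu (by rwa [mul_div_cancel₀ _ two_ne_zero])⟩
  choose r hr hsub c hc using h
  have hloc : IsLocallyConstant c := by
    refine IsLocallyConstant.iff_eventually_eq c |>.2 fun x => ?_
    have h1 : ∀ᶠ y : Ω.carrier in 𝓝 x, (y : Space N) ∈ Metric.ball (x : Space N) (r x) :=
      continuous_subtype_val.continuousAt (Metric.ball_mem_nhds _ (hr x))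
    filter_upwards [h1] with y hy
    have hne : volume (Metric.ball (x : Space N) (r x) ∩ Metric.ball (y : Space N) (r y)) ≠ 0 :=
      (((Metric.isOpen_ball (x := (x : Space N))).inter Metric.isOpen_ball).measure_pos volume
        ⟨y, hy, Metric.mem_ball_self (hr y)⟩).ne'
    have h2 := ae_restrict_of_ae_restrict_of_subset (inter_subset_left :
      Metric.ball (x : Space N) (r x) ∩ Metric.ball (y : Space N) (r y) ⊆ _) (hc x)
    have h3 := ae_restrict_of_ae_restrict_of_subset (inter_subset_right :
      Metric.ball (x : Space N) (r x) ∩ Metric.ball (y : Space N) (r y) ⊆ _) (hc y)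
    have : NeBot (ae (volume.restrict
      (Metric.ball (x : Space N) (r x) ∩ Metric.ball (y : Space N) (r y)))) :=
      ae_neBot.2 (by simpa using hne)
    obtain ⟨z, h4, h5⟩ := (h2.and h3).exists
    rw [← h4, ← h5]
  have : PreconnectedSpace Ω.carrier :=
    isPreconnected_iff_preconnectedSpace.1 Ω.isConnected.isPreconnected
  obtain ⟨x₀, hx₀⟩ := Ω.isConnected.nonempty
  refine ⟨c ⟨x₀, hx₀⟩, (ae_restrict_iff' Ω.isOpen.measurableSet).2 ?_⟩
  rw [ae_iff]
  refine measure_null_of_locally_null _ fun x hx => ?_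
  have hxΩ : x ∈ Ω.carrier := by
    by_contra h
    exact hx fun h' => absurd h' h
  refine ⟨_, inter_mem_nhdsWithin _ (Metric.ball_mem_nhds x (hr ⟨x, hxΩ⟩)), ?_⟩
  have h1 := hc ⟨x, hxΩ⟩
  rw [hloc.apply_eq_of_preconnectedSpace ⟨x, hxΩ⟩ ⟨x₀, hx₀⟩,
    ae_restrict_iff' measurableSet_ball, ae_iff] at h1
  refine measure_mono_null ?_ h1
  rintro y ⟨hy1, hy2⟩ hy3
  exact hy1 fun _ => hy3 hy2

/-! ### Completeness of the Sobolev spaces -/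

lemma continuous_integral_L2_mul (Ω : BoundedC1Domain N) {f : Space N → ℝ} (hf : Continuous f) :
    Continuous fun u : L2 Ω => ∫ x, u x * f x ∂Ω.vol := by
  have h : (fun u : L2 Ω => ∫ x, u x * f x ∂Ω.vol)
      = fun u : L2 Ω => inner ℝ ((memLp_vol Ω hf 2).toLp f) u := by
    ext u
    rw [L2.inner_def]
    refine integral_congr_ae ?_
    filter_upwards [(memLp_vol Ω hf 2).coeFn_toLp] with x hx
    rw [hx]
    simp
  rw [h]
  fun_prop

lemma isClosed_setOf_isWeakPartial {Ω : BoundedC1Domain N} {X : Type*} [TopologicalSpace X]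
    (i : Fin N) {u v : X → L2 Ω} (hu : Continuous u) (hv : Continuous v) :
    IsClosed {x | IsWeakPartial Ω i (u x) (v x)} := by
  simp only [IsWeakPartial, ofPred_forall]
  refine isClosed_iInter fun φ => isClosed_iInter fun hφ => isClosed_eq ?_ ?_
  · exact (continuous_integral_L2_mul Ω (continuous_partialDeriv hφ.smooth i)).comp hu
  · exact ((continuous_integral_L2_mul Ω hφ.smooth.continuous).comp hv).neg

instance (Ω : BoundedC1Domain N) : CompleteSpace (H1 Ω) := by
  have h : IsClosed (H1Sub Ω : Set (WithLp 2 (L2 Ω × PiLp 2 fun _ : Fin N => L2 Ω))) := by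
    change IsClosed {U : WithLp 2 (L2 Ω × PiLp 2 fun _ : Fin N => L2 Ω) |
      ∀ i, IsWeakPartial Ω i U.fst (U.snd i)}
    rw [ofPred_forall]
    refine isClosed_iInter fun i => isClosed_setOf_isWeakPartial i ?_ ?_
    · exact (WithLp.fstL 2 ℝ (L2 Ω) (PiLp 2 fun _ : Fin N => L2 Ω)).continuous
    · exact ((PiLp.proj 2 (fun _ : Fin N => L2 Ω) i).comp
        (WithLp.sndL 2 ℝ (L2 Ω) (PiLp 2 fun _ : Fin N => L2 Ω))).continuous
  exact h.completeSpace_coe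

instance (Ω : BoundedC1Domain N) : CompleteSpace (H2 Ω) := by
  have h : IsClosed (H2Sub Ω :
      Set (WithLp 2 (H1 Ω × PiLp 2 fun _ : Fin N × Fin N => L2 Ω))) := by
    change IsClosed {U : WithLp 2 (H1 Ω × PiLp 2 fun _ : Fin N × Fin N => L2 Ω) |
      ∀ i j, IsWeakPartial Ω i (H1.grad Ω j U.fst) (U.snd (i, j))}
    simp only [ofPred_forall]
    refine isClosed_iInter fun i => isClosed_iInter fun j => isClosed_setOf_isWeakPartial i ?_ ?_
    · exact ((H1.grad Ω j).comp
        (WithLp.fstL 2 ℝ (H1 Ω) (PiLp 2 fun _ : Fin N × Fin N => L2 Ω))).continuous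
    · exact ((PiLp.proj 2 (fun _ : Fin N × Fin N => L2 Ω) (i, j)).comp
        (WithLp.sndL 2 ℝ (H1 Ω) (PiLp 2 fun _ : Fin N × Fin N => L2 Ω))).continuous
  exact h.completeSpace_coe

/-! ### The form on `H²(Ω)` and the quotient by constants -/

lemma H2.norm_sq {Ω : BoundedC1Domain N} (u : H2 Ω) :
    ‖u‖ ^ 2 = ‖H1.toL2 Ω (H2.toH1 Ω u)‖ ^ 2 + ∑ i, ‖H2.grad Ω i u‖ ^ 2
      + ∑ i, ∑ j, ‖H2.hess Ω i j u‖ ^ 2 := by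
  have h : ‖u‖ ^ 2 = ‖u.1.fst‖ ^ 2 + ‖u.1.snd‖ ^ 2 := WithLp.prod_norm_sq_eq_of_L2 u.1
  rw [h, PiLp.norm_sq_eq_of_L2, Fintype.sum_prod_type, H1.norm_sq]
  rfl

lemma form_self {Ω : BoundedC1Domain N} (τ : ℝ≥0) (u : H2 Ω) :
    form Ω τ u u = (∑ i, ∑ j, ‖H2.hess Ω i j u‖ ^ 2) + τ * ∑ i, ‖H2.grad Ω i u‖ ^ 2 := by
  rw [← formL_apply, formL_eq_inner]
  simp

lemma H2.ext' {Ω : BoundedC1Domain N} {u v : H2 Ω} (h : H2.toH1 Ω u = H2.toH1 Ω v)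
    (h' : ∀ i j, H2.hess Ω i j u = H2.hess Ω i j v) : u = v :=
  Subtype.ext (WithLp.ofLp_injective 2
    (Prod.ext h (WithLp.ofLp_injective 2 (funext fun p => h' p.1 p.2))))

lemma toL2_one (Ω : BoundedC1Domain N) :
    H1.toL2 Ω (H2.toH1 Ω (H2.one Ω)) =ᵐ[Ω.vol] fun _ => (1 : ℝ) :=
  H1.toL2_smoothToH1 (Ω := Ω) (smoothOne N)

/-- The form is definite modulo constants. -/
lemma mem_constants_of_form_self_eq_zero {Ω : BoundedC1Domain N} {τ : ℝ≥0} (hτ : 0 < τ) {u : H2 Ω}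
    (hu : form Ω τ u u = 0) : u ∈ constants Ω := by
  rw [form_self] at hu
  have h1 : 0 ≤ ∑ i, ∑ j, ‖H2.hess Ω i j u‖ ^ 2 :=
    Finset.sum_nonneg fun i _ => Finset.sum_nonneg fun j _ => sq_nonneg _
  have h2 : 0 ≤ ∑ i, ‖H2.grad Ω i u‖ ^ 2 := Finset.sum_nonneg fun i _ => sq_nonneg _
  have hτ' : (0 : ℝ) < τ := hτ
  have h3 : ∑ i, ‖H2.grad Ω i u‖ ^ 2 = 0 := by nlinarith [mul_nonneg hτ'.le h2]
  have h4 : ∑ i, ∑ j, ‖H2.hess Ω i j u‖ ^ 2 = 0 := by rw [h3] at hu; linarith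
  have hgrad : ∀ i, H2.grad Ω i u = 0 := fun i => by
    simpa using (Finset.sum_eq_zero_iff_of_nonneg fun i _ => sq_nonneg _).1 h3 i
      (Finset.mem_univ i)
  have hhess : ∀ i j, H2.hess Ω i j u = 0 := fun i j => by
    have h5 := (Finset.sum_eq_zero_iff_of_nonneg fun i _ =>
      Finset.sum_nonneg fun j _ => sq_nonneg _).1 h4 i (Finset.mem_univ i)
    simpa using (Finset.sum_eq_zero_iff_of_nonneg fun j _ => sq_nonneg _).1 h5 j
      (Finset.mem_univ j)
  obtain ⟨c, hc⟩ := exists_ae_eq_const (u := H2.toH1 Ω u) hgrad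
  refine Submodule.mem_span_singleton.2 ⟨c, H2.ext' (H1.ext' ?_ fun i => ?_) fun i j => ?_⟩
  · change H1.toL2 Ω (H2.toH1 Ω (c • H2.one Ω)) = H1.toL2 Ω (H2.toH1 Ω u)
    rw [map_smul, map_smul]
    apply Lp.ext
    filter_upwards [hc, toL2_one Ω, Lp.coeFn_smul c (H1.toL2 Ω (H2.toH1 Ω (H2.one Ω)))]
      with x h5 h6 h7
    rw [h5, h7, Pi.smul_apply, h6]
    simp
  · change H2.grad Ω i (c • H2.one Ω) = H2.grad Ω i u
    have h5 : H2.grad Ω i (H2.one Ω) = 0 := grad_smoothOne Ω i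
    rw [map_smul, h5, smul_zero, hgrad]
  · have h5 : H2.hess Ω i j (H2.one Ω) = 0 := rfl
    rw [map_smul, h5, smul_zero, hhess]

lemma norm_proj_sq {Ω : BoundedC1Domain N} {τ : ℝ≥0} (u : H2 Ω) :
    ‖proj Ω τ u‖ ^ 2 = form Ω τ u u := by
  rw [← real_inner_self_eq_norm_sq, inner_proj]

/-- The projection `H²(Ω) → H²(Ω)/ℝ` as a continuous map. -/
def projL (Ω : BoundedC1Domain N) (τ : ℝ≥0) : H2 Ω →L[ℝ] H2modR Ω τ :=
  (proj Ω τ).mkContinuous (Real.sqrt ‖formL Ω τ‖) fun u => by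
    refine le_of_sq_le_sq ?_ (by positivity)
    rw [norm_proj_sq, mul_pow, Real.sq_sqrt (norm_nonneg (formL Ω τ)), ← formL_apply, sq,
      ← mul_assoc]
    exact (le_abs_self _).trans ((formL Ω τ).le_opNorm₂ u u)

lemma projL_apply {Ω : BoundedC1Domain N} {τ : ℝ≥0} (u : H2 Ω) : projL Ω τ u = proj Ω τ u := rfl

lemma exists_norm_le_norm_proj_add {Ω : BoundedC1Domain N} {τ : ℝ≥0} (hτ : 0 < τ) :
    ∃ C : ℝ, ∀ u : H2 Ω, ‖u‖ ≤ C * (‖projL Ω τ u‖ + ‖H1.toL2 Ω (H2.toH1 Ω u)‖) := by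
  have hτ' : (0 : ℝ) < τ := hτ
  refine ⟨1 + 1 / τ, fun u => ?_⟩
  refine le_of_sq_le_sq ?_ (by positivity)
  have h1 := norm_proj_sq (τ := τ) u
  have h0 : 0 ≤ 1 / (τ : ℝ) := by positivity
  set a := ‖proj Ω τ u‖ with ha
  have ha0 : 0 ≤ a := norm_nonneg _
  have hb0 : 0 ≤ ‖H1.toL2 Ω (H2.toH1 Ω u)‖ := norm_nonneg _
  rw [form_self] at h1
  rw [H2.norm_sq, projL_apply, ← ha]
  set s := ∑ i, ∑ j, ‖H2.hess Ω i j u‖ ^ 2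
  have hs : 0 ≤ s :=
    Finset.sum_nonneg fun i _ => Finset.sum_nonneg fun j _ => sq_nonneg _
  have hg : 0 ≤ ∑ i, ‖H2.grad Ω i u‖ ^ 2 := Finset.sum_nonneg fun i _ => sq_nonneg _
  set g := ∑ i, ‖H2.grad Ω i u‖ ^ 2
  have h2 : g ≤ 1 / τ * a ^ 2 := by
    rw [h1, mul_add, ← mul_assoc, one_div_mul_cancel hτ'.ne']
    have := mul_nonneg h0 hs
    linarith
  have h3 : s ≤ a ^ 2 := by
    have := mul_nonneg hτ'.le hg
    linarith
  have h4 : (1 + 1 / (τ : ℝ)) ≤ (1 + 1 / (τ : ℝ)) ^ 2 := by nlinarith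
  set b := ‖H1.toL2 Ω (H2.toH1 Ω u)‖
  have h5 : a ^ 2 + b ^ 2 ≤ (a + b) ^ 2 := by nlinarith
  rw [mul_pow]
  calc b ^ 2 + g + s ≤ (1 + 1 / τ) * (a ^ 2 + b ^ 2) := by nlinarith [sq_nonneg b]
    _ ≤ (1 + 1 / τ) ^ 2 * (a + b) ^ 2 := mul_le_mul h4 h5 (by positivity) (by positivity)

/-- Peetre's lemma for injective operators: if `p` together with a compact operator controls the
norm, and `p` vanishes nowhere but at `0`, then `p` alone controls the norm. -/
lemma exists_norm_le_of_isCompactOperator {V W Y : Type*} [NormedAddCommGroup V] [NormedSpace ℝ V]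
    [CompleteSpace V] [SeminormedAddCommGroup W] [NormedSpace ℝ W] [NormedAddCommGroup Y]
    [NormedSpace ℝ Y] (p : V →L[ℝ] W) (K : V →L[ℝ] Y) (hK : IsCompactOperator K)
    (hp : ∀ u, ‖p u‖ = 0 → u = 0) {C : ℝ} (hC : ∀ u, ‖u‖ ≤ C * (‖p u‖ + ‖K u‖)) :
    ∃ c > 0, ∀ u, ‖u‖ ≤ c * ‖p u‖ := by
  by_contra! H
  have H' : ∀ n : ℕ, ∃ v : V, ‖v‖ = 1 ∧ ‖p v‖ ≤ 1 / ((n : ℝ) + 1) := by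
    intro n
    obtain ⟨u, hu⟩ := H (n + 1) (by positivity)
    have hu0 : 0 < ‖u‖ := lt_of_le_of_lt (by positivity) hu
    refine ⟨‖u‖⁻¹ • u, ?_, ?_⟩
    · rw [norm_smul, norm_inv, norm_norm, inv_mul_cancel₀ hu0.ne']
    · rw [map_smul, norm_smul, norm_inv, norm_norm, inv_mul_le_iff₀ hu0, mul_one_div,
        le_div_iff₀ (by positivity)]
      linarith
  choose v hv1 hvp using H'
  have hpt : Tendsto (fun n => ‖p (v n)‖) atTop (𝓝 0) :=
    squeeze_zero (fun n => norm_nonneg _) hvp tendsto_one_div_add_atTop_nhds_zero_nat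
  obtain ⟨y, -, φ, hφ, hy⟩ := (hK.isCompact_closure_image_closedBall
    (f := (K : V →ₗ[ℝ] Y)) 1).tendsto_subseq (x := fun n => K (v n))
    fun n => subset_closure ⟨v n, by simp [hv1], rfl⟩
  -- `p (v n)` tends to zero and `K (v (φ n))` is Cauchy, hence so is `v ∘ φ`
  have hcau : CauchySeq (v ∘ φ) := by
    have hKc : CauchySeq fun n => K (v (φ n)) := hy.cauchySeq
    rw [Metric.cauchySeq_iff] at hKc ⊢
    intro ε hε
    set η := ε / (4 * (|C| + 1)) with hη
    have hηpos : 0 < η := by positivity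
    obtain ⟨n₁, h1⟩ := hKc η hηpos
    obtain ⟨n₂, h2⟩ := eventually_atTop.1 ((hpt.comp hφ.tendsto_atTop).eventually
      (gt_mem_nhds hηpos))
    refine ⟨max n₁ n₂, fun m hm n hn => ?_⟩
    have h3 := h1 m (le_of_max_le_left hm) n (le_of_max_le_left hn)
    have h4 := h2 m (le_of_max_le_right hm)
    have h5 := h2 n (le_of_max_le_right hn)
    simp only [Function.comp_apply] at h4 h5 ⊢
    rw [dist_eq_norm] at h3 ⊢
    have h6 := hC (v (φ m) - v (φ n))
    rw [map_sub, map_sub] at h6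
    have h7 := norm_sub_le (p (v (φ m))) (p (v (φ n)))
    calc ‖v (φ m) - v (φ n)‖
        ≤ C * (‖p (v (φ m)) - p (v (φ n))‖ + ‖K (v (φ m)) - K (v (φ n))‖) := h6
      _ ≤ |C| * (3 * η) := by
          refine mul_le_mul (le_abs_self C) (by linarith) (by positivity) (abs_nonneg C)
      _ < ε := by
          have h8 : 4 * (|C| + 1) * η = ε := by
            rw [hη]
            field_simp
          nlinarith [abs_nonneg C]
  obtain ⟨w, hw⟩ := cauchySeq_tendsto_of_complete hcau
  have h1 : ‖w‖ = 1 := by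
    refine tendsto_nhds_unique hw.norm ?_
    simp [hv1]
  have h2 : ‖p w‖ = 0 :=
    tendsto_nhds_unique ((p.continuous.norm.tendsto w).comp hw) (hpt.comp hφ.tendsto_atTop)
  rw [hp w h2, norm_zero] at h1
  exact zero_ne_one h1

/-! ### The weighted boundary mean and the solution operator -/

lemma essInf_le_ae {Ω : BoundedC1Domain N} (ρ : Weight Ω) :
    ∀ᵐ x ∂Ω.surf, essInf ρ Ω.surf ≤ ρ x := by
  refine ae_essInf_le ?_
  refine ⟨-‖ρ‖, ?_⟩
  rw [eventually_map]
  filter_upwards [ae_le_eLpNormEssSup (f := ρ) (μ := Ω.surf)] with x hx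
  have h1 : ‖ρ x‖ ≤ ‖ρ‖ := by
    rw [Lp.norm_def, eLpNorm_exponent_top, ← toReal_enorm]
    refine ENNReal.toReal_mono ?_ hx
    have := Lp.eLpNorm_ne_top ρ
    rwa [eLpNorm_exponent_top] at this
  exact (abs_le.1 h1).1

/-- If `ess inf ρ > 0`, then the surface measure is nonzero: over the zero measure, the real-valued
essential infimum is `sSup univ = 0`. -/
lemma surf_ne_zero {Ω : BoundedC1Domain N} {ρ : Weight Ω} (hρ : 0 < essInf ρ Ω.surf) :
    Ω.surf ≠ 0 := by
  intro h
  have h1 : ae Ω.surf = ⊥ := by rw [h, ae_zero]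
  rw [essInf, h1, liminf_eq] at hρ
  simp at hρ

lemma integral_weight_pos {Ω : BoundedC1Domain N} {ρ : Weight Ω} (hρ : 0 < essInf ρ Ω.surf) :
    0 < ∫ x, ρ x ∂Ω.surf := by
  have hint : Integrable ρ Ω.surf := (Lp.memLp ρ).integrable le_top
  have h1 : ∫ _, essInf ρ Ω.surf ∂Ω.surf ≤ ∫ x, ρ x ∂Ω.surf :=
    integral_mono_ae (integrable_const _) hint (essInf_le_ae ρ)
  refine lt_of_lt_of_le ?_ h1
  rw [integral_const, smul_eq_mul]
  refine mul_pos ?_ hρ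
  have := surf_ne_zero hρ
  simpa [Measure.real, ENNReal.toReal_pos_iff, pos_iff_ne_zero] using this

lemma trace_one (Ω : BoundedC1Domain N) : trace Ω (H2.one Ω) =ᵐ[Ω.surf] fun _ => (1 : ℝ) := by
  have h : trace Ω (H2.one Ω) = smoothToBdry Ω (smoothOne N) :=
    traceH1_smoothToH1 Ω (smoothOne N)
  rw [h]
  exact MemLp.coeFn_toLp (memLp_surf Ω (smoothFunctions.contDiff (smoothOne N)).continuous 2)

lemma steklovJ_trace_one (Ω : BoundedC1Domain N) (ρ : Weight Ω) (u : H2 Ω) :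
    steklovJ Ω ρ (trace Ω u) (H2.one Ω) = bdryIntegral Ω ρ u := by
  rw [steklovJ_apply]
  refine integral_congr_ae ?_
  filter_upwards [trace_one Ω] with x hx
  rw [hx, mul_one]

lemma steklovJ_comm (Ω : BoundedC1Domain N) (ρ : Weight Ω) (u v : H2 Ω) :
    steklovJ Ω ρ (trace Ω u) v = steklovJ Ω ρ (trace Ω v) u := by
  rw [steklovJ_apply, steklovJ_apply]
  refine integral_congr_ae (ae_of_all _ fun x => ?_)
  change ρ x * trace Ω u x * trace Ω v x = ρ x * trace Ω v x * trace Ω u x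
  ring

lemma bdryIntegral_one (Ω : BoundedC1Domain N) (ρ : Weight Ω) :
    bdryIntegral Ω ρ (H2.one Ω) = ∫ x, ρ x ∂Ω.surf := by
  refine integral_congr_ae ?_
  filter_upwards [trace_one Ω] with x hx
  rw [hx, mul_one]

lemma continuous_bdryIntegral (Ω : BoundedC1Domain N) (ρ : Weight Ω) :
    Continuous (bdryIntegral Ω ρ) := by
  have h : (bdryIntegral Ω ρ : H2 Ω → ℝ) = steklovJ Ω ρ (trace Ω (H2.one Ω)) := by
    ext u
    rw [← steklovJ_trace_one, steklovJ_comm]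
  rw [h]
  exact (steklovJ Ω ρ (trace Ω (H2.one Ω))).continuous

instance (Ω : BoundedC1Domain N) (ρ : Weight Ω) : CompleteSpace (H2rho Ω ρ) :=
  (isClosed_singleton.preimage (continuous_bdryIntegral Ω ρ)).completeSpace_coe

variable {Ω : BoundedC1Domain N} {τ : ℝ≥0} {ρ : Weight Ω}

lemma eq_zero_of_mem_constants_of_mem_H2rho (hρ : 0 < essInf ρ Ω.surf) {u : H2 Ω}
    (hu : u ∈ constants Ω) (hu' : u ∈ H2rho Ω ρ) : u = 0 := by
  obtain ⟨c, rfl⟩ := Submodule.mem_span_singleton.1 hu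
  have h : bdryIntegral Ω ρ (c • H2.one Ω) = 0 := hu'
  rw [map_smul, bdryIntegral_one, smul_eq_mul, mul_eq_zero] at h
  rcases h with rfl | h
  · simp
  · exact absurd h (integral_weight_pos hρ).ne'

lemma piMap_mem_H2rho (hρ : 0 < essInf ρ Ω.surf) (u : H2 Ω) : piMap Ω ρ u ∈ H2rho Ω ρ := by
  change bdryIntegral Ω ρ (u - _) = 0
  rw [map_sub, map_smul, bdryIntegral_one, smul_eq_mul,
    div_mul_cancel₀ _ (integral_weight_pos hρ).ne', sub_self]

lemma piMap_of_mem_H2rho {u : H2 Ω} (hu : u ∈ H2rho Ω ρ) : piMap Ω ρ u = u := by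
  have h : bdryIntegral Ω ρ u = 0 := hu
  simp [piMap, h]

lemma sub_piMap_mem_constants (u : H2 Ω) : u - piMap Ω ρ u ∈ constants Ω := by
  rw [piMap, sub_sub_cancel]
  exact Submodule.smul_mem _ _ (Submodule.mem_span_singleton_self _)

lemma proj_eq_proj_iff {u v : H2 Ω} : proj Ω τ u = proj Ω τ v ↔ u - v ∈ constants Ω :=
  Submodule.Quotient.eq _

lemma proj_piMap (u : H2 Ω) : proj Ω τ (piMap Ω ρ u) = proj Ω τ u :=
  (proj_eq_proj_iff.2 (sub_piMap_mem_constants u)).symm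

lemma piMap_eq_of_proj_eq (hρ : 0 < essInf ρ Ω.surf) {u v : H2 Ω}
    (h : proj Ω τ u = proj Ω τ v) : piMap Ω ρ u = piMap Ω ρ v := by
  rw [← sub_eq_zero]
  refine eq_zero_of_mem_constants_of_mem_H2rho hρ ?_
    ((H2rho Ω ρ).sub_mem (piMap_mem_H2rho hρ u) (piMap_mem_H2rho hρ v))
  rw [← proj_eq_proj_iff (τ := τ), proj_piMap, proj_piMap, h]

lemma piSharp_proj (hρ : 0 < essInf ρ Ω.surf) (u : H2 Ω) :
    piSharp Ω τ ρ (proj Ω τ u) = piMap Ω ρ u :=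
  piMap_eq_of_proj_eq hρ (Function.surjInv_eq (proj_surjective Ω τ) _)

lemma proj_piSharp (x : H2modR Ω τ) : proj Ω τ (piSharp Ω τ ρ x) = x := by
  rw [piSharp, proj_piMap]
  exact Function.surjInv_eq (proj_surjective Ω τ) x

lemma piSharp_mem (hρ : 0 < essInf ρ Ω.surf) (x : H2modR Ω τ) : piSharp Ω τ ρ x ∈ H2rho Ω ρ :=
  piMap_mem_H2rho hρ _

lemma piSharp_proj_of_mem (hρ : 0 < essInf ρ Ω.surf) {u : H2 Ω} (hu : u ∈ H2rho Ω ρ) :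
    piSharp Ω τ ρ (proj Ω τ u) = u := by
  rw [piSharp_proj hρ, piMap_of_mem_H2rho hu]

lemma bijOn_piSharp (hρ : 0 < essInf ρ Ω.surf) :
    BijOn (piSharp Ω τ ρ) univ (H2rho Ω ρ) := by
  refine ⟨fun x _ => piSharp_mem hρ x, fun x _ y _ h => ?_, fun u hu => ?_⟩
  · rw [← proj_piSharp (ρ := ρ) x, ← proj_piSharp (ρ := ρ) y, h]
  · exact ⟨proj Ω τ u, mem_univ _, piSharp_proj_of_mem hρ hu⟩

/-- Poincaré-type inequality: the form is coercive on `H²_ρ(Ω)`, by Rellich's theorem. -/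
lemma exists_norm_le_norm_proj (hτ : 0 < τ) (hρ : 0 < essInf ρ Ω.surf) :
    ∃ c > 0, ∀ u : H2rho Ω ρ, ‖u‖ ≤ c * ‖projL Ω τ u‖ := by
  obtain ⟨C, hC⟩ := exists_norm_le_norm_proj_add (Ω := Ω) hτ
  refine exists_norm_le_of_isCompactOperator ((projL Ω τ).comp (H2rho Ω ρ).subtypeL)
    (((H1.toL2 Ω).comp (H2.toH1 Ω)).comp (H2rho Ω ρ).subtypeL) ?_ ?_ fun u => hC u
  · exact (isCompactOperator_toL2 Ω).comp_clm ((H2.toH1 Ω).comp (H2rho Ω ρ).subtypeL)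
  · intro u hu
    have h1 : form Ω τ u u = 0 := by
      rw [← norm_proj_sq]
      change ‖proj Ω τ u‖ = 0 at hu
      rw [hu]
      simp
    exact Subtype.ext (eq_zero_of_mem_constants_of_mem_H2rho hρ
      (mem_constants_of_form_self_eq_zero hτ h1) u.2)

/-- `π♯` as a continuous linear equivalence `H²(Ω)/ℝ ≃ H²_ρ(Ω)`; its inverse is the projection. -/
def projEquiv (hτ : 0 < τ) (hρ : 0 < essInf ρ Ω.surf) : H2modR Ω τ ≃L[ℝ] H2rho Ω ρ :=
  let e : H2rho Ω ρ ≃ₗ[ℝ] H2modR Ω τ :=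
    LinearEquiv.ofBijective ((proj Ω τ).comp (H2rho Ω ρ).subtype)
      ⟨fun u v h => Subtype.ext (by
        rw [← piSharp_proj_of_mem (τ := τ) hρ u.2, ← piSharp_proj_of_mem (τ := τ) hρ v.2]
        exact congrArg _ h),
      fun x => ⟨⟨piSharp Ω τ ρ x, piSharp_mem hρ x⟩, proj_piSharp x⟩⟩
  { e.symm with
    continuous_toFun := by
      obtain ⟨c, -, hc⟩ := exists_norm_le_norm_proj (ρ := ρ) hτ hρ
      refine AddMonoidHomClass.continuous_of_bound e.symm c fun x => ?_
      have h := hc (e.symm x)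
      have h' : projL Ω τ (e.symm x) = x := e.apply_symm_apply x
      rwa [h'] at h
    continuous_invFun := ((projL Ω τ).comp (H2rho Ω ρ).subtypeL).continuous }

lemma projEquiv_symm_apply (hτ : 0 < τ) (hρ : 0 < essInf ρ Ω.surf) (u : H2rho Ω ρ) :
    (projEquiv hτ hρ).symm u = proj Ω τ u := rfl

lemma projEquiv_apply (hτ : 0 < τ) (hρ : 0 < essInf ρ Ω.surf) (x : H2modR Ω τ) :
    (projEquiv hτ hρ x : H2 Ω) = piSharp Ω τ ρ x := by
  have h : projEquiv hτ hρ x = ⟨piSharp Ω τ ρ x, piSharp_mem hρ x⟩ := by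
    rw [← ContinuousLinearEquiv.eq_symm_apply, projEquiv_symm_apply, proj_piSharp]
  rw [h]

lemma t0Space_H2modR (hτ : 0 < τ) (hρ : 0 < essInf ρ Ω.surf) : T0Space (H2modR Ω τ) :=
  (projEquiv hτ hρ).toHomeomorph.isEmbedding.t0Space

lemma completeSpace_H2modR (hτ : 0 < τ) (hρ : 0 < essInf ρ Ω.surf) : CompleteSpace (H2modR Ω τ) :=
  (completeSpace_congr (e := (projEquiv hτ hρ).toLinearEquiv.toEquiv)
    (projEquiv hτ hρ).isUniformEmbedding).2 inferInstance

/-- The restriction of the form to `H²_ρ(Ω)`. -/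
def formRho (Ω : BoundedC1Domain N) (τ : ℝ≥0) (ρ : Weight Ω) :
    H2rho Ω ρ →L[ℝ] H2rho Ω ρ →L[ℝ] ℝ :=
  (formL Ω τ).bilinearComp (H2rho Ω ρ).subtypeL (H2rho Ω ρ).subtypeL

lemma isCoercive_formRho (hτ : 0 < τ) (hρ : 0 < essInf ρ Ω.surf) :
    IsCoercive (formRho Ω τ ρ) := by
  obtain ⟨c, hc, h⟩ := exists_norm_le_norm_proj (ρ := ρ) hτ hρ
  refine ⟨(c ^ 2)⁻¹, by positivity, fun u => ?_⟩
  have h1 : formRho Ω τ ρ u u = ‖projL Ω τ u‖ ^ 2 := by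
    rw [projL_apply, norm_proj_sq, ← formL_apply]
    rfl
  rw [h1, mul_assoc, inv_mul_le_iff₀ (by positivity), ← mul_pow, ← sq]
  exact pow_le_pow_left₀ (norm_nonneg _) (h u) 2

/-- The inverse of the Riesz isomorphism as a continuous linear map. -/
def rieszL (E : Type*) [NormedAddCommGroup E] [InnerProductSpace ℝ E] [CompleteSpace E] :
    StrongDual ℝ E →L[ℝ] E where
  toFun := (InnerProductSpace.toDual ℝ E).symm
  map_add' := map_add _
  map_smul' := fun c G => by simp
  cont := (InnerProductSpace.toDual ℝ E).symm.continuous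

lemma inner_rieszL {E : Type*} [NormedAddCommGroup E] [InnerProductSpace ℝ E] [CompleteSpace E]
    (G : StrongDual ℝ E) (x : E) : inner ℝ (rieszL E G) x = G x :=
  InnerProductSpace.toDual_symm_apply

/-- The solution operator: `solveRho G` is the `u ∈ H²_ρ(Ω)` with `⟨u, φ⟩ = G φ` for all
`φ ∈ H²_ρ(Ω)`, by the Lax–Milgram theorem. -/
def solveRho (hτ : 0 < τ) (hρ : 0 < essInf ρ Ω.surf) :
    StrongDual ℝ (H2 Ω) →L[ℝ] H2rho Ω ρ :=
  (((isCoercive_formRho hτ hρ).continuousLinearEquivOfBilin.symm : H2rho Ω ρ →L[ℝ] H2rho Ω ρ).comp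
    (rieszL (H2rho Ω ρ))).comp
    ((ContinuousLinearMap.compL ℝ (H2rho Ω ρ) (H2 Ω) ℝ).flip (H2rho Ω ρ).subtypeL)

lemma form_solveRho (hτ : 0 < τ) (hρ : 0 < essInf ρ Ω.surf) (G : StrongDual ℝ (H2 Ω))
    (φ : H2rho Ω ρ) : form Ω τ (solveRho hτ hρ G) φ = G φ := by
  rw [← formL_apply]
  change formRho Ω τ ρ (solveRho hτ hρ G) φ = G φ
  rw [← (isCoercive_formRho hτ hρ).continuousLinearEquivOfBilin_apply]
  have h : (isCoercive_formRho hτ hρ).continuousLinearEquivOfBilin (solveRho hτ hρ G)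
      = rieszL (H2rho Ω ρ) (G.comp (H2rho Ω ρ).subtypeL) :=
    ContinuousLinearEquiv.apply_symm_apply _ _
  rw [h, inner_rieszL]
  rfl

lemma form_piMap_right (u φ : H2 Ω) : form Ω τ u (piMap Ω ρ φ) = form Ω τ u φ := by
  rw [← formL_apply, ← formL_apply, ← sub_eq_zero, ← map_sub, ← neg_sub, map_neg, neg_eq_zero]
  exact form_constant_right τ u (sub_piMap_mem_constants φ)

lemma apply_piMap_of_mem_dualF {G : StrongDual ℝ (H2 Ω)} (hG : G ∈ dualF Ω) (φ : H2 Ω) :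
    G (piMap Ω ρ φ) = G φ := by
  have h : G (H2.one Ω) = 0 := hG
  rw [piMap, map_sub, map_smul, h, smul_zero, sub_zero]

/-- If `G 1 = 0`, the equation solved by `solveRho G` holds for all `φ ∈ H²(Ω)`, as both sides are
unaffected by adding constants to `φ`. -/
lemma form_solveRho_of_mem_dualF (hτ : 0 < τ) (hρ : 0 < essInf ρ Ω.surf)
    {G : StrongDual ℝ (H2 Ω)} (hG : G ∈ dualF Ω) (φ : H2 Ω) :
    form Ω τ (solveRho hτ hρ G) φ = G φ := by
  rw [← form_piMap_right (ρ := ρ), ← apply_piMap_of_mem_dualF (ρ := ρ) hG]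
  exact form_solveRho hτ hρ G ⟨_, piMap_mem_H2rho hρ φ⟩

lemma steklovP_injective (hτ : 0 < τ) (hρ : 0 < essInf ρ Ω.surf) :
    Function.Injective (steklovP Ω τ ρ) := by
  refine (injective_iff_map_eq_zero _).2 fun u hu => Subtype.ext ?_
  refine eq_zero_of_mem_constants_of_mem_H2rho hρ
    (mem_constants_of_form_self_eq_zero hτ ?_) u.2
  rw [← steklovP_apply Ω τ ρ u u, hu]
  rfl

lemma steklovP_solveRho (hτ : 0 < τ) (hρ : 0 < essInf ρ Ω.surf)
    {G : StrongDual ℝ (H2 Ω)} (hG : G ∈ dualF Ω) :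
    (steklovP Ω τ ρ (solveRho hτ hρ G) : StrongDual ℝ (H2 Ω)) = G := by
  ext φ
  rw [steklovP_apply, form_solveRho_of_mem_dualF hτ hρ hG]

lemma bijective_steklovP (hτ : 0 < τ) (hρ : 0 < essInf ρ Ω.surf) :
    Function.Bijective (steklovP Ω τ ρ) :=
  ⟨steklovP_injective hτ hρ, fun G =>
    ⟨solveRho hτ hρ G, Subtype.ext (steklovP_solveRho hτ hρ G.2)⟩⟩

/-! ### The Steklov operator -/

/-- The operator `𝒥_ρ` as a continuous linear map. -/
def steklovJL (Ω : BoundedC1Domain N) (ρ : Weight Ω) : L2Bdry Ω →L[ℝ] StrongDual ℝ (H2 Ω) :=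
  (steklovJ Ω ρ).mkContinuous (‖ρ‖ * ‖trace Ω‖) fun u => by
    change ‖(innerSL ℝ (ρ • u : L2Bdry Ω)).comp (trace Ω)‖ ≤ _
    refine (ContinuousLinearMap.opNorm_comp_le _ _).trans ?_
    rw [innerSL_apply_norm, mul_right_comm]
    exact mul_le_mul_of_nonneg_right (Lp.norm_smul_le ρ u) (norm_nonneg _)

/-- The operator `T_ρ` as a continuous linear map. -/
def steklovOpL (hτ : 0 < τ) (hρ : 0 < essInf ρ Ω.surf) : H2modR Ω τ →L[ℝ] H2modR Ω τ :=
  (((projEquiv hτ hρ).symm : H2rho Ω ρ →L[ℝ] H2modR Ω τ).comp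
    ((solveRho hτ hρ).comp (steklovJL Ω ρ))).comp
    ((trace Ω).comp ((H2rho Ω ρ).subtypeL.comp
      (projEquiv hτ hρ : H2modR Ω τ →L[ℝ] H2rho Ω ρ)))

lemma steklovOpL_eq (hτ : 0 < τ) (hρ : 0 < essInf ρ Ω.surf) (x : H2modR Ω τ) :
    steklovOpL hτ hρ x
      = proj Ω τ (solveRho hτ hρ (steklovJ Ω ρ (trace Ω (piSharp Ω τ ρ x)))) := by
  rw [← projEquiv_apply hτ hρ]
  rfl

lemma steklovJ_trace_mem_dualF {u : H2 Ω} (hu : u ∈ H2rho Ω ρ) :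
    steklovJ Ω ρ (trace Ω u) ∈ dualF Ω := by
  change steklovJ Ω ρ (trace Ω u) (H2.one Ω) = 0
  rw [steklovJ_trace_one]
  exact hu

lemma steklovOpL_apply (hτ : 0 < τ) (hρ : 0 < essInf ρ Ω.surf) (x : H2modR Ω τ) :
    steklovOpL hτ hρ x = steklovOp Ω τ ρ x := by
  have hinj : Function.Injective fun u : H2rho Ω ρ => (steklovP Ω τ ρ u : StrongDual ℝ (H2 Ω)) :=
    fun u v h => steklovP_injective hτ hρ (Subtype.ext h)
  have hG := steklovJ_trace_mem_dualF (piSharp_mem (τ := τ) hρ x)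
  have h1 : Function.invFun (fun u : H2rho Ω ρ => (steklovP Ω τ ρ u : StrongDual ℝ (H2 Ω)))
      (steklovJ Ω ρ (trace Ω (piSharp Ω τ ρ x)))
      = solveRho hτ hρ (steklovJ Ω ρ (trace Ω (piSharp Ω τ ρ x))) := by
    conv_lhs => rw [← steklovP_solveRho hτ hρ hG]
    exact Function.leftInverse_invFun hinj _
  rw [steklovOp, h1, steklovOpL_eq]
  set u := solveRho hτ hρ (steklovJ Ω ρ (trace Ω (piSharp Ω τ ρ x)))
  rw [← piSharp_proj_of_mem (τ := τ) hρ u.2]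
  rw [Function.leftInverse_invFun fun x y h =>
    (bijOn_piSharp hρ).injOn (mem_univ x) (mem_univ y) h]
  rw [proj_piSharp]

/-- The operator `T_ρ` represents the weighted boundary form. -/
lemma inner_steklovOpL (hτ : 0 < τ) (hρ : 0 < essInf ρ Ω.surf) (x y : H2modR Ω τ) :
    inner ℝ (steklovOpL hτ hρ x) y
      = steklovJ Ω ρ (trace Ω (piSharp Ω τ ρ x)) (piSharp Ω τ ρ y) := by
  conv_lhs => rw [← proj_piSharp (ρ := ρ) y]
  rw [steklovOpL_eq, inner_proj]
  exact form_solveRho hτ hρ _ ⟨_, piSharp_mem hρ y⟩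

lemma isSymmetric_steklovOpL (hτ : 0 < τ) (hρ : 0 < essInf ρ Ω.surf) :
    (steklovOpL hτ hρ : H2modR Ω τ →ₗ[ℝ] H2modR Ω τ).IsSymmetric := by
  intro x y
  change inner ℝ (steklovOpL hτ hρ x) y = inner ℝ x (steklovOpL hτ hρ y)
  rw [real_inner_comm (steklovOpL hτ hρ y) x, inner_steklovOpL, inner_steklovOpL, steklovJ_comm]

lemma isCompactOperator_steklovOpL (hτ : 0 < τ) (hρ : 0 < essInf ρ Ω.surf) :
    IsCompactOperator (steklovOpL hτ hρ) := by
  refine IsCompactOperator.clm_comp ?_ (((projEquiv hτ hρ).symm :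
    H2rho Ω ρ →L[ℝ] H2modR Ω τ).comp ((solveRho hτ hρ).comp (steklovJL Ω ρ)))
  exact (isCompactOperator_traceH1 Ω).comp_clm ((H2.toH1 Ω).comp ((H2rho Ω ρ).subtypeL.comp
    (projEquiv hτ hρ : H2modR Ω τ →L[ℝ] H2rho Ω ρ)))

lemma ae_nonneg_weight_mul_self (hρ : 0 < essInf ρ Ω.surf) (g : L2Bdry Ω) :
    ∀ᵐ x ∂Ω.surf, 0 ≤ ρ x * g x * g x := by
  filter_upwards [essInf_le_ae ρ] with x hx
  rw [mul_assoc]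
  exact mul_nonneg (hρ.le.trans hx) (mul_self_nonneg _)

lemma steklovJ_trace_self_nonneg (hρ : 0 < essInf ρ Ω.surf) (u : H2 Ω) :
    0 ≤ steklovJ Ω ρ (trace Ω u) u := by
  rw [steklovJ_apply]
  exact integral_nonneg_of_ae (ae_nonneg_weight_mul_self hρ _)

/-- The weighted boundary form is positive definite on traces, since `ρ > 0` almost everywhere. -/
lemma trace_eq_zero_of_steklovJ_self (hρ : 0 < essInf ρ Ω.surf) {u : H2 Ω}
    (hu : steklovJ Ω ρ (trace Ω u) u = 0) : trace Ω u = 0 := by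
  rw [steklovJ_apply] at hu
  have hint : Integrable (fun x => ρ x * trace Ω u x * trace Ω u x) Ω.surf := by
    have h := (Lp.memLp (ρ • trace Ω u : L2Bdry Ω)).integrable_mul (Lp.memLp (trace Ω u))
    refine h.congr ?_
    filter_upwards [Lp.coeFn_lpSMul (r := 2) ρ (trace Ω u)] with x hx
    simp [hx]
  have h1 := (integral_eq_zero_iff_of_nonneg_ae (ae_nonneg_weight_mul_self hρ _) hint).1 hu
  apply Lp.ext
  filter_upwards [h1, essInf_le_ae ρ, Lp.coeFn_zero ℝ 2 Ω.surf] with x h2 h3 h4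
  rw [h4]
  have h5 : ρ x ≠ 0 := (hρ.trans_le h3).ne'
  simpa [h5] using h2

/-! ### Compact symmetric operators -/

section Spectral

variable {E : Type*} [NormedAddCommGroup E] [InnerProductSpace ℝ E]

/-- The eigenvalues of a compact symmetric operator can accumulate only at `0`: unit eigenvectors
for distinct eigenvalues of modulus at least `ε` have images at distance at least `ε`. -/
lemma finite_setOf_hasEigenvalue {T : E →L[ℝ] E} (hT : IsCompactOperator T)
    (hsym : (T : E →ₗ[ℝ] E).IsSymmetric) {ε : ℝ} (hε : 0 < ε) :
    {μ : ℝ | ε ≤ |μ| ∧ Module.End.HasEigenvalue (T : E →ₗ[ℝ] E) μ}.Finite := by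
  by_contra hinf
  have hex : ∀ μ : {μ : ℝ | ε ≤ |μ| ∧ Module.End.HasEigenvalue (T : E →ₗ[ℝ] E) μ},
      ∃ v : E, ‖v‖ = 1 ∧ T v = (μ : ℝ) • v := by
    rintro ⟨μ, -, hμ⟩
    obtain ⟨v, hv⟩ := hμ.exists_hasEigenvector
    have hv0 : ‖v‖ ≠ 0 := norm_ne_zero_iff.2 hv.2
    have hTv : T v = μ • v := hv.apply_eq_smul
    refine ⟨‖v‖⁻¹ • v, ?_, ?_⟩
    · rw [norm_smul, norm_inv, norm_norm, inv_mul_cancel₀ hv0]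
    · rw [map_smul, hTv, smul_comm]
  choose v hv1 hv2 using hex
  have horth : ∀ μ ν, μ ≠ ν → inner ℝ (v μ) (v ν) = 0 := by
    intro μ ν hne
    have h := hsym (v μ) (v ν)
    change inner ℝ (T (v μ)) (v ν) = inner ℝ (v μ) (T (v ν)) at h
    rw [hv2, hv2, real_inner_smul_left, real_inner_smul_right, ← sub_eq_zero, ← sub_mul,
      mul_eq_zero, sub_eq_zero] at h
    exact h.resolve_left fun h => hne (Subtype.ext h)
  have hsep : ∀ μ ν, μ ≠ ν → ε ≤ ‖T (v μ) - T (v ν)‖ := by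
    intro μ ν hne
    have h1 : ‖T (v μ) - T (v ν)‖ ^ 2 = |(μ : ℝ)| ^ 2 + |(ν : ℝ)| ^ 2 := by
      rw [hv2, hv2, norm_sub_sq_real, norm_smul, norm_smul, real_inner_smul_left,
        real_inner_smul_right, horth μ ν hne, hv1, hv1]
      simp
    refine le_of_sq_le_sq ?_ (norm_nonneg _)
    rw [h1]
    have h2 := pow_le_pow_left₀ hε.le μ.2.1 2
    have h3 : 0 ≤ |(ν : ℝ)| ^ 2 := by positivity
    linarith
  let f := Set.Infinite.natEmbedding _ hinf
  obtain ⟨K, hK, hKT⟩ := hT.image_closedBall_subset_compact 1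
  have hmem : ∀ n, T (v (f n)) ∈ K := fun n =>
    hKT ⟨v (f n), by simp [hv1], rfl⟩
  obtain ⟨a, -, φ, hφ, hlim⟩ := hK.tendsto_subseq hmem
  obtain ⟨n, hn⟩ := (Metric.cauchySeq_iff'.1 hlim.cauchySeq) ε hε
  have h1 := hn (n + 1) (Nat.le_succ n)
  rw [dist_eq_norm] at h1
  refine absurd h1 (not_lt.2 (hsep _ _ fun h => ?_))
  have := hφ.injective (f.injective h)
  omega

/-- A compact symmetric operator with only finitely many nonzero eigenvalues has finite rank. -/
lemma finiteDimensional_range_of_finite_hasEigenvalue [CompleteSpace E] {T : E →L[ℝ] E}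
    (hT : IsCompactOperator T) (hsym : (T : E →ₗ[ℝ] E).IsSymmetric)
    (hfin : {μ : ℝ | μ ≠ 0 ∧ Module.End.HasEigenvalue (T : E →ₗ[ℝ] E) μ}.Finite) :
    FiniteDimensional ℝ (LinearMap.range (T : E →ₗ[ℝ] E)) := by
  set S := {μ : ℝ | μ ≠ 0 ∧ Module.End.HasEigenvalue (T : E →ₗ[ℝ] E) μ}
  have : Finite S := hfin
  have hfd : ∀ μ : S, FiniteDimensional ℝ (Module.End.eigenspace (T : E →ₗ[ℝ] E) (μ : ℝ)) :=
    fun μ => ContinuousLinearMap.finite_dimensional_eigenspace hT _ μ.2.1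
  set E₀ : Submodule ℝ E := ⨆ μ : S, Module.End.eigenspace (T : E →ₗ[ℝ] E) (μ : ℝ)
  have hE₀ : FiniteDimensional ℝ E₀ := inferInstance
  suffices h : LinearMap.range (T : E →ₗ[ℝ] E) ≤ E₀ from Submodule.finiteDimensional_of_le h
  rw [LinearMap.range_le_iff_comap, ← top_le_iff]
  have hdense : (⨆ μ : ℝ, Module.End.eigenspace (T : E →ₗ[ℝ] E) μ).topologicalClosure = ⊤ :=
    Submodule.topologicalClosure_eq_top_iff.2
      (ContinuousLinearMap.orthogonalComplement_iSup_eigenspaces_eq_bot hT hsym)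
  rw [← hdense]
  refine Submodule.topologicalClosure_minimal _ (iSup_le fun μ x hx => ?_)
    ((Submodule.closed_of_finiteDimensional E₀).preimage T.continuous)
  have hx' : T x = μ • x := Module.End.mem_eigenspace_iff.1 hx
  change T x ∈ E₀
  rw [hx']
  by_cases hμ : μ = 0
  · simp [hμ]
  by_cases hx0 : x = 0
  · simp [hx0]
  exact E₀.smul_mem _ (le_iSup (fun μ : S => Module.End.eigenspace (T : E →ₗ[ℝ] E) (μ : ℝ))
    ⟨μ, hμ, Module.End.hasEigenvalue_of_hasEigenvector ⟨hx, hx0⟩⟩ hx)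

end Spectral

/-- The normed group structure on a seminormed group that is a `T0` space. -/
abbrev normedAddCommGroupOfT0 (E : Type*) [SeminormedAddCommGroup E] [T0Space E] :
    NormedAddCommGroup E :=
  NormedAddCommGroup.ofSeparation fun x hx =>
    (show Inseparable x 0 from Metric.inseparable_iff.2 (by simpa using hx)).eq

/-! ### Enumeration with multiplicities -/

/-- A multiplicity function on `ℝ` whose support is infinite and locally finite towards `-∞` is
that of a nondecreasing sequence: the pairs `(l, k)` with `k < m l` in lexicographic order are
order isomorphic to `ℕ`. -/
lemma exists_monotone_enumeration (m : ℝ → ℕ) (hfin : ∀ a, {l : ℝ | l ≤ a ∧ m l ≠ 0}.Finite)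
    (hinf : {l : ℝ | m l ≠ 0}.Infinite) :
    ∃ lam : ℕ → ℝ, Monotone lam ∧ Tendsto lam atTop atTop ∧ range lam = {l | m l ≠ 0} ∧
      ∀ l, {j | lam j = l}.ncard = m l := by
  let I : Type := {p : ℝ ×ₗ ℕ // (ofLex p).2 < m (ofLex p).1}
  have hIic : ∀ p : I, (Iic p).Finite := by
    intro p
    have h : (⋃ l ∈ {l : ℝ | l ≤ (ofLex p.1).1 ∧ m l ≠ 0},
        (fun k : ℕ => (toLex (l, k) : ℝ ×ₗ ℕ)) '' Iio (m l)).Finite :=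
      (hfin _).biUnion fun l _ => (finite_Iio (m l)).image _
    refine Finite.of_finite_image (f := Subtype.val) (h.subset ?_) Subtype.val_injective.injOn
    rintro _ ⟨q, hq, rfl⟩
    simp only [mem_iUnion]
    exact ⟨(ofLex q.1).1, ⟨Prod.Lex.monotone_fst _ _ hq, (Nat.zero_le _).trans_lt q.2 |>.ne'⟩,
      (ofLex q.1).2, q.2, rfl⟩
  have hbig : ∀ a : ℝ, ∃ l, a < l ∧ m l ≠ 0 := by
    intro a
    by_contra! h
    refine hinf ((hfin a).subset fun l hl => ⟨?_, hl⟩)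
    by_contra! h'
    exact hl (h l h')
  obtain ⟨l₀, -, hl₀⟩ := hbig 0
  let : LocallyFiniteOrder I := LocallyFiniteOrder.ofFiniteIcc fun p q =>
    (hIic q).subset Icc_subset_Iic_self
  have : NoMaxOrder I := ⟨fun p => by
    obtain ⟨l, hl, hl'⟩ := hbig (ofLex p.1).1
    exact ⟨⟨toLex (l, 0), Nat.pos_of_ne_zero hl'⟩, Prod.Lex.lt_iff.2 (Or.inl hl)⟩⟩
  have : Nonempty I := ⟨⟨toLex (l₀, 0), Nat.pos_of_ne_zero hl₀⟩⟩
  obtain ⟨b, hb⟩ : ∃ b : I, ∀ p, b ≤ p := by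
    obtain ⟨p⟩ := ‹Nonempty I›
    obtain ⟨b, hb, hb'⟩ := (hIic p).exists_minimal ⟨p, self_mem_Iic⟩
    refine ⟨b, fun q => ?_⟩
    rcases le_total b q with h | h
    · exact h
    · exact hb' (h.trans hb) h
  let : OrderBot I := { bot := b, bot_le := hb }
  let : SuccOrder I := LinearLocallyFiniteOrder.succOrder I
  let : PredOrder I := LinearLocallyFiniteOrder.predOrder I
  let f : ℕ ≃o I := (orderIsoNatOfLinearSuccPredArch (ι := I)).symm
  have hmono : Monotone fun j => (ofLex (f j).1).1 := fun i j hij =>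
    Prod.Lex.monotone_fst _ _ (f.monotone hij)
  have hrange : ∀ l k, k < m l → ∃ j, (f j).1 = toLex (l, k) := fun l k h =>
    ⟨f.symm ⟨toLex (l, k), h⟩, by simp⟩
  refine ⟨fun j => (ofLex (f j).1).1, hmono, ?_, ?_, fun l => ?_⟩
  · refine tendsto_atTop_atTop_of_monotone hmono fun a => ?_
    obtain ⟨l, hl, hl'⟩ := hbig a
    obtain ⟨j, hj⟩ := hrange l 0 (Nat.pos_of_ne_zero hl')
    exact ⟨j, by simpa [hj] using hl.le⟩
  · ext l
    constructor
    · rintro ⟨j, rfl⟩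
      exact ((Nat.zero_le _).trans_lt (f j).2).ne'
    · intro hl
      obtain ⟨j, hj⟩ := hrange l 0 (Nat.pos_of_ne_zero hl)
      exact ⟨j, by simp [hj]⟩
  · have h1 : InjOn (fun j => (ofLex (f j).1).2) {j | (ofLex (f j).1).1 = l} := by
      intro i hi j hj hij
      refine f.injective (Subtype.ext (ofLex.injective (Prod.ext ?_ hij)))
      exact (show (ofLex (f i).1).1 = l from hi).trans (show (ofLex (f j).1).1 = l from hj).symm
    have h2 : (fun j => (ofLex (f j).1).2) '' {j | (ofLex (f j).1).1 = l} = Iio (m l) := by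
      ext k
      constructor
      · rintro ⟨j, rfl, rfl⟩
        exact (f j).2
      · intro hk
        obtain ⟨j, hj⟩ := hrange l k hk
        exact ⟨j, by simp [hj], by simp [hj]⟩
    rw [← h1.ncard_image, h2]
    simp [Set.ncard_eq_toFinset_card']

/-! ### Infinitely many eigenvalues -/

lemma contDiff_partialDeriv {f : Space N → ℝ} (hf : ContDiff ℝ ∞ f) (i : Fin N) :
    ContDiff ℝ ∞ (partialDeriv i f) :=
  (hf.fderiv_right (m := ∞) (by simp)).clm_apply contDiff_const

lemma smoothToBdry_mem_range_trace (Ω : BoundedC1Domain N) (f : smoothFunctions N) :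
    smoothToBdry Ω f ∈ LinearMap.range (trace Ω : H2 Ω →ₗ[ℝ] L2Bdry Ω) := by
  have hf := smoothFunctions.contDiff f
  let u : H2 Ω := ⟨WithLp.toLp 2 (smoothToH1 Ω f, WithLp.toLp 2 fun p =>
    (memLp_vol Ω (continuous_partialDeriv (contDiff_partialDeriv hf p.2) p.1) 2).toLp
      (partialDeriv p.1 (partialDeriv p.2 f))), fun i j =>
    isWeakPartial_toLp Ω i (contDiff_partialDeriv hf j)⟩
  exact ⟨u, traceH1_smoothToH1 Ω f⟩

/-- The support of the surface measure is infinite, as this measure has no atoms. -/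
lemma infinite_support_surf (hN : 2 ≤ N) (hσ : Ω.surf ≠ 0) : Ω.surf.support.Infinite := by
  intro hfin
  have hpos : (0 : ℝ) < ((N - 1 : ℕ) : ℝ) := by
    have : 0 < N - 1 := by omega
    exact_mod_cast this
  have := Measure.nullSingletonClass_hausdorff (Space N) hpos
  have h1 : (μHE[N - 1] : Measure (Space N)) Ω.surf.support = 0 := by
    rw [Measure.euclideanHausdorffMeasure_def, Measure.smul_apply, hfin.measure_zero, smul_zero]
  have h2 : Ω.surf Ω.surf.support = 0 :=
    le_antisymm ((Measure.restrict_apply_le _ _).trans h1.le) bot_le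
  apply hσ
  rw [← Measure.measure_univ_eq_zero, ← union_compl_self Ω.surf.support]
  exact measure_union_null h2 Measure.measure_compl_support

/-- The restrictions of smooth functions to `∂Ω` span an infinite-dimensional space: bump functions
around different points of the support of the surface measure are orthogonal. -/
lemma not_finiteDimensional_range_smoothToBdry (hN : 2 ≤ N) (hσ : Ω.surf ≠ 0) :
    ¬ FiniteDimensional ℝ (LinearMap.range (smoothToBdry Ω)) := by
  intro hfd
  obtain ⟨s, hs, hcard⟩ := (infinite_support_surf hN hσ).exists_subset_card_eq
    (Module.finrank ℝ (LinearMap.range (smoothToBdry Ω)) + 1)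
  obtain ⟨U, hU, hdisj⟩ := s.finite_toSet.t2_separation
  have hbump : ∀ x, ∃ f : smoothFunctions N, tsupport (f : Space N → ℝ) ⊆ U x ∧
      (f : Space N → ℝ) x = 1 := by
    intro x
    obtain ⟨f, h1, -, h3, -, h5⟩ := exists_contDiff_tsupport_subset (n := ⊤)
      ((hU x).2.mem_nhds (hU x).1)
    exact ⟨⟨f, h3⟩, h1, h5⟩
  choose f hf1 hf2 using hbump
  have hcoe : ∀ x, smoothToBdry Ω (f x) =ᵐ[Ω.surf] (f x : Space N → ℝ) := fun x =>
    MemLp.coeFn_toLp (memLp_surf Ω (smoothFunctions.contDiff (f x)).continuous 2)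
  have hli : LinearIndependent ℝ fun x : s => smoothToBdry Ω (f x) := by
    refine linearIndependent_of_ne_zero_of_inner_eq_zero (fun x h0 => ?_) fun x y hxy => ?_
    · have hx : (x : Space N) ∈ Ω.surf.support := hs x.2
      have hopen : {y | (f x : Space N → ℝ) y ≠ 0} ∈ 𝓝 (x : Space N) :=
        (isOpen_ne_fun (smoothFunctions.contDiff (f x)).continuous continuous_const).mem_nhds
          (by simp [hf2])
      refine ((Measure.mem_support_iff_forall _).1 hx _ hopen).ne' ?_
      change ∀ᵐ y ∂Ω.surf, (f x : Space N → ℝ) y = 0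
      filter_upwards [hcoe x, Lp.coeFn_zero ℝ 2 Ω.surf] with y h1 h2
      rw [← h1, h0, h2]
      rfl
    · change inner ℝ (smoothToBdry Ω (f x)) (smoothToBdry Ω (f y)) = 0
      rw [L2.inner_def]
      refine integral_eq_zero_of_ae ?_
      filter_upwards [hcoe x, hcoe y] with z h1 h2
      rw [h1, h2]
      have hd := hdisj x.2 y.2 (fun h => hxy (Subtype.ext h))
      by_cases hz : z ∈ U x
      · have : (f y : Space N → ℝ) z = 0 := by
          by_contra h
          exact disjoint_left.1 hd hz (hf1 y (subset_tsupport _ h))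
        simp [this]
      · have : (f x : Space N → ℝ) z = 0 := by
          by_contra h
          exact hz (hf1 x (subset_tsupport _ h))
        simp [this]
  have hli' : LinearIndependent ℝ fun x : s =>
      (⟨smoothToBdry Ω (f x), f x, rfl⟩ : LinearMap.range (smoothToBdry Ω)) :=
    LinearIndependent.of_comp (LinearMap.range (smoothToBdry Ω)).subtype hli
  have h := hli'.fintype_card_le_finrank
  rw [Fintype.card_coe, hcard] at h
  omega

/-- The operator `T_ρ` has infinite rank, since its kernel consists of classes of functions with
constant trace. -/
lemma not_finiteDimensional_range_steklovOpL (hN : 2 ≤ N) (hτ : 0 < τ)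
    (hρ : 0 < essInf ρ Ω.surf) :
    ¬ FiniteDimensional ℝ
      (LinearMap.range (steklovOpL hτ hρ : H2modR Ω τ →ₗ[ℝ] H2modR Ω τ)) := by
  intro hfd
  let T : H2modR Ω τ →ₗ[ℝ] H2modR Ω τ := (steklovOpL hτ hρ).toLinearMap
  let Φ : H2modR Ω τ →ₗ[ℝ] L2Bdry Ω := (trace Ω).toLinearMap.comp
    ((H2rho Ω ρ).subtype.comp (projEquiv hτ hρ).toLinearEquiv.toLinearMap)
  have hΦ : ∀ x, Φ x = trace Ω (piSharp Ω τ ρ x) := fun x =>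
    congrArg (trace Ω) (projEquiv_apply hτ hρ x)
  have hker : LinearMap.ker T ≤ LinearMap.ker Φ := by
    intro x hx
    have hx' : steklovOpL hτ hρ x = 0 := hx
    rw [LinearMap.mem_ker, hΦ]
    refine trace_eq_zero_of_steklovJ_self hρ ?_
    rw [← inner_steklovOpL hτ hρ, hx', inner_zero_left]
  have h1 : FiniteDimensional ℝ (LinearMap.range T) := hfd
  have h2 : FiniteDimensional ℝ (H2modR Ω τ ⧸ LinearMap.ker T) :=
    T.quotKerEquivRange.symm.finiteDimensional
  have h3 : FiniteDimensional ℝ (LinearMap.range Φ) := by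
    rw [← Submodule.range_liftQ _ Φ hker]
    infer_instance
  apply not_finiteDimensional_range_smoothToBdry hN (surf_ne_zero hρ)
  have h4 : LinearMap.range (smoothToBdry Ω)
      ≤ LinearMap.range Φ ⊔ Submodule.span ℝ {trace Ω (H2.one Ω)} := by
    rintro _ ⟨f, rfl⟩
    obtain ⟨u, hu⟩ := smoothToBdry_mem_range_trace Ω f
    rw [← hu]
    obtain ⟨c, hc⟩ := Submodule.mem_span_singleton.1 (sub_piMap_mem_constants (ρ := ρ) u)
    have h5 : trace Ω u = Φ (proj Ω τ u) + c • trace Ω (H2.one Ω) := by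
      rw [hΦ, piSharp_proj hρ, ← map_smul, hc, ← map_add, add_sub_cancel]
    change trace Ω u ∈ _
    rw [h5]
    exact Submodule.add_mem_sup ⟨_, rfl⟩
      (Submodule.smul_mem _ _ (Submodule.mem_span_singleton_self _))
  exact Submodule.finiteDimensional_of_le h4

/-! ### The Steklov eigenvalues -/

lemma mem_steklovEigenspace_iff {lam : ℝ} {u : H2 Ω} : u ∈ steklovEigenspace Ω τ ρ lam ↔
    ∀ φ, form Ω τ u φ = lam * steklovJ Ω ρ (trace Ω u) φ := by
  simp only [steklovJ_apply]
  rfl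

lemma form_one_right (u : H2 Ω) : form Ω τ u (H2.one Ω) = 0 := by
  rw [← formL_apply]
  exact form_constant_right τ u (Submodule.mem_span_singleton_self _)

lemma mem_H2rho_of_mem_steklovEigenspace {lam : ℝ} (hlam : lam ≠ 0) {u : H2 Ω}
    (hu : u ∈ steklovEigenspace Ω τ ρ lam) : u ∈ H2rho Ω ρ := by
  have h := mem_steklovEigenspace_iff.1 hu (H2.one Ω)
  rw [form_one_right, steklovJ_trace_one, eq_comm, mul_eq_zero] at h
  exact h.resolve_left hlam

/-- For `λ ≠ 0`, the maps `π♯` and `p` identify the eigenspace of `T_ρ` for `λ⁻¹` with the space of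
Steklov solutions for `λ`. -/
lemma steklovOpL_eq_smul_iff (hτ : 0 < τ) (hρ : 0 < essInf ρ Ω.surf) {lam : ℝ} (hlam : lam ≠ 0)
    (x : H2modR Ω τ) :
    steklovOpL hτ hρ x = lam⁻¹ • x ↔ piSharp Ω τ ρ x ∈ steklovEigenspace Ω τ ρ lam := by
  have := t0Space_H2modR hτ hρ
  let : NormedAddCommGroup (H2modR Ω τ) := normedAddCommGroupOfT0 _
  have h1 : ∀ φ, inner ℝ (steklovOpL hτ hρ x) (proj Ω τ φ)
      = steklovJ Ω ρ (trace Ω (piSharp Ω τ ρ x)) φ := fun φ => by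
    rw [inner_steklovOpL, piSharp_proj hρ,
      apply_piMap_of_mem_dualF (steklovJ_trace_mem_dualF (piSharp_mem hρ x))]
  have h2 : ∀ φ, inner ℝ x (proj Ω τ φ) = form Ω τ (piSharp Ω τ ρ x) φ := fun φ => by
    rw [← inner_proj, proj_piSharp]
  have h3 : steklovOpL hτ hρ x = lam⁻¹ • x ↔
      ∀ φ, inner ℝ (steklovOpL hτ hρ x) (proj Ω τ φ) = inner ℝ (lam⁻¹ • x) (proj Ω τ φ) := by
    refine ⟨fun h φ => by rw [h], fun h => ext_inner_right ℝ fun y => ?_⟩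
    rw [← proj_piSharp (ρ := ρ) y]
    exact h _
  rw [h3, mem_steklovEigenspace_iff]
  refine forall_congr' fun φ => ?_
  rw [real_inner_smul_left, h1, h2, eq_inv_mul_iff_mul_eq₀ hlam, eq_comm]

lemma isSteklovEigenvalue_iff_hasEigenvalue (hτ : 0 < τ) (hρ : 0 < essInf ρ Ω.surf) {lam : ℝ}
    (hlam : lam ≠ 0) : IsSteklovEigenvalue Ω τ ρ lam ↔
      Module.End.HasEigenvalue (steklovOpL hτ hρ : H2modR Ω τ →ₗ[ℝ] H2modR Ω τ) lam⁻¹ := by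
  constructor
  · rintro ⟨u, hu0, hu⟩
    have hmem := mem_H2rho_of_mem_steklovEigenspace hlam hu
    refine Module.End.hasEigenvalue_of_hasEigenvector (x := proj Ω τ u)
      ⟨Module.End.mem_eigenspace_iff.2 ((steklovOpL_eq_smul_iff hτ hρ hlam _).2 ?_), fun h => ?_⟩
    · rwa [piSharp_proj_of_mem hρ hmem]
    · apply hu0
      rw [← piSharp_proj_of_mem (τ := τ) hρ hmem, h, ← map_zero (proj Ω τ),
        piSharp_proj_of_mem hρ (zero_mem _)]
  · intro h
    obtain ⟨x, hx, hx0⟩ := h.exists_hasEigenvector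
    refine ⟨piSharp Ω τ ρ x, fun h0 => hx0 ?_, (steklovOpL_eq_smul_iff hτ hρ hlam x).1
      (Module.End.mem_eigenspace_iff.1 hx)⟩
    rw [← proj_piSharp (ρ := ρ) x, h0, map_zero]

lemma steklovEigenspace_zero (hτ : 0 < τ) (ρ : Weight Ω) :
    steklovEigenspace Ω τ ρ 0 = constants Ω := by
  ext u
  rw [mem_steklovEigenspace_iff]
  refine ⟨fun h => mem_constants_of_form_self_eq_zero hτ (by simpa using h u), fun h φ => ?_⟩
  rw [zero_mul, form_comm, ← formL_apply]
  exact form_constant_right τ φ h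

lemma one_ne_zero_H2 (hρ : 0 < essInf ρ Ω.surf) : H2.one Ω ≠ 0 := by
  intro h
  have h1 := bdryIntegral_one Ω ρ
  rw [h, map_zero] at h1
  exact (integral_weight_pos hρ).ne h1

lemma finrank_constants (hρ : 0 < essInf ρ Ω.surf) : Module.finrank ℝ (constants Ω) = 1 :=
  finrank_span_singleton (one_ne_zero_H2 hρ)

lemma IsSteklovEigenvalue.nonneg (hτ : 0 < τ) (hρ : 0 < essInf ρ Ω.surf) {lam : ℝ}
    (h : IsSteklovEigenvalue Ω τ ρ lam) : 0 ≤ lam := by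
  obtain ⟨u, hu0, hu⟩ := h
  by_contra! hlam
  have h1 := mem_steklovEigenspace_iff.1 hu u
  have h2 := steklovJ_trace_self_nonneg hρ u
  have h3 : form Ω τ u u = 0 := le_antisymm
    (h1 ▸ mul_nonpos_of_nonpos_of_nonneg hlam.le h2) (form_self_nonneg Ω τ u)
  exact hu0 (eq_zero_of_mem_constants_of_mem_H2rho hρ (mem_constants_of_form_self_eq_zero hτ h3)
    (mem_H2rho_of_mem_steklovEigenspace hlam.ne hu))

lemma finiteDimensional_steklovEigenspace (hτ : 0 < τ) (hρ : 0 < essInf ρ Ω.surf) (lam : ℝ) :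
    FiniteDimensional ℝ (steklovEigenspace Ω τ ρ lam) := by
  by_cases hlam : lam = 0
  · rw [hlam, steklovEigenspace_zero hτ ρ, constants]
    infer_instance
  have := t0Space_H2modR hτ hρ
  have := completeSpace_H2modR hτ hρ
  let : NormedAddCommGroup (H2modR Ω τ) := normedAddCommGroupOfT0 _
  have hfd : FiniteDimensional ℝ
      (Module.End.eigenspace (steklovOpL hτ hρ : H2modR Ω τ →ₗ[ℝ] H2modR Ω τ) lam⁻¹) :=
    ContinuousLinearMap.finite_dimensional_eigenspace (isCompactOperator_steklovOpL hτ hρ) _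
      (inv_ne_zero hlam)
  have hle : steklovEigenspace Ω τ ρ lam ≤
      (Module.End.eigenspace (steklovOpL hτ hρ : H2modR Ω τ →ₗ[ℝ] H2modR Ω τ) lam⁻¹).map
        ((H2rho Ω ρ).subtype.comp (projEquiv hτ hρ).toLinearEquiv.toLinearMap) := by
    intro u hu
    have hmem := mem_H2rho_of_mem_steklovEigenspace hlam hu
    have h1 := piSharp_proj_of_mem (τ := τ) hρ hmem
    refine ⟨proj Ω τ u, Module.End.mem_eigenspace_iff.2
      ((steklovOpL_eq_smul_iff hτ hρ hlam _).2 (by rwa [h1])), ?_⟩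
    exact (projEquiv_apply hτ hρ _).trans h1
  exact Submodule.finiteDimensional_of_le hle

lemma isSteklovEigenvalue_iff_finrank_ne_zero (hτ : 0 < τ) (hρ : 0 < essInf ρ Ω.surf) (lam : ℝ) :
    IsSteklovEigenvalue Ω τ ρ lam ↔ Module.finrank ℝ (steklovEigenspace Ω τ ρ lam) ≠ 0 := by
  have := finiteDimensional_steklovEigenspace hτ hρ lam
  rw [Ne, Submodule.finrank_eq_zero, ← Ne, Submodule.ne_bot_iff]
  exact exists_congr fun u => and_comm

lemma finite_setOf_isSteklovEigenvalue_le (hτ : 0 < τ) (hρ : 0 < essInf ρ Ω.surf) (a : ℝ) :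
    {l | l ≤ a ∧ IsSteklovEigenvalue Ω τ ρ l}.Finite := by
  have := t0Space_H2modR hτ hρ
  let : NormedAddCommGroup (H2modR Ω τ) := normedAddCommGroupOfT0 _
  have ha : 0 < (max a 1)⁻¹ := inv_pos.2 (lt_max_of_lt_right one_pos)
  have hfin := finite_setOf_hasEigenvalue (isCompactOperator_steklovOpL hτ hρ)
    (isSymmetric_steklovOpL hτ hρ) ha
  refine ((hfin.image fun μ => μ⁻¹).insert 0).subset ?_
  rintro l ⟨hla, hl⟩
  by_cases h0 : l = 0
  · exact Or.inl h0
  have hpos : 0 < l := lt_of_le_of_ne (hl.nonneg hτ hρ) (Ne.symm h0)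
  refine Or.inr ⟨l⁻¹, ⟨?_, (isSteklovEigenvalue_iff_hasEigenvalue hτ hρ h0).1 hl⟩, inv_inv l⟩
  rw [abs_of_pos (inv_pos.2 hpos)]
  exact inv_anti₀ hpos (hla.trans (le_max_left _ _))

lemma infinite_setOf_isSteklovEigenvalue (hN : 2 ≤ N) (hτ : 0 < τ) (hρ : 0 < essInf ρ Ω.surf) :
    {l | IsSteklovEigenvalue Ω τ ρ l}.Infinite := by
  intro hfin
  have := t0Space_H2modR hτ hρ
  have := completeSpace_H2modR hτ hρ
  let : NormedAddCommGroup (H2modR Ω τ) := normedAddCommGroupOfT0 _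
  refine not_finiteDimensional_range_steklovOpL hN hτ hρ
    (finiteDimensional_range_of_finite_hasEigenvalue (isCompactOperator_steklovOpL hτ hρ)
      (isSymmetric_steklovOpL hτ hρ) ((hfin.image fun μ => μ⁻¹).subset ?_))
  rintro μ ⟨hμ, h⟩
  refine ⟨μ⁻¹, (isSteklovEigenvalue_iff_hasEigenvalue hτ hρ (inv_ne_zero hμ)).2 ?_, inv_inv μ⟩
  rwa [inv_inv]

lemma hasEigenvalue_steklovOpL_iff (hτ : 0 < τ) (hρ : 0 < essInf ρ Ω.surf) {μ : ℝ} (hμ : μ ≠ 0) :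
    Module.End.HasEigenvalue (steklovOpL hτ hρ : H2modR Ω τ →ₗ[ℝ] H2modR Ω τ) μ ↔
      ∃ lam : ℝ, 0 < lam ∧ IsSteklovEigenvalue Ω τ ρ lam ∧ μ = lam⁻¹ := by
  constructor
  · intro h
    have h1 := (isSteklovEigenvalue_iff_hasEigenvalue hτ hρ (inv_ne_zero hμ)).2 (by rwa [inv_inv])
    exact ⟨μ⁻¹, lt_of_le_of_ne (h1.nonneg hτ hρ) (inv_ne_zero hμ).symm, h1, (inv_inv μ).symm⟩
  · rintro ⟨lam, hlam, h, rfl⟩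
    exact (isSteklovEigenvalue_iff_hasEigenvalue hτ hρ hlam.ne').1 h

lemma exists_steklovEigenvalue_sequence (hN : 2 ≤ N) (hτ : 0 < τ) (hρ : 0 < essInf ρ Ω.surf) :
    ∃ lam : ℕ → ℝ, Monotone lam ∧ Tendsto lam atTop atTop ∧
      range lam = {l | IsSteklovEigenvalue Ω τ ρ l} ∧
      (∀ l : ℝ, {j | lam j = l}.ncard = Module.finrank ℝ (steklovEigenspace Ω τ ρ l)) ∧
      lam 0 = 0 ∧ 0 < lam 1 := by
  have hiff := isSteklovEigenvalue_iff_finrank_ne_zero (Ω := Ω) (ρ := ρ) hτ hρ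
  have hfin := finite_setOf_isSteklovEigenvalue_le hτ hρ
  have hinf := infinite_setOf_isSteklovEigenvalue hN hτ hρ
  simp only [hiff] at hfin hinf
  obtain ⟨lam, hmono, hlim, hrange, hcard⟩ := exists_monotone_enumeration _ hfin hinf
  simp only [← hiff] at hrange
  have hmem : ∀ j, IsSteklovEigenvalue Ω τ ρ (lam j) := fun j =>
    (Set.ext_iff.1 hrange (lam j)).1 (mem_range_self j)
  have hcard0 := hcard 0
  rw [steklovEigenspace_zero hτ ρ, finrank_constants hρ] at hcard0
  have h0 : lam 0 = 0 := by
    obtain ⟨j, hj⟩ := ncard_eq_one.1 hcard0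
    have hj' : lam j = 0 := (Set.ext_iff.1 hj j).2 rfl
    exact le_antisymm (hj' ▸ hmono (Nat.zero_le j)) ((hmem 0).nonneg hτ hρ)
  refine ⟨lam, hmono, hlim, hrange, hcard, h0,
    lt_of_le_of_ne ((hmem 1).nonneg hτ hρ) fun h1 => ?_⟩
  have : ({0, 1} : Set ℕ) ⊆ {j | lam j = 0} := by
    rintro j (rfl | rfl)
    · exact h0
    · exact h1.symm
  have h2 := ncard_le_ncard this (finite_of_ncard_ne_zero (by rw [hcard0]; exact one_ne_zero))
  rw [hcard0, ncard_pair zero_ne_one] at h2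
  omega

end BiharmonicSteklov

end

theorem mainTheorem11 {N : ℕ} (hN : 2 ≤ N) (Ω : BoundedC1Domain N) (τ : ℝ≥0) (hτ : 0 < τ)
    (ρ : Weight Ω) (hρ : 0 < essInf ρ Ω.surf) :
    -- the objects that enter the definition of the operator are well defined:
    -- trace operator, Hilbert space `H²(Ω)/ℝ`, maps `π♯` and `𝒫`
    (DenseRange (smoothToH1 Ω) ∧ ∀ f : smoothFunctions N,
      traceH1 Ω (smoothToH1 Ω f) = smoothToBdry Ω f) ∧
    (T0Space (H2modR Ω τ) ∧ CompleteSpace (H2modR Ω τ)) ∧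
    ((∀ u : H2 Ω, piSharp Ω τ ρ (proj Ω τ u) = piMap Ω ρ u) ∧
      BijOn (piSharp Ω τ ρ) univ (H2rho Ω ρ)) ∧
    Function.Bijective (steklovP Ω τ ρ) ∧
    -- the operator is a compact, selfadjoint, non-negative bounded linear operator, and its
    -- (nonzero) eigenvalues are the reciprocals of the positive Steklov eigenvalues
    -- (a bounded everywhere defined symmetric operator on a Hilbert space is selfadjoint)
    (∃ T : H2modR Ω τ →L[ℝ] H2modR Ω τ,
      (∀ x, T x = steklovOp Ω τ ρ x) ∧
      IsCompactOperator T ∧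
      (T : H2modR Ω τ →ₗ[ℝ] H2modR Ω τ).IsSymmetric ∧
      (∀ x, 0 ≤ inner ℝ (T x) x) ∧
      ∀ μ : ℝ, μ ≠ 0 →
        (Module.End.HasEigenvalue (T : H2modR Ω τ →ₗ[ℝ] H2modR Ω τ) μ ↔
          ∃ lam : ℝ, 0 < lam ∧ IsSteklovEigenvalue Ω τ ρ lam ∧ μ = lam⁻¹)) ∧
    -- all Steklov eigenvalues are non-negative and of finite multiplicity
    (∀ lam : ℝ, IsSteklovEigenvalue Ω τ ρ lam → 0 ≤ lam) ∧
    (∀ lam : ℝ, FiniteDimensional ℝ (steklovEigenspace Ω τ ρ lam)) ∧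
    -- they form a sequence increasing to infinity, each repeated according to its multiplicity;
    -- `lam j` is the `(j + 1)`-st eigenvalue; the first one is zero and the second is positive
    (∃ lam : ℕ → ℝ, Monotone lam ∧ Tendsto lam atTop atTop ∧
      range lam = {l | IsSteklovEigenvalue Ω τ ρ l} ∧
      (∀ l : ℝ, {j | lam j = l}.ncard = Module.finrank ℝ (steklovEigenspace Ω τ ρ l)) ∧
      lam 0 = 0 ∧ 0 < lam 1) ∧
    -- the eigenvalue zero is simple, its eigenfunctions being the constants
    steklovEigenspace Ω τ ρ 0 = constants Ω ∧
    Module.finrank ℝ (steklovEigenspace Ω τ ρ 0) = 1 := by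
  refine ⟨⟨denseRange_smoothToH1 Ω, traceH1_smoothToH1 Ω⟩,
    ⟨t0Space_H2modR hτ hρ, completeSpace_H2modR hτ hρ⟩, ⟨piSharp_proj hρ, bijOn_piSharp hρ⟩,
    bijective_steklovP hτ hρ,
    ⟨steklovOpL hτ hρ, steklovOpL_apply hτ hρ, isCompactOperator_steklovOpL hτ hρ,
      isSymmetric_steklovOpL hτ hρ, fun x => ?_,
      fun μ hμ => hasEigenvalue_steklovOpL_iff hτ hρ hμ⟩,
    fun lam h => h.nonneg hτ hρ, finiteDimensional_steklovEigenspace hτ hρ,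
    exists_steklovEigenvalue_sequence hN hτ hρ, steklovEigenspace_zero hτ ρ, ?_⟩
  · rw [inner_steklovOpL]
    exact steklovJ_trace_self_nonneg hρ _
  · rw [steklovEigenspace_zero hτ ρ]
    exact finrank_constants hρ
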